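/- **Setting.** For $p\in\{0,1,2\}$ let $\langle x,y\rangle_p=-\sum_{i\le p}x_iy_i+\sum_{i>p}x_iy_i$ on $\mathbb R^3$, $I_p$ the diagonal matrix of this form, $\mathbb S^2_p=\{x\in\mathbb R^3:\langle x,x\rangle_p=1\}$ with the induced metric $g$, $j_x(v)=-I_p(x\times v)$ and $\omega=g(j\cdot,\cdot)$. On $\mathbb S^2_p\times\mathbb S^2_p$ put $J_1=j\oplus j$, $J_2=j\oplus(-j)$, $\Omega_1=\pi_1^*\omega-\pi_2^*\omega$, $\Omega_2=\pi_1^*\omega+\pi_2^*\omega$ and let $G=g\oplus(-g)$ be the neutral metric. Let $\Sigma$ be an oriented smooth surface and $F:\Sigma\to\mathbb S^2_p\times\mathbb S^2_p$ a smooth immersion whose induced metric $F^*G$ is either Riemannian (positive definite; put $\epsilon=1$) or Lorentzian (put $\epsilon=-1$). Let $\omega_\Sigma$ be the area form of $F^*G$ (normalised by $\omega_\Sigma(e_1,e_2)=\epsilon$ on oriented orthonormal frames with $|e_1|^2=\epsilon|e_2|^2=1$) and let the Kähler functions $C_1,C_2:\Sigma\to\mathbb R$ be defined by $F^*\Omega_k=C_k\,\omega_\Sigma$.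 A point of $\Sigma$ is a (para-)complex point if its tangent plane is preserved by $J_1$ or by $J_2$. An isothermal coordinate $z=x+iy$, with $i^2=-\epsilon$, is one with $\langle F_x,F_y\rangle=0$ and $\langle F_x,F_x\rangle=\epsilon\langle F_y,F_y\rangle=\sigma e^{2u}$, where $\langle\cdot,\cdot\rangle$ is $G$ (extended bilinearly to (para-)complex vectors), $\sigma=1$ if $\epsilon=1$, and $\sigma\in\{1,-1\}$ if $\epsilon=-1$. Put $\partial_z=\frac12(\partial_x-\epsilon i\,\partial_y)$, $\partial_{\bar z}=\frac12(\partial_x+\epsilon i\,\partial_y)$ (so $v_{z\bar z}=\frac14(v_{xx}+\epsilon v_{yy})$ for real $v$), $|a+bi|=\sqrt{|a^2+\epsilon b^2|}$ and $M=|\langle J_1F_z,J_2F_z\rangle|$. **Proposition 11.** Let $F$ be minimal (its mean curvature vector vanishes) and without (para-)complex points. The following equations hold in every isothermal coordinate. **(1)** If $p\in\{0,2\}$ and $F^*G$ is Riemannian, the functions $$v=\tfrac12\log\sqrt{\frac{|C_1+1||C_2+1|}{|C_1-1||C_2-1|}},\qquad w=\tfrac12\log\sqrt{\frac{|C_1-1||C_2+1|}{|C_1+1||C_2-1|}}\qquad(*)$$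 are smooth on $\Sigma$, and for $\lambda\in\{-1,1\}$, wherever $\lambda C_1C_2>0$, $$v_{z\bar z}+\lambda\tfrac M4\sinh 2v=0,\qquad w_{z\bar z}+\lambda\tfrac M4\sinh 2w=0.$$ **(2)** If $p=1$ and $F^*G$ is Lorentzian, the functions $v,w$ of $(*)$ are smooth on the set where $|C_1|\neq1$ and $|C_2|\ne1$, and: wherever $|C_1|<1$ and $|C_2|<1$, $$v_{z\bar z}+\sigma\tfrac M4\sinh 2v=0,\qquad w_{z\bar z}-\sigma\tfrac M4\sinh 2w=0;$$ wherever $|C_1|>1$, $|C_2|>1$ and $\lambda C_1C_2>0$ with $\lambda\in\{-1,1\}$, $$v_{z\bar z}+\sigma\lambda\tfrac M4\sinh 2v=0,\qquad w_{z\bar z}+\sigma\lambda\tfrac M4\sinh 2w=0.$$ **(3)** If $p=1$ and $F^*G$ is Riemannian, the functions $v=\frac12(\arctan C_1+\arctan C_2)$ and $w=\frac12(\arctan C_1-\arctan C_2)$ are smooth on $\Sigma$ and $$v_{z\bar z}+\tfrac M4\sin 2v=0,\qquad w_{z\bar z}-\tfrac M4\sin 2w=0.$$ **(4)** If $p\in\{0,2\}$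 and $F^*G$ is Lorentzian, the same functions $v,w$ as in (3) are smooth on $\Sigma$ and $$v_{z\bar z}+\sigma\tfrac M4\sin 2v=0,\qquad w_{z\bar z}-\sigma\tfrac M4\sin 2w=0.$$ -/

import Mathlib

open scoped Manifold ContDiff

noncomputable section

namespace NeutralSurface

/-! ### The ambient space -/

/-- The ambient vector space `ℝ³ × ℝ³`, which contains `𝕊²_p × 𝕊²_p`. -/
abbrev Amb : Type := (Fin 3 → ℝ) × (Fin 3 → ℝ)

/-- The sign of the `i`-th coordinate in the metric with `p` minus signs (first coordinates). -/
def sgn (K : Type*) [CommRing K] (p : ℕ) (i : Fin 3) : K := if (i : ℕ) < p then -1 else 1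

/-- `⟨x, y⟩_p = -∑_{i ≤ p} x_i y_i + ∑_{i > p} x_i y_i`; for a commutative ring `K` containing `ℝ`
this is the bilinear extension of the real metric. -/
def ip {K : Type*} [CommRing K] (p : ℕ) (x y : Fin 3 → K) : K := ∑ i, sgn K p i * x i * y i

/-- The quadric `𝕊²_p = {x ∈ ℝ³ : ⟨x, x⟩_p = 1}`. -/
def quadric (p : ℕ) : Set (Fin 3 → ℝ) := {x | ip p x x = 1}

/-- The cross product adapted to `⟨·,·⟩_p`, namely `I_p (x × y)` with `I_p = diag (sgn p)`; it is
characterised by `⟨cross p x y, w⟩_p = det (x, y, w)`. -/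
def cross {K : Type*} [CommRing K] (p : ℕ) (x y : Fin 3 → K) : Fin 3 → K :=
  fun i => sgn K p i * crossProduct x y i

/-- The (para-)complex structure `j_x v = - x × v` of `𝕊²_p` (extended linearly in `v`). -/
def jmap {K : Type*} [CommRing K] (p : ℕ) (x v : Fin 3 → K) : Fin 3 → K := - cross p x v

/-- `J₁ = j ⊕ j` at the point `x`. -/
def J1 {K : Type*} [CommRing K] (p : ℕ) (x X : (Fin 3 → K) × (Fin 3 → K)) :
    (Fin 3 → K) × (Fin 3 → K) := (jmap p x.1 X.1, jmap p x.2 X.2)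

/-- `J₂ = j ⊕ (-j)` at the point `x`. -/
def J2 {K : Type*} [CommRing K] (p : ℕ) (x X : (Fin 3 → K) × (Fin 3 → K)) :
    (Fin 3 → K) × (Fin 3 → K) := (jmap p x.1 X.1, - jmap p x.2 X.2)

/-- The neutral metric `G = g ⊕ (-g)` (and its bilinear extension). -/
def G {K : Type*} [CommRing K] (p : ℕ) (X Y : (Fin 3 → K) × (Fin 3 → K)) : K :=
  ip p X.1 Y.1 - ip p X.2 Y.2

/-- The Kähler form `ω = g(j·,·)` of `𝕊²_p` at the point `x`. -/
def kform (p : ℕ) (x v w : Fin 3 → ℝ) : ℝ := ip p (jmap p x v) w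

/-- `Ω₁ = π₁^*ω - π₂^*ω` at the point `x`. -/
def Omega1 (p : ℕ) (x X Y : Amb) : ℝ := kform p x.1 X.1 Y.1 - kform p x.2 X.2 Y.2

/-- `Ω₂ = π₁^*ω + π₂^*ω` at the point `x`. -/
def Omega2 (p : ℕ) (x X Y : Amb) : ℝ := kform p x.1 X.1 Y.1 + kform p x.2 X.2 Y.2

/-! ### Calculus in the coordinate plane -/

/-- The coordinate plane. -/
abbrev Plane : Type := EuclideanSpace ℝ (Fin 2)

/-- The partial derivative `∂f/∂x_i` of a map on the coordinate plane
(`i = 0` is the coordinate `x`, `i = 1` is the coordinate `y`). -/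
def pd {W : Type*} [NormedAddCommGroup W] [NormedSpace ℝ W] (i : Fin 2) (f : Plane → W)
    (x : Plane) : W := fderiv ℝ f x (EuclideanSpace.single i (1 : ℝ))

/-- `h_{z z̄}` for a real function `h`, where `z = x + i y` with `i² = -ε`,
`∂_z = (∂_x - ε i ∂_y) / 2` and `∂_z̄ = (∂_x + ε i ∂_y) / 2`. -/
def dzdzbar (ε : ℝ) (h : Plane → ℝ) (x : Plane) : ℝ :=
  (pd 0 (pd 0 h) x + ε * pd 1 (pd 1 h) x) / 4

/-! ### (Para-)complex vectors -/

/-- The (para-)complex numbers `a + b i` with `i² = -ε`. -/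
abbrev PC (ε : ℝ) : Type := QuadraticAlgebra ℝ (-ε) 0

/-- The modulus of a (para-)complex number; the norm of `a + b i` is `a² + ε b²`. -/
def modulus {ε : ℝ} (ζ : PC ε) : ℝ := Real.sqrt |QuadraticAlgebra.norm ζ|

/-- A real vector seen as a (para-)complex one. -/
def toPC (ε : ℝ) (X : Amb) : (Fin 3 → PC ε) × (Fin 3 → PC ε) :=
  (fun i => ⟨X.1 i, 0⟩, fun i => ⟨X.2 i, 0⟩)

/-- `f_z = (f_x - ε i f_y) / 2`. -/
def dz (ε : ℝ) (f : Plane → Amb) (x : Plane) : (Fin 3 → PC ε) × (Fin 3 → PC ε) :=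
  (fun i => ⟨(pd 0 f x).1 i / 2, - ε * (pd 1 f x).1 i / 2⟩,
    fun i => ⟨(pd 0 f x).2 i / 2, - ε * (pd 1 f x).2 i / 2⟩)

/-- The number `|⟨J₁ f_z, J₂ f_z⟩|`. -/
def absJJ (p : ℕ) (ε : ℝ) (f : Plane → Amb) (x : Plane) : ℝ :=
  modulus (G p (J1 p (toPC ε (f x)) (dz ε f x)) (J2 p (toPC ε (f x)) (dz ε f x)))

/-! ### Local geometry of a parametrised surface -/

/-- The coefficient `g_{ij}` of the metric induced by `G`. -/
def met (p : ℕ) (f : Plane → Amb) (i j : Fin 2) (x : Plane) : ℝ := G p (pd i f x) (pd j f x)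

/-- The determinant `g₁₁ g₂₂ - g₁₂²` of the induced metric. -/
def metDet (p : ℕ) (f : Plane → Amb) (x : Plane) : ℝ :=
  met p f 0 0 x * met p f 1 1 x - met p f 0 1 x ^ 2

/-- The value `ω_Σ(∂_x, ∂_y)` of the area form in positively oriented coordinates, normalised by
`ω_Σ(e₁, e₂) = ε` for oriented orthonormal frames with `|e₁|² = ε |e₂|² = 1`. As `ε` is the sign
of the determinant `D` of the metric, the value is `ε √|D| = D / √|D|`. -/
def areaForm (p : ℕ) (f : Plane → Amb) (x : Plane) : ℝ :=
  metDet p f x / Real.sqrt |metDet p f x|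

/-- `N` is normal to the parametrised surface `f` in `𝕊²_p × 𝕊²_p` at the parameter `x`: it is
tangent to `𝕊²_p × 𝕊²_p` at `f x` and `G`-orthogonal to the surface. -/
def IsNormalAt (p : ℕ) (f : Plane → Amb) (x : Plane) (N : Amb) : Prop :=
  ip p (f x).1 N.1 = 0 ∧ ip p (f x).2 N.2 = 0 ∧ ∀ i, G p (pd i f x) N = 0

/-- The component `G(h(∂_i, ∂_j), N)` of the second fundamental form along a normal vector `N`.
The Levi-Civita connection of `G` is the tangential projection of the flat derivative, so this is
`G(f_{ij}, N)`. -/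
def sff (p : ℕ) (f : Plane → Amb) (i j : Fin 2) (x : Plane) (N : Amb) : ℝ :=
  G p (pd i (pd j f) x) N

/-- `G(H, N)` for the mean curvature vector `H`, half of the trace of the second fundamental form
with respect to the induced metric. -/
def meanCurv (p : ℕ) (f : Plane → Amb) (x : Plane) (N : Amb) : ℝ :=
  (met p f 1 1 x * sff p f 0 0 x N - 2 * met p f 0 1 x * sff p f 0 1 x N
    + met p f 0 0 x * sff p f 1 1 x N) / (2 * metDet p f x)

/-! ### Surfaces -/

section Surface

variable {S : Type*} [TopologicalSpace S] [ChartedSpace Plane S]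

/-- The charts of the smooth surface `S` (its maximal smooth atlas). -/
abbrev Charts (S : Type*) [TopologicalSpace S] [ChartedSpace Plane S] :
    Set (OpenPartialHomeomorph S Plane) := IsManifold.maximalAtlas (𝓡 2) ∞ S

/-- An orientation of the surface, given by an oriented atlas: charts that cover the surface and
whose coordinate changes have positive Jacobian. -/
structure IsOrientedAtlas (A : Set (OpenPartialHomeomorph S Plane)) : Prop where
  subset : A ⊆ Charts S
  cover : ∀ q : S, ∃ e ∈ A, q ∈ e.source
  pos : ∀ e ∈ A, ∀ e' ∈ A, ∀ q ∈ e.source ∩ e'.source,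
    0 < (fderiv ℝ (fun x => e' (e.symm x)) (e q)).det

/-- The differential of `F : S → 𝕊²_p × 𝕊²_p ⊆ ℝ³ × ℝ³` at `q`. -/
def dF (F : S → Amb) (q : S) : TangentSpace (𝓡 2) q →L[ℝ] Amb := mfderiv (𝓡 2) 𝓘(ℝ, Amb) F q

/-- `F` is a smooth immersion of `S` into `𝕊²_p × 𝕊²_p`. -/
structure IsImmersionInto (p : ℕ) (F : S → Amb) : Prop where
  smooth : ContMDiff (𝓡 2) 𝓘(ℝ, Amb) ∞ F
  mem : ∀ q, (F q).1 ∈ quadric p ∧ (F q).2 ∈ quadric p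
  inj : ∀ q, Function.Injective (dF F q)

/-- The induced metric `F^*G` is Riemannian (positive definite). -/
def IsRiemannian (p : ℕ) (F : S → Amb) : Prop :=
  ∀ (q : S) (X : TangentSpace (𝓡 2) q), X ≠ 0 → 0 < G p (dF F q X) (dF F q X)

/-- The induced metric `F^*G` is Lorentzian (of signature `(1,1)`; the surface has dimension 2, so
this says that both signs occur). -/
def IsLorentzian (p : ℕ) (F : S → Amb) : Prop :=
  ∀ q : S, (∃ X : TangentSpace (𝓡 2) q, 0 < G p (dF F q X) (dF F q X)) ∧
    ∃ Y : TangentSpace (𝓡 2) q, G p (dF F q Y) (dF F q Y) < 0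

/-- `F` is minimal: its mean curvature vector vanishes. -/
def IsMinimal (p : ℕ) (F : S → Amb) : Prop :=
  ∀ e ∈ Charts S, ∀ x ∈ e.target, ∀ N : Amb, IsNormalAt p (F ∘ e.symm) x N →
    meanCurv p (F ∘ e.symm) x N = 0

/-- `q` is a (para-)complex point of `F` with respect to `J₁` or to `J₂`: the tangent plane is
preserved by `J₁` or by `J₂`. -/
def IsComplexPoint (p : ℕ) (F : S → Amb) (q : S) : Prop :=
  (∀ X, ∃ Y, J1 p (F q) (dF F q X) = dF F q Y) ∨ (∀ X, ∃ Y, J2 p (F q) (dF F q X) = dF F q Y)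

/-- `C₁`, `C₂` are the Kähler functions of `F` for the orientation given by the oriented atlas `A`:
`F^*Ω_k = C_k ω_Σ`. -/
def IsKahlerPair (p : ℕ) (A : Set (OpenPartialHomeomorph S Plane)) (F : S → Amb)
    (C₁ C₂ : S → ℝ) : Prop :=
  ∀ e ∈ A, ∀ x ∈ e.target,
    Omega1 p (F (e.symm x)) (pd 0 (F ∘ e.symm) x) (pd 1 (F ∘ e.symm) x)
        = C₁ (e.symm x) * areaForm p (F ∘ e.symm) x ∧
      Omega2 p (F (e.symm x)) (pd 0 (F ∘ e.symm) x) (pd 1 (F ∘ e.symm) x)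
        = C₂ (e.symm x) * areaForm p (F ∘ e.symm) x

/-- `e` is an isothermal chart: `⟨F_x, F_y⟩ = 0` and `⟨F_x, F_x⟩ = ε ⟨F_y, F_y⟩ = σ e^{2u}`, where
`σ = 1` or `σ = -1`. In a Lorentzian surface (`ε = -1`) the sign `σ` tells whether `∂_x` or `∂_y`
is the direction of positive length. -/
def IsIsothermal (p : ℕ) (ε σ : ℝ) (F : S → Amb) (e : OpenPartialHomeomorph S Plane) : Prop :=
  e ∈ Charts S ∧ ∀ x ∈ e.target, met p (F ∘ e.symm) 0 1 x = 0 ∧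
    met p (F ∘ e.symm) 0 0 x = ε * met p (F ∘ e.symm) 1 1 x ∧
    0 < σ * met p (F ∘ e.symm) 0 0 x

/-- The left-hand side `v_{z z̄} + κ |⟨J₁F_z, J₂F_z⟩| / 4 * φ(2 v)` of a (sinh- or sine-)Gordon
equation in the chart `e`, at the parameter `x`. -/
def gordon (p : ℕ) (ε : ℝ) (F : S → Amb) (e : OpenPartialHomeomorph S Plane) (κ : ℝ)
    (φ : ℝ → ℝ) (v : S → ℝ) (x : Plane) : ℝ :=
  dzdzbar ε (v ∘ e.symm) x
    + κ * (absJJ p ε (F ∘ e.symm) x / 4) * φ (2 * v (e.symm x))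

end Surface

/-- `v` with `2v = log √(|C₁+1||C₂+1| / (|C₁-1||C₂-1|))`. -/
def vLog (c₁ c₂ : ℝ) : ℝ :=
  Real.log (Real.sqrt ((|c₁ + 1| * |c₂ + 1|) / (|c₁ - 1| * |c₂ - 1|))) / 2

/-- `w` with `2w = log √(|C₁-1||C₂+1| / (|C₁+1||C₂-1|))`. -/
def wLog (c₁ c₂ : ℝ) : ℝ :=
  Real.log (Real.sqrt ((|c₁ - 1| * |c₂ + 1|) / (|c₁ + 1| * |c₂ - 1|))) / 2

/-- `v = (arctan C₁ + arctan C₂) / 2`. -/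
def vArctan (c₁ c₂ : ℝ) : ℝ := (Real.arctan c₁ + Real.arctan c₂) / 2

/-- `w = (arctan C₁ - arctan C₂) / 2`. -/
def wArctan (c₁ c₂ : ℝ) : ℝ := (Real.arctan c₁ - Real.arctan c₂) / 2

end NeutralSurface

end

open scoped Manifold ContDiff

noncomputable section

namespace NeutralSurface

/-! ### Algebra of the form `ip p` -/

/-! In an isothermal coordinate, minimality of F = (φ, ψ) says that φ and ψ are both harmonic for
dx² + ε dy² (`IsMinimalPatch.laplacian_eq`). The tangential part of the relevant vector vanishes by
conformality, the normal part by minimality. Everything then reduces to one harmonic map into the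
quadric, with energy T and Jacobian a.

Write δ = ε · `disc p`, E = |F_x|², and κ for a sign. Comparing the Gram determinants of φ and ψ,
whose metrics differ by the conformal one, gives for the first factor T = E(1 + δ C₁C₂) and a =
-(κ/2) E (C₁ + C₂) (`energy_eq`, `jac_eq`). Up to the factor -κ, the quotient 2a/T is therefore (C₁
+ C₂)/(1 + δ C₁C₂). This is the addition formula of tanh or coth when δ = 1 and of tan when δ = -1.
Hence v, half the sum of the inverse functions of C₁ and C₂, is a primitive of κ(a dT - T da)/R with
R = T² - 4δa² = E²(1 - δC₁²)(1 - δC₂²).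

The analytic core is the Bochner-type formula `laplacian_potential`: any such primitive satisfies
v_xx + ε v_yy = κ a. The Laplacians of T and a bring in the covariant second derivatives of φ, and
these cancel against the derivatives of R by the pointwise polynomial identity `bochner_identity`.

Two remarks turn κ a into a Gordon term. First, ⟨J₁F_z, J₂F_z⟩ is up to sign twice the Hopf
differential of φ, so M = √|R|/2 (`absJJ_eq`). Second, sinh 2v or sin 2v times √|(1 - δC₁²)(1 -
δC₂²)| equals ±(C₁ + C₂) (`sinh_vLog`, `sin_vArctan`). The second factor has the same form, with E
replaced by -E and one Kähler function changing sign, and yields the equation for w.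

For δ = -1 the denominators 1 + C_k² never vanish. For p ∈ {0, 2} and a Riemannian metric, C_k² = 1
would make the tangent plane J_k-invariant (`one_sub_sq_ne_zero`), and the signs of the energy and
of the squared Hopf differential then force |C_k| > 1 (`one_lt_abs`). -/

/-- The determinant `det (x, y, z)`. -/
def triple (x y z : Fin 3 → ℝ) : ℝ :=
  x 0 * (y 1 * z 2 - y 2 * z 1) + x 1 * (y 2 * z 0 - y 0 * z 2) + x 2 * (y 0 * z 1 - y 1 * z 0)

/-- The determinant of the form `ip p`. -/
def disc (p : ℕ) : ℝ := sgn ℝ p 0 * sgn ℝ p 1 * sgn ℝ p 2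

lemma sgn_mul_self {K : Type*} [CommRing K] (p : ℕ) (i : Fin 3) : sgn K p i * sgn K p i = 1 := by
  unfold sgn; split_ifs <;> simp

lemma disc_mul_self (p : ℕ) : disc p * disc p = 1 := by
  have h0 := sgn_mul_self (K := ℝ) p 0
  have h1 := sgn_mul_self (K := ℝ) p 1
  have h2 := sgn_mul_self (K := ℝ) p 2
  unfold disc
  calc _ = (sgn ℝ p 0 * sgn ℝ p 0) * (sgn ℝ p 1 * sgn ℝ p 1) * (sgn ℝ p 2 * sgn ℝ p 2) := by ring
    _ = 1 := by rw [h0, h1, h2]; ring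

lemma ip_eq {K : Type*} [CommRing K] (p : ℕ) (x y : Fin 3 → K) :
    ip p x y = sgn K p 0 * x 0 * y 0 + sgn K p 1 * x 1 * y 1 + sgn K p 2 * x 2 * y 2 := by
  simp [ip, Fin.sum_univ_three]

section ring
variable {K : Type*} [CommRing K] (p : ℕ) (x y z : Fin 3 → K) (c : K)

lemma ip_comm : ip p x y = ip p y x := by simp only [ip_eq]; ring
lemma ip_add_left : ip p (x + y) z = ip p x z + ip p y z := by
  simp only [ip_eq, Pi.add_apply]; ring
lemma ip_add_right : ip p x (y + z) = ip p x y + ip p x z := by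
  simp only [ip_eq, Pi.add_apply]; ring
lemma ip_sub_right : ip p x (y - z) = ip p x y - ip p x z := by
  simp only [ip_eq, Pi.sub_apply]; ring
lemma ip_neg_left : ip p (-x) y = -ip p x y := by
  simp only [ip_eq, Pi.neg_apply]; ring
lemma ip_neg_right : ip p x (-y) = -ip p x y := by
  simp only [ip_eq, Pi.neg_apply]; ring
lemma ip_smul_left : ip p (c • x) y = c * ip p x y := by
  simp only [ip_eq, Pi.smul_apply, smul_eq_mul]; ring
lemma ip_smul_right : ip p x (c • y) = c * ip p x y := by
  simp only [ip_eq, Pi.smul_apply, smul_eq_mul]; ring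
lemma ip_zero_left : ip p 0 x = 0 := by simp [ip_eq]
lemma ip_zero_right : ip p x 0 = 0 := by simp [ip_eq]

end ring

/-- The matrix I_p enters once through j and once through the metric, and its square is the
identity. The Kähler form is thus independent of p up to the domain. -/
lemma kform_eq (p : ℕ) (x v w : Fin 3 → ℝ) : kform p x v w = - triple x v w := by
  have h0 := sgn_mul_self (K := ℝ) p 0
  have h1 := sgn_mul_self (K := ℝ) p 1
  have h2 := sgn_mul_self (K := ℝ) p 2
  simp only [kform, jmap, cross, ip_eq, triple, cross_apply, Pi.neg_apply, Matrix.cons_val_zero,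
    Matrix.cons_val_one, Matrix.cons_val]
  linear_combination -(x 1 * v 2 - x 2 * v 1) * w 0 * h0 - (x 2 * v 0 - x 0 * v 2) * w 1 * h1
    - (x 0 * v 1 - x 1 * v 0) * w 2 * h2

/-- This is det(AᵀI_pA) = det(I_p) det(A)² for the matrix A with columns x, y, z. -/
lemma gram_triple (p : ℕ) (x y z : Fin 3 → ℝ) :
    disc p * triple x y z ^ 2 = ip p x x * (ip p y y * ip p z z - ip p y z ^ 2)
      - ip p x y * (ip p x y * ip p z z - ip p y z * ip p x z)
      + ip p x z * (ip p x y * ip p y z - ip p y y * ip p x z) := by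
  simp only [ip_eq, triple, disc]; ring

lemma gram_tangent (p : ℕ) {x y z : Fin 3 → ℝ} (hx : ip p x x = 1) (hy : ip p x y = 0)
    (hz : ip p x z = 0) : disc p * triple x y z ^ 2 = ip p y y * ip p z z - ip p y z ^ 2 := by
  rw [gram_triple, hx, hy, hz]; ring

/-- `jmap` multiplies the form by `disc p`. -/
lemma ip_jmap_jmap (p : ℕ) (x v w : Fin 3 → ℝ) :
    ip p (jmap p x v) (jmap p x w)
      = disc p * (ip p x x * ip p v w - ip p x v * ip p x w) := by
  have h0 := sgn_mul_self (K := ℝ) p 0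
  have h1 := sgn_mul_self (K := ℝ) p 1
  have h2 := sgn_mul_self (K := ℝ) p 2
  simp only [jmap, cross, ip_eq, cross_apply, Pi.neg_apply, Matrix.cons_val_zero,
    Matrix.cons_val_one, Matrix.cons_val, disc]
  generalize sgn ℝ p 0 = a at *
  generalize sgn ℝ p 1 = b at *
  generalize sgn ℝ p 2 = c at *
  linear_combination
    (a * (x 1 * v 2 - x 2 * v 1) * (x 1 * w 2 - x 2 * w 1)
      - b * (x 2 * v 0 - x 0 * v 2) * (x 2 * w 0 - x 0 * w 2)
      - c * b * b * (x 0 * v 1 - x 1 * v 0) * (x 0 * w 1 - x 1 * w 0)) * h0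
    + (b * (x 2 * v 0 - x 0 * v 2) * (x 2 * w 0 - x 0 * w 2)
      - a * c * c * (x 1 * v 2 - x 2 * v 1) * (x 1 * w 2 - x 2 * w 1)
      - c * (x 0 * v 1 - x 1 * v 0) * (x 0 * w 1 - x 1 * w 0)) * h1
    + (c * (x 0 * v 1 - x 1 * v 0) * (x 0 * w 1 - x 1 * w 0)
      - a * (x 1 * v 2 - x 2 * v 1) * (x 1 * w 2 - x 2 * w 1)
      - b * a * a * (x 2 * v 0 - x 0 * v 2) * (x 2 * w 0 - x 0 * w 2)) * h2

/-- The functional ⟨x, ·⟩ is nonzero, so its kernel is a plane. No orthonormality is asked for,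
which lets one frame serve every signature. -/
lemma exists_tangent_frame (p : ℕ) {x : Fin 3 → ℝ} (hx : ip p x x = 1) :
    ∃ u w : Fin 3 → ℝ, ip p x u = 0 ∧ ip p x w = 0 ∧
      ∀ v, ip p x v = 0 → ∃ a b : ℝ, v = a • u + b • w := by
  let L : Module.Dual ℝ (Fin 3 → ℝ) :=
    { toFun := ip p x, map_add' := ip_add_right p x, map_smul' := fun c y => ip_smul_right p x y c }
  have hL : L ≠ 0 := fun h => by
    have : L x = 0 := by rw [h]; rfl
    rw [show L x = 1 from hx] at this
    exact one_ne_zero this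
  have hr := Module.Dual.finrank_ker_add_one_of_ne_zero hL
  rw [Module.finrank_fin_fun] at hr
  let b := Module.finBasisOfFinrankEq ℝ (LinearMap.ker L) (n := 2) (by omega)
  refine ⟨b 0, b 1, (b 0).2, (b 1).2, fun v hv => ⟨b.repr ⟨v, hv⟩ 0, b.repr ⟨v, hv⟩ 1, ?_⟩⟩
  have := congrArg Subtype.val (b.sum_repr ⟨v, hv⟩)
  rw [Fin.sum_univ_two] at this
  exact this.symm

/-- The identity behind the Bochner formula for the density of a harmonic map: the quantities are
polynomials in tangent vectors `X`, `Y` (first derivatives) and `A`, `B` (covariant second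
derivatives in the directions `xx` and `xy`; the direction `yy` is then `-ε A`). -/
lemma bochner_identity (p : ℕ) {ε : ℝ} (hε : ε * ε = 1) {x X Y A B : Fin 3 → ℝ}
    (hx : ip p x x = 1) (hX : ip p x X = 0) (hY : ip p x Y = 0) (hA : ip p x A = 0)
    (hB : ip p x B = 0) {T a Tx Ty ax ay R S D : ℝ}
    (hT : T = ip p X X + ε * ip p Y Y) (ha : a = triple x X Y)
    (hTx : Tx = 2 * ip p A X + 2 * ε * ip p B Y) (hTy : Ty = 2 * ip p B X - 2 * ip p A Y)
    (hax : ax = triple x A Y + triple x X B) (hay : ay = triple x B Y - ε * triple x X A)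
    (hR : R = T ^ 2 - 4 * (ε * disc p) * a ^ 2)
    (hS : S = ip p A A + ε * ip p B B) (hD : D = triple x A B) :
    4 * (a * S - T * D) * R
      = (a * Tx - T * ax) * (2 * T * Tx - 8 * (ε * disc p) * a * ax)
        + ε * ((a * Ty - T * ay) * (2 * T * Ty - 8 * (ε * disc p) * a * ay)) := by
  obtain ⟨u, w, hu, hw, hspan⟩ := exists_tangent_frame p hx
  obtain ⟨X0, X1, rfl⟩ := hspan X hX
  obtain ⟨Y0, Y1, rfl⟩ := hspan Y hY
  obtain ⟨A0, A1, rfl⟩ := hspan A hA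
  obtain ⟨B0, B1, rfl⟩ := hspan B hB
  have hd := gram_tangent p hx hu hw
  have ht : ∀ a b c d : ℝ, triple x (a • u + b • w) (c • u + d • w)
      = (a * d - b * c) * triple x u w := by
    intro a b c d
    simp only [triple, Pi.add_apply, Pi.smul_apply, smul_eq_mul]; ring
  have hi : ∀ a b c d : ℝ, ip p (a • u + b • w) (c • u + d • w)
      = a * c * ip p u u + (a * d + b * c) * ip p u w + b * d * ip p w w := by
    intro a b c d
    simp only [ip_add_left, ip_add_right, ip_smul_left, ip_smul_right, ip_comm p w u]; ring
  simp only [ht] at ha hax hay hD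
  simp only [hi] at hT hTx hTy hS
  generalize disc p = η at *
  generalize ip p u u = E at *
  generalize ip p u w = F at *
  generalize ip p w w = H at *
  generalize triple x u w = d at *
  -- The frame's volume d enters only through `disc p` · d², which is its Gram determinant EH - F².
  -- Substituting this leaves a polynomial identity.
  have hR' : R = T ^ 2 - 4 * ε * (X0 * Y1 - X1 * Y0) ^ 2 * (E * H - F ^ 2) := by
    rw [hR, ha, ← hd]; ring
  have hdd : ∀ m n : ℝ, 8 * (ε * η) * (m * d) * (n * d) = 8 * ε * m * n * (E * H - F ^ 2) := by
    intro m n; rw [← hd]; ring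
  have hax' : ax = ((A0 * Y1 - A1 * Y0) + (X0 * B1 - X1 * B0)) * d := by rw [hax]; ring
  have hay' : ay = ((B0 * Y1 - B1 * Y0) - ε * (X0 * A1 - X1 * A0)) * d := by rw [hay]; ring
  rw [hR', ha, hax', hay', hdd, hdd, hS, hD, hTx, hTy, hT]
  rcases mul_self_eq_one_iff.1 hε with rfl | rfl
  · ring
  · ring

/-! ### Rules for partial derivatives -/

section pd
variable {W : Type*} [NormedAddCommGroup W] [NormedSpace ℝ W] {U : Set Plane} {x : Plane}

lemma ContDiffOn.pd (hU : IsOpen U) {f : Plane → W} (hf : ContDiffOn ℝ ∞ f U) (i : Fin 2) :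
    ContDiffOn ℝ ∞ (pd i f) U :=
  (hf.fderiv_of_isOpen hU (m := ∞) (by simp)).clm_apply contDiffOn_const

lemma differentiableAt_of_contDiffOn (hU : IsOpen U) {f : Plane → W} (hf : ContDiffOn ℝ ∞ f U)
    (hx : x ∈ U) : DifferentiableAt ℝ f x :=
  (hf.contDiffAt (hU.mem_nhds hx)).differentiableAt (by simp)

lemma pd_congr_on (hU : IsOpen U) (hx : x ∈ U) {f g : Plane → W} (h : ∀ y ∈ U, f y = g y)
    (i : Fin 2) : pd i f x = pd i g x := by
  have : f =ᶠ[nhds x] g := Filter.eventuallyEq_of_mem (hU.mem_nhds hx) h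
  unfold NeutralSurface.pd
  rw [this.fderiv_eq]

lemma pd_comm (hU : IsOpen U) (hx : x ∈ U) {f : Plane → W} (hf : ContDiffOn ℝ ∞ f U)
    (i j : Fin 2) : pd i (pd j f) x = pd j (pd i f) x := by
  have hc := hf.contDiffAt (hU.mem_nhds hx)
  have hs : IsSymmSndFDerivAt ℝ f x := hc.isSymmSndFDerivAt (by simpa using ENat.LEInfty.out)
  have hd : DifferentiableAt ℝ (fderiv ℝ f) x :=
    (hc.fderiv_right (m := 1) (by norm_cast)).differentiableAt one_ne_zero
  have key : ∀ k l, pd k (pd l f) x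
      = fderiv ℝ (fderiv ℝ f) x (EuclideanSpace.single k 1) (EuclideanSpace.single l 1) := by
    intro k l
    unfold NeutralSurface.pd
    rw [fderiv_clm_apply hd (differentiableAt_const _)]
    simp
  rw [key, key]
  exact hs _ _

lemma pd_add {f g : Plane → W} (hf : DifferentiableAt ℝ f x) (hg : DifferentiableAt ℝ g x)
    (i : Fin 2) : pd i (fun y => f y + g y) x = pd i f x + pd i g x := by
  unfold NeutralSurface.pd
  rw [fderiv_fun_add hf hg]; rfl

lemma pd_add_add {f g h : Plane → W} (hf : DifferentiableAt ℝ f x) (hg : DifferentiableAt ℝ g x)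
    (hh : DifferentiableAt ℝ h x) (i : Fin 2) :
    pd i (fun y => f y + g y + h y) x = pd i f x + pd i g x + pd i h x := by
  rw [pd_add (hf.fun_add hg) hh, pd_add hf hg]

lemma pd_const_smul {f : Plane → W} (hf : DifferentiableAt ℝ f x) (c : ℝ)
    (i : Fin 2) : pd i (fun y => c • f y) x = c • pd i f x := by
  unfold NeutralSurface.pd
  rw [fderiv_fun_const_smul hf]; rfl

lemma pd_smul {c : Plane → ℝ} {f : Plane → W} (hc : DifferentiableAt ℝ c x)
    (hf : DifferentiableAt ℝ f x) (i : Fin 2) :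
    pd i (fun y => c y • f y) x = c x • pd i f x + pd i c x • f x := by
  unfold NeutralSurface.pd
  rw [fderiv_fun_smul hc hf]; simp

lemma pd_mul {f g : Plane → ℝ} (hf : DifferentiableAt ℝ f x)
    (hg : DifferentiableAt ℝ g x) (i : Fin 2) :
    pd i (fun y => f y * g y) x = f x * pd i g x + g x * pd i f x := by
  unfold NeutralSurface.pd
  rw [fderiv_fun_mul hf hg]; simp

lemma pd_const_mul {f : Plane → ℝ} (hf : DifferentiableAt ℝ f x) (c : ℝ)
    (i : Fin 2) : pd i (fun y => c * f y) x = c * pd i f x :=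
  pd_const_smul hf c i

lemma pd_const (c : W) (i : Fin 2) : pd i (fun _ => c) x = 0 := by
  unfold NeutralSurface.pd
  simp

lemma pd_neg (f : Plane → W) (i : Fin 2) : pd i (fun y => -f y) x = - pd i f x := by
  unfold NeutralSurface.pd
  rw [fderiv_fun_neg]; rfl

lemma pd_sub {f g : Plane → W} (hf : DifferentiableAt ℝ f x) (hg : DifferentiableAt ℝ g x)
    (i : Fin 2) : pd i (fun y => f y - g y) x = pd i f x - pd i g x := by
  unfold NeutralSurface.pd
  rw [fderiv_fun_sub hf hg]; rfl

lemma pd_of_hasDerivAt {f : Plane → ℝ} {φ : ℝ → ℝ} {φ' : ℝ} (hφ : HasDerivAt φ φ' (f x))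
    (hf : DifferentiableAt ℝ f x) (i : Fin 2) : pd i (fun y => φ (f y)) x = φ' * pd i f x := by
  unfold NeutralSurface.pd
  change fderiv ℝ (φ ∘ f) x _ = _
  rw [(hφ.comp_hasFDerivAt x hf.hasFDerivAt).fderiv]; simp

lemma pd_fst {f : Plane → Amb} (hf : DifferentiableAt ℝ f x) (i : Fin 2) :
    pd i (fun y => (f y).1) x = (pd i f x).1 := by
  unfold NeutralSurface.pd
  rw [hf.hasFDerivAt.fst.fderiv]; rfl

lemma pd_snd {f : Plane → Amb} (hf : DifferentiableAt ℝ f x) (i : Fin 2) :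
    pd i (fun y => (f y).2) x = (pd i f x).2 := by
  unfold NeutralSurface.pd
  rw [hf.hasFDerivAt.snd.fderiv]; rfl

lemma pd_apply {f : Plane → Fin 3 → ℝ} (hf : DifferentiableAt ℝ f x) (i : Fin 2) (k : Fin 3) :
    pd i (fun y => f y k) x = pd i f x k := by
  unfold NeutralSurface.pd
  rw [fderiv_apply hf]; rfl

lemma pd_ip (p : ℕ) {f g : Plane → Fin 3 → ℝ} (hf : DifferentiableAt ℝ f x)
    (hg : DifferentiableAt ℝ g x) (i : Fin 2) :
    pd i (fun y => ip p (f y) (g y)) x = ip p (pd i f x) (g x) + ip p (f x) (pd i g x) := by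
  have h1 : ∀ k, DifferentiableAt ℝ (fun y => f y k) x := fun k => differentiableAt_pi.1 hf k
  have h2 : ∀ k, DifferentiableAt ℝ (fun y => g y k) x := fun k => differentiableAt_pi.1 hg k
  have h3 : ∀ k, DifferentiableAt ℝ (fun y => sgn ℝ p k * f y k) x := fun k => (h1 k).const_mul _
  have h4 : ∀ k, DifferentiableAt ℝ (fun y => sgn ℝ p k * f y k * g y k) x :=
    fun k => (h3 k).mul (h2 k)
  simp only [ip_eq]
  rw [pd_add_add (h4 0) (h4 1) (h4 2), pd_mul (h3 0) (h2 0),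
    pd_mul (h3 1) (h2 1), pd_mul (h3 2) (h2 2), pd_const_mul (h1 0), pd_const_mul (h1 1),
    pd_const_mul (h1 2)]
  simp only [pd_apply hf, pd_apply hg]
  ring

lemma pd_triple {f g h : Plane → Fin 3 → ℝ} (hf : DifferentiableAt ℝ f x)
    (hg : DifferentiableAt ℝ g x) (hh : DifferentiableAt ℝ h x) (i : Fin 2) :
    pd i (fun y => triple (f y) (g y) (h y)) x = triple (pd i f x) (g x) (h x)
      + triple (f x) (pd i g x) (h x) + triple (f x) (g x) (pd i h x) := by
  have h1 : ∀ k, DifferentiableAt ℝ (fun y => f y k) x := fun k => differentiableAt_pi.1 hf k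
  have h2 : ∀ k, DifferentiableAt ℝ (fun y => g y k) x := fun k => differentiableAt_pi.1 hg k
  have h3 : ∀ k, DifferentiableAt ℝ (fun y => h y k) x := fun k => differentiableAt_pi.1 hh k
  have h4 : ∀ k l, DifferentiableAt ℝ (fun y => g y k * h y l) x :=
    fun k l => (h2 k).mul (h3 l)
  have h5 : ∀ k l m n, DifferentiableAt ℝ (fun y => g y k * h y l - g y m * h y n) x :=
    fun k l m n => (h4 k l).sub (h4 m n)
  have h6 : ∀ j k l m n,
      DifferentiableAt ℝ (fun y => f y j * (g y k * h y l - g y m * h y n)) x :=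
    fun j k l m n => (h1 j).mul (h5 k l m n)
  have h7 : ∀ j k l m n, pd i (fun y => f y j * (g y k * h y l - g y m * h y n)) x =
      f x j * (g x k * pd i h x l + h x l * pd i g x k
        - (g x m * pd i h x n + h x n * pd i g x m))
        + (g x k * h x l - g x m * h x n) * pd i f x j := by
    intro j k l m n
    rw [pd_mul (h1 j) (h5 k l m n), pd_sub (h4 k l) (h4 m n), pd_mul (h2 k) (h3 l),
      pd_mul (h2 m) (h3 n)]
    simp only [pd_apply hf, pd_apply hg, pd_apply hh]
  simp only [triple]
  rw [pd_add_add (h6 _ _ _ _ _) (h6 _ _ _ _ _) (h6 _ _ _ _ _), h7, h7, h7]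
  ring

lemma contDiffOn_ip (p : ℕ) {f g : Plane → Fin 3 → ℝ} (hf : ContDiffOn ℝ ∞ f U)
    (hg : ContDiffOn ℝ ∞ g U) : ContDiffOn ℝ ∞ (fun y => ip p (f y) (g y)) U := by
  have h1 : ∀ k, ContDiffOn ℝ ∞ (fun y => f y k) U := fun k => contDiffOn_pi.1 hf k
  have h2 : ∀ k, ContDiffOn ℝ ∞ (fun y => g y k) U := fun k => contDiffOn_pi.1 hg k
  simp only [ip_eq]
  exact (((contDiffOn_const.mul (h1 0)).mul (h2 0)).add
    ((contDiffOn_const.mul (h1 1)).mul (h2 1))).add ((contDiffOn_const.mul (h1 2)).mul (h2 2))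

lemma contDiffOn_triple {f g h : Plane → Fin 3 → ℝ} (hf : ContDiffOn ℝ ∞ f U)
    (hg : ContDiffOn ℝ ∞ g U) (hh : ContDiffOn ℝ ∞ h U) :
    ContDiffOn ℝ ∞ (fun y => triple (f y) (g y) (h y)) U := by
  have h1 : ∀ k, ContDiffOn ℝ ∞ (fun y => f y k) U := fun k => contDiffOn_pi.1 hf k
  have h2 : ∀ k, ContDiffOn ℝ ∞ (fun y => g y k) U := fun k => contDiffOn_pi.1 hg k
  have h3 : ∀ k, ContDiffOn ℝ ∞ (fun y => h y k) U := fun k => contDiffOn_pi.1 hh k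
  simp only [triple]
  exact (((h1 0).mul (((h2 1).mul (h3 2)).sub ((h2 2).mul (h3 1)))).add
    ((h1 1).mul (((h2 2).mul (h3 0)).sub ((h2 0).mul (h3 2))))).add
    ((h1 2).mul (((h2 0).mul (h3 1)).sub ((h2 1).mul (h3 0))))

end pd

/-! ### Harmonic maps into the quadric -/

/-- Twice the energy density of a map of the (Riemannian or Lorentzian) plane. -/
def energy (p : ℕ) (ε : ℝ) (φ : Plane → Fin 3 → ℝ) (x : Plane) : ℝ :=
  ip p (pd 0 φ x) (pd 0 φ x) + ε * ip p (pd 1 φ x) (pd 1 φ x)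

/-- The Jacobian of a map of the plane into the quadric. -/
def jac (φ : Plane → Fin 3 → ℝ) (x : Plane) : ℝ := triple (φ x) (pd 0 φ x) (pd 1 φ x)

/-- `φ` is a smooth map of `U` into the quadric, harmonic for the metric `dx² + ε dy²`. -/
structure IsHarmonicOn (p : ℕ) (ε : ℝ) (φ : Plane → Fin 3 → ℝ) (U : Set Plane) : Prop where
  smooth : ContDiffOn ℝ ∞ φ U
  mem : ∀ x ∈ U, ip p (φ x) (φ x) = 1
  harmonic : ∀ x ∈ U, pd 0 (pd 0 φ) x + ε • pd 1 (pd 1 φ) x = - energy p ε φ x • φ x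

/-- The squared norm of the Hopf differential, up to a factor. -/
def hopfSq (p : ℕ) (ε : ℝ) (φ : Plane → Fin 3 → ℝ) (x : Plane) : ℝ :=
  energy p ε φ x ^ 2 - 4 * (ε * disc p) * jac φ x ^ 2

/-- Four vectors of ℝ³ are dependent; pairing the Cramer relation with x leaves only the normal
component of the middle vector. -/
lemma triple_of_tangent (p : ℕ) {x y z w : Fin 3 → ℝ} (hx : ip p x x = 1) (hy : ip p x y = 0)
    (hw : ip p x w = 0) : triple y z w = ip p x z * triple y x w := by
  have : ip p x x * triple y z w = ip p x y * triple x z w + ip p x z * triple y x w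
      + ip p x w * triple y z x := by
    simp only [ip_eq, triple]; ring
  rw [hx, hy, hw] at this
  linarith

section tangent
variable {p : ℕ} {φ : Plane → Fin 3 → ℝ} {U : Set Plane} {x : Plane}

lemma ip_pd_eq_zero (hU : IsOpen U) (hφ : ContDiffOn ℝ ∞ φ U) (h1 : ∀ x ∈ U, ip p (φ x) (φ x) = 1)
    (hx : x ∈ U) (i : Fin 2) : ip p (φ x) (pd i φ x) = 0 := by
  have hd := differentiableAt_of_contDiffOn hU hφ hx
  have h := pd_congr_on hU hx (f := fun y => ip p (φ y) (φ y)) (g := fun _ => 1) h1 i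
  rw [pd_ip p hd hd, pd_const, ip_comm p (pd i φ x)] at h
  linarith

lemma ip_pd_pd (hU : IsOpen U) (hφ : ContDiffOn ℝ ∞ φ U) (h1 : ∀ x ∈ U, ip p (φ x) (φ x) = 1)
    (hx : x ∈ U) (i j : Fin 2) :
    ip p (φ x) (pd i (pd j φ) x) = - ip p (pd i φ x) (pd j φ x) := by
  have hd := differentiableAt_of_contDiffOn hU hφ hx
  have hd' := differentiableAt_of_contDiffOn hU (ContDiffOn.pd hU hφ j) hx
  have h := pd_congr_on hU hx (f := fun y => ip p (φ y) (pd j φ y)) (g := fun _ => 0)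
    (fun y hy => ip_pd_eq_zero hU hφ h1 hy j) i
  rw [pd_ip p hd hd', pd_const] at h
  linarith

end tangent

/-! ### Laplacians of the energy and of the Jacobian of a harmonic map -/

namespace IsHarmonicOn

variable {p : ℕ} {ε : ℝ} {φ : Plane → Fin 3 → ℝ} {U : Set Plane} {x : Plane}

lemma smooth_energy (hU : IsOpen U) (h : IsHarmonicOn p ε φ U) :
    ContDiffOn ℝ ∞ (energy p ε φ) U := by
  have h0 := ContDiffOn.pd hU h.smooth 0
  have h1 := ContDiffOn.pd hU h.smooth 1
  exact (contDiffOn_ip p h0 h0).add (contDiffOn_const.mul (contDiffOn_ip p h1 h1))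

lemma smooth_jac (hU : IsOpen U) (h : IsHarmonicOn p ε φ U) : ContDiffOn ℝ ∞ (jac φ) U :=
  contDiffOn_triple h.smooth (ContDiffOn.pd hU h.smooth 0) (ContDiffOn.pd hU h.smooth 1)

lemma pd_energy (hU : IsOpen U) (h : IsHarmonicOn p ε φ U) (hx : x ∈ U) (i : Fin 2) :
    pd i (energy p ε φ) x = 2 * ip p (pd i (pd 0 φ) x) (pd 0 φ x)
      + 2 * ε * ip p (pd i (pd 1 φ) x) (pd 1 φ x) := by
  have d0 := differentiableAt_of_contDiffOn hU (ContDiffOn.pd hU h.smooth 0) hx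
  have d1 := differentiableAt_of_contDiffOn hU (ContDiffOn.pd hU h.smooth 1) hx
  have e := fun k => contDiffOn_ip p (ContDiffOn.pd hU h.smooth k) (ContDiffOn.pd hU h.smooth k)
  have e' := fun k => differentiableAt_of_contDiffOn hU (e k) hx
  unfold energy
  rw [pd_add (e' 0) ((e' 1).const_mul ε), pd_const_mul (e' 1), pd_ip p d0 d0, pd_ip p d1 d1,
    ip_comm p (pd 0 φ x), ip_comm p (pd 1 φ x)]
  ring

lemma pd_jac (hU : IsOpen U) (h : IsHarmonicOn p ε φ U) (hx : x ∈ U) (i : Fin 2) :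
    pd i (jac φ) x = triple (φ x) (pd i (pd 0 φ) x) (pd 1 φ x)
      + triple (φ x) (pd 0 φ x) (pd i (pd 1 φ) x) := by
  have d0 := differentiableAt_of_contDiffOn hU (ContDiffOn.pd hU h.smooth 0) hx
  have d1 := differentiableAt_of_contDiffOn hU (ContDiffOn.pd hU h.smooth 1) hx
  have d := differentiableAt_of_contDiffOn hU h.smooth hx
  unfold jac
  rw [pd_triple d d0 d1]
  have : triple (pd i φ x) (pd 0 φ x) (pd 1 φ x) = 0 := by
    fin_cases i <;> simp only [triple, Fin.zero_eta, Fin.mk_one] <;> ring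
  rw [this]; ring

/-- Second derivatives in terms of the covariant ones. -/
lemma pd_one_one (hε : ε * ε = 1) (h : IsHarmonicOn p ε φ U) (hx : x ∈ U) :
    pd 1 (pd 1 φ) x = -ε • (energy p ε φ x • φ x + pd 0 (pd 0 φ) x) := by
  have := h.harmonic x hx
  ext k
  have hk := congrFun this k
  simp only [Pi.add_apply, Pi.smul_apply, smul_eq_mul] at hk
  simp only [Pi.add_apply, Pi.smul_apply, smul_eq_mul]
  linear_combination ε * hk - pd 1 (pd 1 φ) x k * hε

/-- The harmonic map equation differentiated once; it removes all third derivatives from the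
Laplacians of T and a. -/
lemma pd_laplacian (hU : IsOpen U) (h : IsHarmonicOn p ε φ U) (hx : x ∈ U) (i : Fin 2) :
    pd 0 (pd 0 (pd i φ)) x + ε • pd 1 (pd 1 (pd i φ)) x
      = - (energy p ε φ x • pd i φ x + pd i (energy p ε φ) x • φ x) := by
  have s1 := fun k => ContDiffOn.pd hU h.smooth k
  have s2 := fun k l => ContDiffOn.pd hU (s1 k) l
  have key : ∀ k, pd k (pd k (pd i φ)) x = pd i (pd k (pd k φ)) x := by
    intro k
    rw [pd_congr_on hU hx (fun y hy => pd_comm hU hy h.smooth k i) k, pd_comm hU hx (s1 k)]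
  have d2 := fun k l => differentiableAt_of_contDiffOn hU (s2 k l) hx
  rw [key, key, ← pd_const_smul (d2 1 1), ← pd_add (d2 0 0) ((d2 1 1).fun_const_smul ε),
    pd_congr_on hU hx (g := fun y => -(energy p ε φ y • φ y))
      (fun y hy => by rw [h.harmonic y hy, neg_smul]) i, pd_neg,
    pd_smul (differentiableAt_of_contDiffOn hU (h.smooth_energy hU) hx)
      (differentiableAt_of_contDiffOn hU h.smooth hx)]

lemma gram_jac (hU : IsOpen U) (h : IsHarmonicOn p ε φ U) (hx : x ∈ U) :
    disc p * jac φ x ^ 2 = ip p (pd 0 φ x) (pd 0 φ x) * ip p (pd 1 φ x) (pd 1 φ x)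
      - ip p (pd 0 φ x) (pd 1 φ x) ^ 2 :=
  gram_tangent p (h.mem x hx) (ip_pd_eq_zero hU h.smooth h.mem hx 0)
    (ip_pd_eq_zero hU h.smooth h.mem hx 1)

/-- The Laplacian of the Jacobian. -/
lemma laplacian_jac (hε : ε * ε = 1) (hU : IsOpen U) (h : IsHarmonicOn p ε φ U) (hx : x ∈ U) :
    pd 0 (pd 0 (jac φ)) x + ε * pd 1 (pd 1 (jac φ)) x = - energy p ε φ x * jac φ x
      + 4 * triple (φ x) (pd 0 (pd 0 φ) x) (pd 0 (pd 1 φ) x) := by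
  have s1 := fun k => ContDiffOn.pd hU h.smooth k
  have s2 := fun k l => ContDiffOn.pd hU (s1 k) l
  have d := differentiableAt_of_contDiffOn hU h.smooth hx
  have d1 := fun k => differentiableAt_of_contDiffOn hU (s1 k) hx
  have d2 := fun k l => differentiableAt_of_contDiffOn hU (s2 k l) hx
  have t1 := fun k l => differentiableAt_of_contDiffOn hU
    (contDiffOn_triple h.smooth (s2 k l) (s1 1)) hx
  have t2 := fun k l => differentiableAt_of_contDiffOn hU
    (contDiffOn_triple h.smooth (s1 0) (s2 k l)) hx
  have key : ∀ i, pd i (pd i (jac φ)) x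
      = triple (pd i φ x) (pd i (pd 0 φ) x) (pd 1 φ x)
        + triple (φ x) (pd i (pd i (pd 0 φ)) x) (pd 1 φ x)
        + triple (φ x) (pd i (pd 0 φ) x) (pd i (pd 1 φ) x)
        + (triple (pd i φ x) (pd 0 φ x) (pd i (pd 1 φ) x)
        + triple (φ x) (pd i (pd 0 φ) x) (pd i (pd 1 φ) x)
        + triple (φ x) (pd 0 φ x) (pd i (pd i (pd 1 φ)) x)) := by
    intro i
    rw [pd_congr_on hU hx (fun y hy => h.pd_jac hU hy i) i, pd_add (t1 _ _) (t2 _ _),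
      pd_triple d (d2 _ _) (d1 _), pd_triple d (d1 _) (d2 _ _)]
  have hX := ip_pd_eq_zero hU h.smooth h.mem hx 0
  have hY := ip_pd_eq_zero hU h.smooth h.mem hx 1
  have e1 := triple_of_tangent p (z := pd 0 (pd 0 φ) x) (h.mem x hx) hX hY
  have e2 := triple_of_tangent p (y := pd 1 φ x) (z := pd 1 (pd 1 φ) x) (h.mem x hx) hY hX
  rw [ip_pd_pd hU h.smooth h.mem hx] at e1 e2
  have e2' : triple (pd 1 φ x) (pd 0 φ x) (pd 1 (pd 1 φ) x)
      = - triple (pd 1 φ x) (pd 1 (pd 1 φ) x) (pd 0 φ x) := by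
    simp only [triple]; ring
  have l0 := h.pd_laplacian hU hx 0
  have l1 := h.pd_laplacian hU hx 1
  have m0 : triple (φ x) (pd 0 (pd 0 (pd 0 φ)) x) (pd 1 φ x)
      + ε * triple (φ x) (pd 1 (pd 1 (pd 0 φ)) x) (pd 1 φ x) = - energy p ε φ x * jac φ x := by
    have : triple (φ x) (pd 0 (pd 0 (pd 0 φ)) x) (pd 1 φ x)
      + ε * triple (φ x) (pd 1 (pd 1 (pd 0 φ)) x) (pd 1 φ x)
      = triple (φ x) (pd 0 (pd 0 (pd 0 φ)) x + ε • pd 1 (pd 1 (pd 0 φ)) x) (pd 1 φ x) := by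
      simp only [triple, Pi.add_apply, Pi.smul_apply, smul_eq_mul]; ring
    rw [this, l0]
    simp only [jac, triple, Pi.add_apply, Pi.smul_apply, smul_eq_mul, Pi.neg_apply]; ring
  have m1 : triple (φ x) (pd 0 φ x) (pd 0 (pd 0 (pd 1 φ)) x)
      + ε * triple (φ x) (pd 0 φ x) (pd 1 (pd 1 (pd 1 φ)) x) = - energy p ε φ x * jac φ x := by
    have : triple (φ x) (pd 0 φ x) (pd 0 (pd 0 (pd 1 φ)) x)
      + ε * triple (φ x) (pd 0 φ x) (pd 1 (pd 1 (pd 1 φ)) x)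
      = triple (φ x) (pd 0 φ x) (pd 0 (pd 0 (pd 1 φ)) x + ε • pd 1 (pd 1 (pd 1 φ)) x) := by
      simp only [triple, Pi.add_apply, Pi.smul_apply, smul_eq_mul]; ring
    rw [this, l1]
    simp only [jac, triple, Pi.add_apply, Pi.smul_apply, smul_eq_mul, Pi.neg_apply]; ring
  -- By harmonicity φ_yy equals -ε φ_xx modulo φ, and the multiple of φ drops out of a determinant
  -- that already contains φ.
  have m2 : ε * triple (φ x) (pd 0 (pd 1 φ) x) (pd 1 (pd 1 φ) x)
      = triple (φ x) (pd 0 (pd 0 φ) x) (pd 0 (pd 1 φ) x) := by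
    have : ε * triple (φ x) (pd 0 (pd 1 φ) x) (pd 1 (pd 1 φ) x)
      = ε * ε * triple (φ x) (pd 0 (pd 0 φ) x) (pd 0 (pd 1 φ) x) := by
      rw [h.pd_one_one hε hx]
      simp only [triple, Pi.add_apply, Pi.smul_apply, smul_eq_mul]; ring
    rw [this, hε, one_mul]
  have z1 : triple (pd 0 φ x) (pd 0 φ x) (pd 0 (pd 1 φ) x) = 0 := by simp only [triple]; ring
  have z2 : triple (pd 1 φ x) (pd 0 (pd 1 φ) x) (pd 1 φ x) = 0 := by simp only [triple]; ring
  have z3 : triple (pd 0 φ x) (φ x) (pd 1 φ x) = - jac φ x := by simp only [triple, jac]; ring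
  have z4 : triple (pd 1 φ x) (φ x) (pd 0 φ x) = jac φ x := by simp only [triple, jac]; ring
  rw [key, key, pd_comm hU hx h.smooth 1 0, e1, e2', e2, z1, z2, z3, z4]
  have hT : energy p ε φ x = ip p (pd 0 φ x) (pd 0 φ x) + ε * ip p (pd 1 φ x) (pd 1 φ x) := rfl
  linear_combination m0 + m1 + 2 * m2 - jac φ x * hT

/-- The Laplacian of the energy density, with the covariant second derivatives `A`, `B`. -/
lemma laplacian_energy (hε : ε * ε = 1) (hU : IsOpen U) (h : IsHarmonicOn p ε φ U) (hx : x ∈ U)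
    {A B : Fin 3 → ℝ} (hA : A = pd 0 (pd 0 φ) x + ip p (pd 0 φ x) (pd 0 φ x) • φ x)
    (hB : B = pd 0 (pd 1 φ) x + ip p (pd 0 φ x) (pd 1 φ x) • φ x) :
    pd 0 (pd 0 (energy p ε φ)) x + ε * pd 1 (pd 1 (energy p ε φ)) x
      = - 4 * (ε * disc p) * jac φ x ^ 2 + 4 * (ip p A A + ε * ip p B B) := by
  have s1 := fun k => ContDiffOn.pd hU h.smooth k
  have s2 := fun k l => ContDiffOn.pd hU (s1 k) l
  have d := differentiableAt_of_contDiffOn hU h.smooth hx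
  have d1 := fun k => differentiableAt_of_contDiffOn hU (s1 k) hx
  have d2 := fun k l => differentiableAt_of_contDiffOn hU (s2 k l) hx
  have t := fun k l => differentiableAt_of_contDiffOn hU (contDiffOn_ip p (s2 k l) (s1 k)) hx
  have key : ∀ i, pd i (pd i (energy p ε φ)) x
      = 2 * (ip p (pd i (pd i (pd 0 φ)) x) (pd 0 φ x)
        + ip p (pd i (pd 0 φ) x) (pd i (pd 0 φ) x))
        + 2 * ε * (ip p (pd i (pd i (pd 1 φ)) x) (pd 1 φ x)
        + ip p (pd i (pd 1 φ) x) (pd i (pd 1 φ) x)) := by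
    intro i
    rw [pd_congr_on hU hx (fun y hy => h.pd_energy hU hy i) i,
      pd_add ((t _ _).const_mul _) ((t _ _).const_mul _), pd_const_mul (t _ _),
      pd_const_mul (t _ _), pd_ip p (d2 _ _) (d1 _), pd_ip p (d2 _ _) (d1 _)]
  have hX := ip_pd_eq_zero hU h.smooth h.mem hx 0
  have hY := ip_pd_eq_zero hU h.smooth h.mem hx 1
  have l0 := congrArg (fun v => ip p v (pd 0 φ x)) (h.pd_laplacian hU hx 0)
  have l1 := congrArg (fun v => ip p v (pd 1 φ x)) (h.pd_laplacian hU hx 1)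
  simp only [ip_add_left, ip_smul_left, ip_neg_left, hX, hY] at l0 l1
  have n0 := ip_pd_pd hU h.smooth h.mem hx 0 0
  have n1 := ip_pd_pd hU h.smooth h.mem hx 0 1
  have hAA : ip p A A = ip p (pd 0 (pd 0 φ) x) (pd 0 (pd 0 φ) x)
      - ip p (pd 0 φ x) (pd 0 φ x) ^ 2 := by
    rw [hA]
    simp only [ip_add_left, ip_add_right, ip_smul_left, ip_smul_right, h.mem x hx,
      ip_comm p (pd 0 (pd 0 φ) x) (φ x), n0]
    ring
  have hBB : ip p B B = ip p (pd 0 (pd 1 φ) x) (pd 0 (pd 1 φ) x)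
      - ip p (pd 0 φ x) (pd 1 φ x) ^ 2 := by
    rw [hB]
    simp only [ip_add_left, ip_add_right, ip_smul_left, ip_smul_right, h.mem x hx,
      ip_comm p (pd 0 (pd 1 φ) x) (φ x), n1]
    ring
  have hVV : ip p (pd 1 (pd 1 φ) x) (pd 1 (pd 1 φ) x) = energy p ε φ x ^ 2
      - 2 * energy p ε φ x * ip p (pd 0 φ x) (pd 0 φ x)
      + ip p (pd 0 (pd 0 φ) x) (pd 0 (pd 0 φ) x) := by
    rw [h.pd_one_one hε hx]
    simp only [ip_add_left, ip_add_right, ip_smul_left, ip_smul_right, h.mem x hx,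
      ip_comm p (pd 0 (pd 0 φ) x) (φ x), n0]
    linear_combination (energy p ε φ x ^ 2
      - 2 * energy p ε φ x * ip p (pd 0 φ x) (pd 0 φ x)
      + ip p (pd 0 (pd 0 φ) x) (pd 0 (pd 0 φ) x)) * hε
  have hT : energy p ε φ x = ip p (pd 0 φ x) (pd 0 φ x) + ε * ip p (pd 1 φ x) (pd 1 φ x) := rfl
  have hg := h.gram_jac hU hx
  rw [key, key, pd_comm hU hx h.smooth 1 0, hAA, hBB, hVV]
  linear_combination 2 * l0 + 2 * ε * l1 + 4 * ε * hg
    + 2 * (energy p ε φ x ^ 2 - 2 * energy p ε φ x * ip p (pd 0 φ x) (pd 0 φ x)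
      + ip p (pd 0 (pd 0 φ) x) (pd 0 (pd 0 φ) x)) * hε
    - 4 * ip p (pd 0 φ x) (pd 0 φ x) * hT + 2 * energy p ε φ x * hT

end IsHarmonicOn

/-! ### The Bochner formula and its version for Kähler functions -/

namespace IsHarmonicOn

variable {p : ℕ} {ε : ℝ} {φ : Plane → Fin 3 → ℝ} {U : Set Plane} {x : Plane}

lemma pd_hopfSq (hU : IsOpen U) (h : IsHarmonicOn p ε φ U) (hx : x ∈ U) (i : Fin 2) :
    pd i (hopfSq p ε φ) x = 2 * energy p ε φ x * pd i (energy p ε φ) x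
      - 8 * (ε * disc p) * jac φ x * pd i (jac φ) x := by
  have dT := differentiableAt_of_contDiffOn hU (h.smooth_energy hU) hx
  have da := differentiableAt_of_contDiffOn hU (h.smooth_jac hU) hx
  have e : hopfSq p ε φ = fun y => energy p ε φ y * energy p ε φ y
      - 4 * (ε * disc p) * (jac φ y * jac φ y) := by
    funext y; simp only [hopfSq]; ring
  rw [e, pd_sub (dT.fun_mul dT) ((da.fun_mul da).const_mul _), pd_mul dT dT,
    pd_const_mul (da.fun_mul da), pd_mul da da]
  ring

/-- The Bochner formula: a potential of `(a dT - T da) / (T² - 4 δ a²)`, where `T` is the energy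
and `a` the Jacobian of a harmonic map, has Laplacian `a`. -/
theorem laplacian_potential (hε : ε * ε = 1) (hU : IsOpen U) (h : IsHarmonicOn p ε φ U)
    (hR : ∀ y ∈ U, hopfSq p ε φ y ≠ 0) {κ : ℝ} {v : Plane → ℝ}
    (hv : ∀ y ∈ U, ∀ i, pd i v y = κ * ((jac φ y * pd i (energy p ε φ) y
      - energy p ε φ y * pd i (jac φ) y) * (hopfSq p ε φ y)⁻¹)) (hx : x ∈ U) :
    pd 0 (pd 0 v) x + ε * pd 1 (pd 1 v) x = κ * jac φ x := by
  have sT := h.smooth_energy hU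
  have sa := h.smooth_jac hU
  have dT := differentiableAt_of_contDiffOn hU sT hx
  have da := differentiableAt_of_contDiffOn hU sa hx
  have dT' := fun i => differentiableAt_of_contDiffOn hU (ContDiffOn.pd hU sT i) hx
  have da' := fun i => differentiableAt_of_contDiffOn hU (ContDiffOn.pd hU sa i) hx
  have dR : DifferentiableAt ℝ (hopfSq p ε φ) x :=
    (dT.pow 2).sub ((da.pow 2).const_mul _)
  have dRi : DifferentiableAt ℝ (fun y => (hopfSq p ε φ y)⁻¹) x := dR.fun_inv (hR x hx)
  have key : ∀ i, pd i (pd i v) x = κ * ((jac φ x * pd i (pd i (energy p ε φ)) x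
      - energy p ε φ x * pd i (pd i (jac φ)) x) * (hopfSq p ε φ x)⁻¹
      - (jac φ x * pd i (energy p ε φ) x - energy p ε φ x * pd i (jac φ) x)
        * pd i (hopfSq p ε φ) x * ((hopfSq p ε φ x) ^ 2)⁻¹) := by
    intro i
    have dN := (da.fun_mul (dT' i)).fun_sub (dT.fun_mul (da' i))
    rw [pd_congr_on hU hx (fun y hy => hv y hy i) i, pd_const_mul (dN.fun_mul dRi),
      pd_mul dN dRi, pd_sub (da.fun_mul (dT' i)) (dT.fun_mul (da' i)), pd_mul da (dT' i),
      pd_mul dT (da' i), pd_of_hasDerivAt (hasDerivAt_inv (hR x hx)) dR]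
    ring
  have s2 := fun k l => ContDiffOn.pd hU (ContDiffOn.pd hU h.smooth k) l
  have hX := ip_pd_eq_zero hU h.smooth h.mem hx 0
  have hY := ip_pd_eq_zero hU h.smooth h.mem hx 1
  have n0 := ip_pd_pd hU h.smooth h.mem hx 0 0
  have n1 := ip_pd_pd hU h.smooth h.mem hx 0 1
  have hxx := h.mem x hx
  set P := pd 0 (pd 0 φ) x with hP
  set Q := pd 0 (pd 1 φ) x with hQ
  set X := pd 0 φ x with hXdef
  set Y := pd 1 φ x with hYdef
  -- A and B are the tangential parts of φ_xx and φ_xy, since ⟨φ, φ_ij⟩ = -⟨φ_i, φ_j⟩.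
  set A : Fin 3 → ℝ := P + ip p X X • φ x with hA
  set B : Fin 3 → ℝ := Q + ip p X Y • φ x with hB
  have hlT := h.laplacian_energy hε hU hx hA hB
  have hla := h.laplacian_jac hε hU hx
  have hpA : ip p (φ x) A = 0 := by rw [hA, ip_add_right, ip_smul_right, hxx, n0]; ring
  have hpB : ip p (φ x) B = 0 := by rw [hB, ip_add_right, ip_smul_right, hxx, n1]; ring
  have hAX : ip p A X = ip p P X := by rw [hA, ip_add_left, ip_smul_left, hX]; ring
  have hAY : ip p A Y = ip p P Y := by rw [hA, ip_add_left, ip_smul_left, hY]; ring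
  have hBX : ip p B X = ip p Q X := by rw [hB, ip_add_left, ip_smul_left, hX]; ring
  have hBY : ip p B Y = ip p Q Y := by rw [hB, ip_add_left, ip_smul_left, hY]; ring
  have tAB : triple (φ x) P Q = triple (φ x) A B := by
    simp only [hA, hB, triple, Pi.add_apply, Pi.smul_apply, smul_eq_mul]; ring
  have tA : ∀ z, triple (φ x) A z = triple (φ x) P z := by
    intro z; simp only [hA, triple, Pi.add_apply, Pi.smul_apply, smul_eq_mul]; ring
  have tA' : ∀ z, triple (φ x) z A = triple (φ x) z P := by
    intro z; simp only [hA, triple, Pi.add_apply, Pi.smul_apply, smul_eq_mul]; ring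
  have tB : ∀ z, triple (φ x) B z = triple (φ x) Q z := by
    intro z; simp only [hB, triple, Pi.add_apply, Pi.smul_apply, smul_eq_mul]; ring
  have tB' : ∀ z, triple (φ x) z B = triple (φ x) z Q := by
    intro z; simp only [hB, triple, Pi.add_apply, Pi.smul_apply, smul_eq_mul]; ring
  have hV := h.pd_one_one hε hx
  have T0 := h.pd_energy hU hx 0
  have T1 := h.pd_energy hU hx 1
  have a0 := h.pd_jac hU hx 0
  have a1 := h.pd_jac hU hx 1
  rw [pd_comm hU hx h.smooth 1 0, hV] at T1 a1
  have T1' : pd 1 (energy p ε φ) x = 2 * ip p B X - 2 * ip p A Y := by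
    rw [T1, hBX, hAY, ip_smul_left, ip_add_left, ip_smul_left, hY]
    linear_combination (-2) * ip p P Y * hε
  have a1' : pd 1 (jac φ) x = triple (φ x) B Y - ε * triple (φ x) X A := by
    rw [a1, tB, tA']
    simp only [triple, Pi.add_apply, Pi.smul_apply, smul_eq_mul]; ring
  have T0' : pd 0 (energy p ε φ) x = 2 * ip p A X + 2 * ε * ip p B Y := by
    rw [T0, hAX, hBY]
  have a0' : pd 0 (jac φ) x = triple (φ x) A Y + triple (φ x) X B := by
    rw [a0, tA, tB']
  -- With third derivatives gone, what remains is pointwise algebra in X, Y, A, B.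
  have bo := bochner_identity p hε hxx hX hY hpA hpB (T := energy p ε φ x) (a := jac φ x)
    rfl rfl T0' T1' a0' a1' (R := hopfSq p ε φ x) rfl rfl rfl
  rw [← h.pd_hopfSq hU hx, ← h.pd_hopfSq hU hx] at bo
  rw [tAB] at hla
  rw [key, key]
  have hRx := hR x hx
  have hRdef : hopfSq p ε φ x
    = energy p ε φ x ^ 2 - 4 * (ε * disc p) * jac φ x ^ 2 := rfl
  generalize hopfSq p ε φ x = R at *
  generalize pd 0 (pd 0 (energy p ε φ)) x = T00 at *
  generalize pd 1 (pd 1 (energy p ε φ)) x = T11 at *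
  generalize pd 0 (pd 0 (jac φ)) x = a00 at *
  generalize pd 1 (pd 1 (jac φ)) x = a11 at *
  generalize ip p A A + ε * ip p B B = S at *
  generalize triple (φ x) A B = D at *
  generalize pd 0 (hopfSq p ε φ) x = R0 at *
  generalize pd 1 (hopfSq p ε φ) x = R1 at *
  field_simp
  linear_combination κ * jac φ x * R * hlT - κ * energy p ε φ x * R * hla + κ * bo
    - κ * jac φ x * R * hRdef

/-- The form of the Bochner formula adapted to the Kähler functions. -/
theorem dzdzbar_potential (hε : ε * ε = 1) (hU : IsOpen U) (h : IsHarmonicOn p ε φ U)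
    {κ : ℝ} (hκ : κ * κ = 1) {c₁ c₂ E v : Plane → ℝ}
    (hc₁ : ∀ y ∈ U, DifferentiableAt ℝ c₁ y) (hc₂ : ∀ y ∈ U, DifferentiableAt ℝ c₂ y)
    (hE : ∀ y ∈ U, DifferentiableAt ℝ E y) (hE0 : ∀ y ∈ U, E y ≠ 0)
    (h₁ : ∀ y ∈ U, 1 - ε * disc p * c₁ y ^ 2 ≠ 0) (h₂ : ∀ y ∈ U, 1 - ε * disc p * c₂ y ^ 2 ≠ 0)
    (hT : ∀ y ∈ U, energy p ε φ y = E y * (1 + ε * disc p * (c₁ y * c₂ y)))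
    (ha : ∀ y ∈ U, jac φ y = -(κ / 2) * (E y * (c₁ y + c₂ y)))
    (hv : ∀ y ∈ U, ∀ i, pd i v y = (pd i c₁ y / (1 - ε * disc p * c₁ y ^ 2)
      + pd i c₂ y / (1 - ε * disc p * c₂ y ^ 2)) / 2) (hx : x ∈ U) :
    dzdzbar ε v x = κ * jac φ x / 4 := by
  have hRv : ∀ y ∈ U, hopfSq p ε φ y
      = E y ^ 2 * ((1 - ε * disc p * c₁ y ^ 2) * (1 - ε * disc p * c₂ y ^ 2)) := by
    intro y hy
    unfold hopfSq
    rw [hT y hy, ha y hy]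
    linear_combination -(ε * disc p) * E y ^ 2 * (c₁ y + c₂ y) ^ 2 * hκ
  have hR : ∀ y ∈ U, hopfSq p ε φ y ≠ 0 := by
    intro y hy
    rw [hRv y hy]
    exact mul_ne_zero (pow_ne_zero 2 (hE0 y hy)) (mul_ne_zero (h₁ y hy) (h₂ y hy))
  unfold dzdzbar
  rw [h.laplacian_potential hε hU hR _ hx]
  intro y hy i
  have d1 := hc₁ y hy
  have d2 := hc₂ y hy
  have dE := hE y hy
  have d12 := d1.fun_mul d2
  have d3 : DifferentiableAt ℝ (fun z => 1 + ε * disc p * (c₁ z * c₂ z)) y :=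
    (differentiableAt_const _).add (d12.const_mul _)
  have eT : pd i (energy p ε φ) y = E y * (ε * disc p * (c₁ y * pd i c₂ y + c₂ y * pd i c₁ y))
      + (1 + ε * disc p * (c₁ y * c₂ y)) * pd i E y := by
    rw [pd_congr_on hU hy hT i, pd_mul dE d3, pd_add (differentiableAt_const _) (d12.const_mul _),
      pd_const, pd_const_mul d12, pd_mul d1 d2]
    ring
  have ea : pd i (jac φ) y = -(κ / 2) * (E y * (pd i c₁ y + pd i c₂ y)
      + (c₁ y + c₂ y) * pd i E y) := by
    rw [pd_congr_on hU hy ha i, pd_const_mul (dE.fun_mul (d1.fun_add d2)), pd_mul dE (d1.fun_add d2),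
      pd_add d1 d2]
  -- The derivative of E cancels in a dT - T da, because a/T does not involve E. The rest is the
  -- derivative of the addition formula, with κ² = 1.
  rw [hv y hy i, eT, ea, hT y hy, ha y hy, hRv y hy]
  have q1 := h₁ y hy
  have q2 := h₂ y hy
  have q3 := hE0 y hy
  generalize ε * disc p = δ at *
  field_simp
  rw [show κ ^ 2 = 1 by rw [sq, hκ]]
  ring

end IsHarmonicOn

/-! ### The functions `vLog` and `vArctan` -/

/-- This reduces w to v. Here the first argument changes sign, while in the arctan case the second
does; `gordon_snd` absorbs the difference in its sign τ. -/
lemma wLog_eq_vLog (c₁ c₂ : ℝ) : wLog c₁ c₂ = vLog (-c₁) c₂ := by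
  have h1 : |-c₁ + 1| = |c₁ - 1| := by rw [← abs_neg]; congr 1; ring
  have h2 : |-c₁ - 1| = |c₁ + 1| := by rw [← abs_neg]; congr 1; ring
  simp only [wLog, vLog, h1, h2]

lemma wArctan_eq_vArctan (c₁ c₂ : ℝ) : wArctan c₁ c₂ = vArctan c₁ (-c₂) := by
  simp only [wArctan, vArctan, Real.arctan_neg]; ring

/-- `Real.log` is even, so the absolute values disappear and a single formula covers both the artanh
range |c| < 1 and the arcoth range |c| > 1. -/
lemma vLog_eq_log (c₁ c₂ : ℝ) (h₁ : 1 - c₁ ^ 2 ≠ 0) (h₂ : 1 - c₂ ^ 2 ≠ 0) :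
    vLog c₁ c₂ = (Real.log (c₁ + 1) + Real.log (c₂ + 1) - Real.log (c₁ - 1)
      - Real.log (c₂ - 1)) / 4 := by
  have a1 : c₁ + 1 ≠ 0 := fun h => h₁ (by linear_combination (1 - c₁) * h)
  have a2 : c₂ + 1 ≠ 0 := fun h => h₂ (by linear_combination (1 - c₂) * h)
  have a3 : c₁ - 1 ≠ 0 := fun h => h₁ (by linear_combination -(1 + c₁) * h)
  have a4 : c₂ - 1 ≠ 0 := fun h => h₂ (by linear_combination -(1 + c₂) * h)
  unfold vLog
  rw [Real.log_sqrt (by positivity), Real.log_div (by positivity) (by positivity),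
    Real.log_mul (by positivity) (by positivity), Real.log_mul (by positivity) (by positivity)]
  simp only [Real.log_abs]
  ring

lemma pd_vLog {U : Set Plane} (hU : IsOpen U) {c₁ c₂ : Plane → ℝ}
    (hc₁ : ∀ y ∈ U, DifferentiableAt ℝ c₁ y) (hc₂ : ∀ y ∈ U, DifferentiableAt ℝ c₂ y)
    (h₁ : ∀ y ∈ U, 1 - c₁ y ^ 2 ≠ 0) (h₂ : ∀ y ∈ U, 1 - c₂ y ^ 2 ≠ 0) {y : Plane} (hy : y ∈ U)
    (i : Fin 2) : pd i (fun z => vLog (c₁ z) (c₂ z)) y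
      = (pd i c₁ y / (1 - c₁ y ^ 2) + pd i c₂ y / (1 - c₂ y ^ 2)) / 2 := by
  have d : ∀ c : Plane → ℝ, DifferentiableAt ℝ c y → 1 - c y ^ 2 ≠ 0 →
      HasFDerivAt (fun z => Real.log (c z + 1) - Real.log (c z - 1))
        ((2 / (1 - c y ^ 2)) • fderiv ℝ c y) y := by
    intro c hc h
    have a1 : c y + 1 ≠ 0 := fun e => h (by linear_combination (1 - c y) * e)
    have a3 : c y - 1 ≠ 0 := fun e => h (by linear_combination -(1 + c y) * e)
    refine (((hc.hasFDerivAt.add_const 1).log a1).sub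
      ((hc.hasFDerivAt.sub_const 1).log a3)).congr_fderiv ?_
    rw [← sub_smul]
    congr 1
    field_simp
    ring
  have e := ((d c₁ (hc₁ y hy) (h₁ y hy)).add (d c₂ (hc₂ y hy) (h₂ y hy))).const_smul (1 / 4 : ℝ)
  have q1 := h₁ y hy
  have q2 := h₂ y hy
  rw [pd_congr_on hU hy (g := (1 / 4 : ℝ) • ((fun z => Real.log (c₁ z + 1) - Real.log (c₁ z - 1))
      + fun z => Real.log (c₂ z + 1) - Real.log (c₂ z - 1)))
    (fun z hz => by
      rw [vLog_eq_log _ _ (h₁ z hz) (h₂ z hz)]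
      simp only [Pi.smul_apply, Pi.add_apply, smul_eq_mul]; ring)]
  unfold pd
  rw [e.fderiv]
  simp only [smul_apply, add_apply, smul_eq_mul]
  field_simp
  ring

lemma pd_vArctan {c₁ c₂ : Plane → ℝ} {y : Plane}
    (hc₁ : DifferentiableAt ℝ c₁ y) (hc₂ : DifferentiableAt ℝ c₂ y)
    (i : Fin 2) : pd i (fun z => vArctan (c₁ z) (c₂ z)) y
      = (pd i c₁ y / (1 + c₁ y ^ 2) + pd i c₂ y / (1 + c₂ y ^ 2)) / 2 := by
  have e := (hc₁.hasFDerivAt.arctan.add hc₂.hasFDerivAt.arctan).const_smul (1 / 2 : ℝ)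
  have : (fun z => vArctan (c₁ z) (c₂ z)) = (1 / 2 : ℝ) • ((fun z => Real.arctan (c₁ z))
      + fun z => Real.arctan (c₂ z)) := by
    funext z
    simp only [vArctan, Pi.smul_apply, Pi.add_apply, smul_eq_mul]; ring
  rw [this]
  unfold pd
  rw [e.fderiv]
  simp only [smul_apply, add_apply, smul_eq_mul]
  ring

lemma contDiffAt_vLog {c : ℝ × ℝ} (h₁ : 1 - c.1 ^ 2 ≠ 0) (h₂ : 1 - c.2 ^ 2 ≠ 0) :
    ContDiffAt ℝ ∞ (fun c : ℝ × ℝ => vLog c.1 c.2) c := by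
  have o1 : ∀ᶠ d : ℝ × ℝ in nhds c, 1 - d.1 ^ 2 ≠ 0 :=
    (by fun_prop : Continuous fun d : ℝ × ℝ => 1 - d.1 ^ 2).continuousAt.eventually_ne h₁
  have o2 : ∀ᶠ d : ℝ × ℝ in nhds c, 1 - d.2 ^ 2 ≠ 0 :=
    (by fun_prop : Continuous fun d : ℝ × ℝ => 1 - d.2 ^ 2).continuousAt.eventually_ne h₂
  have a1 : c.1 + 1 ≠ 0 := fun h => h₁ (by linear_combination (1 - c.1) * h)
  have a2 : c.2 + 1 ≠ 0 := fun h => h₂ (by linear_combination (1 - c.2) * h)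
  have a3 : c.1 - 1 ≠ 0 := fun h => h₁ (by linear_combination -(1 + c.1) * h)
  have a4 : c.2 - 1 ≠ 0 := fun h => h₂ (by linear_combination -(1 + c.2) * h)
  have e : (fun c : ℝ × ℝ => vLog c.1 c.2) =ᶠ[nhds c] fun c => (Real.log (c.1 + 1)
      + Real.log (c.2 + 1) - Real.log (c.1 - 1) - Real.log (c.2 - 1)) / 4 := by
    filter_upwards [o1, o2] with d h h' using vLog_eq_log _ _ h h'
  refine ContDiffAt.congr_of_eventuallyEq ?_ e
  have l1 : ContDiffAt ℝ ∞ (fun c : ℝ × ℝ => Real.log (c.1 + 1)) c :=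
    (by fun_prop : ContDiffAt ℝ ∞ (fun c : ℝ × ℝ => c.1 + 1) c).log a1
  have l2 : ContDiffAt ℝ ∞ (fun c : ℝ × ℝ => Real.log (c.2 + 1)) c :=
    (by fun_prop : ContDiffAt ℝ ∞ (fun c : ℝ × ℝ => c.2 + 1) c).log a2
  have l3 : ContDiffAt ℝ ∞ (fun c : ℝ × ℝ => Real.log (c.1 - 1)) c :=
    (by fun_prop : ContDiffAt ℝ ∞ (fun c : ℝ × ℝ => c.1 - 1) c).log a3
  have l4 : ContDiffAt ℝ ∞ (fun c : ℝ × ℝ => Real.log (c.2 - 1)) c :=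
    (by fun_prop : ContDiffAt ℝ ∞ (fun c : ℝ × ℝ => c.2 - 1) c).log a4
  exact (((l1.add l2).sub l3).sub l4).div_const 4

lemma contDiff_vArctan : ContDiff ℝ ∞ (fun c : ℝ × ℝ => vArctan c.1 c.2) :=
  ((Real.contDiff_arctan.comp contDiff_fst).add (Real.contDiff_arctan.comp contDiff_snd)).div_const 2

/-- With P, Q the two absolute values on the right, e^{2v} = √(P/Q), so sinh 2v = (P - Q)/(2√(PQ)),
and PQ is the quantity under the root. -/
lemma sinh_vLog {c₁ c₂ : ℝ} (h₁ : 1 - c₁ ^ 2 ≠ 0) (h₂ : 1 - c₂ ^ 2 ≠ 0) :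
    Real.sinh (2 * vLog c₁ c₂) * Real.sqrt |(1 - c₁ ^ 2) * (1 - c₂ ^ 2)|
      = (|(c₁ + 1) * (c₂ + 1)| - |(c₁ - 1) * (c₂ - 1)|) / 2 := by
  have a1 : c₁ + 1 ≠ 0 := fun h => h₁ (by linear_combination (1 - c₁) * h)
  have a2 : c₂ + 1 ≠ 0 := fun h => h₂ (by linear_combination (1 - c₂) * h)
  have a3 : c₁ - 1 ≠ 0 := fun h => h₁ (by linear_combination -(1 + c₁) * h)
  have a4 : c₂ - 1 ≠ 0 := fun h => h₂ (by linear_combination -(1 + c₂) * h)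
  have hP : 0 < |(c₁ + 1) * (c₂ + 1)| := abs_pos.2 (mul_ne_zero a1 a2)
  have hQ : 0 < |(c₁ - 1) * (c₂ - 1)| := abs_pos.2 (mul_ne_zero a3 a4)
  have e : |(1 - c₁ ^ 2) * (1 - c₂ ^ 2)|
      = |(c₁ + 1) * (c₂ + 1)| * |(c₁ - 1) * (c₂ - 1)| := by
    rw [← abs_mul]; congr 1; ring
  have e2 : 2 * vLog c₁ c₂
      = Real.log (Real.sqrt (|(c₁ + 1) * (c₂ + 1)| / |(c₁ - 1) * (c₂ - 1)|)) := by
    simp only [vLog, abs_mul]; ring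
  rw [e, e2, Real.sinh_log (Real.sqrt_pos.2 (div_pos hP hQ)), Real.sqrt_div hP.le,
    Real.sqrt_mul hP.le]
  have s1 := Real.sqrt_pos.2 hP
  have s2 := Real.sqrt_pos.2 hQ
  have t1 := Real.sq_sqrt hP.le
  have t2 := Real.sq_sqrt hQ.le
  generalize Real.sqrt |(c₁ + 1) * (c₂ + 1)| = P at *
  generalize Real.sqrt |(c₁ - 1) * (c₂ - 1)| = Q at *
  rw [← t1, ← t2]
  field_simp

lemma sinh_vLog_of_lt {c₁ c₂ : ℝ} (h₁ : |c₁| < 1) (h₂ : |c₂| < 1) :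
    Real.sinh (2 * vLog c₁ c₂) * Real.sqrt |(1 - c₁ ^ 2) * (1 - c₂ ^ 2)| = c₁ + c₂ := by
  obtain ⟨a, b⟩ := abs_lt.1 h₁
  obtain ⟨c, d⟩ := abs_lt.1 h₂
  rw [sinh_vLog (by nlinarith) (by nlinarith), abs_of_pos (by nlinarith), abs_of_pos (by nlinarith)]
  ring

/-- For |c_k| > 1 the products (c₁+1)(c₂+1) and (c₁-1)(c₂-1) both have the sign of c₁c₂, and
removing the two absolute values costs exactly the factor l. -/
lemma sinh_vLog_of_gt {c₁ c₂ l : ℝ} (h₁ : 1 < |c₁|) (h₂ : 1 < |c₂|) (hl : l = 1 ∨ l = -1)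
    (h : 0 < l * (c₁ * c₂)) :
    l * Real.sinh (2 * vLog c₁ c₂) * Real.sqrt |(1 - c₁ ^ 2) * (1 - c₂ ^ 2)| = c₁ + c₂ := by
  have q1 : 1 < c₁ ^ 2 := by rw [← sq_abs]; nlinarith
  have q2 : 1 < c₂ ^ 2 := by rw [← sq_abs]; nlinarith
  rw [mul_assoc, sinh_vLog (by linarith) (by linarith)]
  rcases lt_abs.1 h₁ with a | a <;> rcases lt_abs.1 h₂ with b | b <;> rcases hl with rfl | rfl <;>
  first
  | (exfalso; nlinarith)
  | (rw [abs_of_pos (by nlinarith), abs_of_pos (by nlinarith)]; ring)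
  | (rw [abs_of_neg (by nlinarith), abs_of_neg (by nlinarith)]; ring)

lemma sin_vArctan (c₁ c₂ : ℝ) :
    Real.sin (2 * vArctan c₁ c₂) * Real.sqrt |(1 + c₁ ^ 2) * (1 + c₂ ^ 2)| = c₁ + c₂ := by
  have e : 2 * vArctan c₁ c₂ = Real.arctan c₁ + Real.arctan c₂ := by unfold vArctan; ring
  have p1 : 0 < 1 + c₁ ^ 2 := by positivity
  have p2 : 0 < 1 + c₂ ^ 2 := by positivity
  rw [e, Real.sin_add, Real.sin_arctan, Real.cos_arctan, Real.sin_arctan, Real.cos_arctan,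
    abs_of_pos (by positivity), Real.sqrt_mul p1.le]
  have s1 := Real.sqrt_pos.2 p1
  have s2 := Real.sqrt_pos.2 p2
  field_simp

/-! ### The modulus of `⟨J₁ f_z, J₂ f_z⟩` -/

lemma sgn_pc (ε : ℝ) (p : ℕ) (i : Fin 3) : sgn (PC ε) p i = ⟨sgn ℝ p i, 0⟩ := by
  unfold sgn
  split_ifs <;> ext <;> simp <;> rfl

lemma jmap_pc (p : ℕ) (ε : ℝ) (x X Y : Fin 3 → ℝ) :
    jmap p (fun i => (⟨x i, 0⟩ : PC ε)) (fun i => ⟨X i / 2, -ε * Y i / 2⟩)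
      = fun i => ⟨jmap p x X i / 2, -ε * jmap p x Y i / 2⟩ := by
  funext i
  fin_cases i <;> ext <;>
  simp [jmap, cross, cross_apply, sgn_pc] <;> ring

lemma ip_pc (p : ℕ) (ε : ℝ) (X Y : Fin 3 → ℝ) :
    ip p (fun i => (⟨X i / 2, -ε * Y i / 2⟩ : PC ε)) (fun i => ⟨X i / 2, -ε * Y i / 2⟩)
      = ⟨(ip p X X - ε ^ 3 * ip p Y Y) / 4, -ε * ip p X Y / 2⟩ := by
  ext <;> simp [ip_eq, sgn_pc] <;> ring

/-- The sign in J₂ cancels the one in G, so ⟨J₁F_z, J₂F_z⟩ is `disc p` times ⟨φ_z, φ_z⟩ + ⟨ψ_z,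
ψ_z⟩. Conformality makes the two summands equal. The norm of the Hopf differential becomes T² -
4δa², up to a factor, through the Gram identity. -/
lemma absJJ_eq (p : ℕ) {ε : ℝ} (hε : ε * ε = 1) {f : Plane → Amb} {x : Plane} {E : ℝ}
    {X₁ Y₁ X₂ Y₂ : Fin 3 → ℝ} (hX : pd 0 f x = (X₁, X₂)) (hY : pd 1 f x = (Y₁, Y₂))
    (h1 : ip p (f x).1 (f x).1 = 1) (h2 : ip p (f x).2 (f x).2 = 1)
    (hX₁ : ip p (f x).1 X₁ = 0) (hY₁ : ip p (f x).1 Y₁ = 0)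
    (hX₂ : ip p (f x).2 X₂ = 0) (hY₂ : ip p (f x).2 Y₂ = 0)
    (he : ip p X₁ X₁ - ip p X₂ X₂ = E) (hf : ip p X₁ Y₁ - ip p X₂ Y₂ = 0)
    (hg : ip p Y₁ Y₁ - ip p Y₂ Y₂ = ε * E) :
    absJJ p ε f x = Real.sqrt |(ip p X₁ X₁ + ε * ip p Y₁ Y₁) ^ 2
      - 4 * (ε * disc p) * triple (f x).1 X₁ Y₁ ^ 2| / 2 := by
  have hG : G p (J1 p (toPC ε (f x)) (dz ε f x)) (J2 p (toPC ε (f x)) (dz ε f x))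
      = ⟨disc p * (ip p X₁ X₁ - ε * ip p Y₁ Y₁) / 2, -ε * disc p * ip p X₁ Y₁⟩ := by
    simp only [G, J1, J2, toPC, dz, hX, hY, jmap_pc, ip_neg_right, sub_neg_eq_add]
    rw [ip_pc, ip_pc]
    simp only [ip_jmap_jmap, h1, h2, hX₁, hY₁, hX₂, hY₂]
    ext
    · simp only [QuadraticAlgebra.re_add]
      linear_combination -(disc p / 4) * he + disc p * ε / 4 * hg
        - disc p * ε * (ip p Y₁ Y₁ + ip p Y₂ Y₂) / 4 * hε + disc p * E / 4 * hε
    · simp only [QuadraticAlgebra.im_add]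
      linear_combination ε * disc p / 2 * hf
  have hgr := gram_tangent p h1 hX₁ hY₁
  unfold absJJ modulus
  rw [hG]
  have : QuadraticAlgebra.norm (⟨disc p * (ip p X₁ X₁ - ε * ip p Y₁ Y₁) / 2,
      -ε * disc p * ip p X₁ Y₁⟩ : PC ε) = ((ip p X₁ X₁ + ε * ip p Y₁ Y₁) ^ 2
      - 4 * (ε * disc p) * triple (f x).1 X₁ Y₁ ^ 2) / 4 := by
    rw [QuadraticAlgebra.norm_def]
    simp only
    linear_combination ε * hgr
      + ((ip p X₁ X₁ - ε * ip p Y₁ Y₁) ^ 2 / 4 + ε ^ 3 * ip p X₁ Y₁ ^ 2) * disc_mul_self p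
      + ε * ip p X₁ Y₁ ^ 2 * hε
  rw [this, abs_div, Real.sqrt_div (abs_nonneg _), abs_of_pos (by norm_num : (0 : ℝ) < 4),
    show Real.sqrt 4 = 2 by rw [show (4 : ℝ) = 2 ^ 2 by norm_num]; exact Real.sqrt_sq (by norm_num)]

/-! ### Minimal surfaces in isothermal coordinates -/

section G
variable (p : ℕ) (X Y Z : Amb) (c : ℝ)

lemma G_comm : G p X Y = G p Y X := by simp only [G, ip_comm p X.1, ip_comm p X.2]
lemma G_add_right : G p X (Y + Z) = G p X Y + G p X Z := by
  simp only [G, Prod.fst_add, Prod.snd_add, ip_add_right]; ring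
lemma G_sub_right : G p X (Y - Z) = G p X Y - G p X Z := by
  simp only [G, Prod.fst_sub, Prod.snd_sub, ip_sub_right]; ring
lemma G_smul_right : G p X (c • Y) = c * G p X Y := by
  simp only [G, Prod.smul_fst, Prod.smul_snd, ip_smul_right]; ring
lemma G_add_left : G p (X + Y) Z = G p X Z + G p Y Z := by
  rw [G_comm, G_add_right, G_comm p Z, G_comm p Z]
lemma G_sub_left : G p (X - Y) Z = G p X Z - G p Y Z := by
  rw [G_comm, G_sub_right, G_comm p Z, G_comm p Z]
lemma G_smul_left : G p (c • X) Y = c * G p X Y := by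
  rw [G_comm, G_smul_right, G_comm]

end G

lemma eq_zero_of_ip_eq_zero (p : ℕ) {x : Fin 3 → ℝ} (h : ∀ y, ip p x y = 0) : x = 0 := by
  funext k
  have hk := h (Pi.single k 1)
  have hs := sgn_mul_self (K := ℝ) p k
  have e : ip p x (Pi.single k 1) = sgn ℝ p k * x k := by
    simp [ip, Pi.single_apply]
  rw [e] at hk
  have : x k = sgn ℝ p k * sgn ℝ p k * x k := by rw [hs, one_mul]
  rw [this, mul_assoc, hk, mul_zero]; rfl

/-- A tangent vector of `𝕊²_p × 𝕊²_p` which is orthogonal to a plane with orthogonal basis `X`, `Y`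
and to all its normal vectors vanishes. -/
lemma eq_zero_of_orthogonal (p : ℕ) {ε E : ℝ} (hε : ε * ε = 1) (hE : E ≠ 0) {x X Y V : Amb}
    (h1 : ip p x.1 x.1 = 1) (h2 : ip p x.2 x.2 = 1)
    (hX1 : ip p x.1 X.1 = 0) (hX2 : ip p x.2 X.2 = 0)
    (hY1 : ip p x.1 Y.1 = 0) (hY2 : ip p x.2 Y.2 = 0)
    (hXX : G p X X = E) (hXY : G p X Y = 0) (hYY : G p Y Y = ε * E)
    (hV1 : ip p x.1 V.1 = 0) (hV2 : ip p x.2 V.2 = 0) (hVX : G p V X = 0) (hVY : G p V Y = 0)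
    (hVN : ∀ N : Amb, ip p x.1 N.1 = 0 → ip p x.2 N.2 = 0 → G p X N = 0 → G p Y N = 0 →
      G p V N = 0) : V = 0 := by
  have key : ∀ W : Amb, ip p x.1 W.1 = 0 → ip p x.2 W.2 = 0 → G p V W = 0 := by
    intro W hW1 hW2
    -- Subtracting the orthogonal projection to the plane turns any tangent vector W of the product
    -- into a normal one; this uses E ≠ 0 rather than definiteness.
    have := hVN (W - ((G p X W / E) • X + (ε * G p Y W / E) • Y)) ?_ ?_ ?_ ?_
    · rwa [G_sub_right, G_add_right, G_smul_right, G_smul_right, hVX, hVY, mul_zero, mul_zero,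
        add_zero, sub_zero] at this
    · simp only [Prod.fst_sub, Prod.fst_add, Prod.smul_fst, ip_sub_right, ip_add_right,
        ip_smul_right, hW1, hX1, hY1]; ring
    · simp only [Prod.snd_sub, Prod.snd_add, Prod.smul_snd, ip_sub_right, ip_add_right,
        ip_smul_right, hW2, hX2, hY2]; ring
    · rw [G_sub_right, G_add_right, G_smul_right, G_smul_right, hXX, hXY]
      field_simp; ring
    · rw [G_sub_right, G_add_right, G_smul_right, G_smul_right, hYY, G_comm p Y X, hXY]
      field_simp
      linear_combination -(G p Y W) * E * hε
  have v1 : V.1 = 0 := eq_zero_of_ip_eq_zero p fun y => by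
    -- An arbitrary y is made tangent to the quadric, which costs nothing because V.1 is itself
    -- tangent.
    have := key (y - ip p x.1 y • x.1, 0)
      (by simp only [ip_sub_right, ip_smul_right, h1]; ring) (ip_zero_right p _)
    simp only [G, ip_sub_right, ip_smul_right, ip_zero_right, ip_comm p V.1 x.1, hV1] at this
    linarith
  have v2 : V.2 = 0 := eq_zero_of_ip_eq_zero p fun y => by
    have := key (0, y - ip p x.2 y • x.2) (ip_zero_right p _)
      (by simp only [ip_sub_right, ip_smul_right, h2]; ring)
    simp only [G, ip_sub_right, ip_smul_right, ip_zero_right, ip_comm p V.2 x.2, hV2] at this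
    linarith
  exact Prod.ext v1 v2

lemma contDiffOn_met {p : ℕ} {f : Plane → Amb} {U : Set Plane} (hU : IsOpen U)
    (hf : ContDiffOn ℝ ∞ f U) (i j : Fin 2) :
    ContDiffOn ℝ ∞ (met p f i j) U := by
  have s := fun i => ContDiffOn.pd hU hf i
  exact (contDiffOn_ip p (contDiff_fst.comp_contDiffOn (s i))
    (contDiff_fst.comp_contDiffOn (s j))).sub (contDiffOn_ip p
    (contDiff_snd.comp_contDiffOn (s i)) (contDiff_snd.comp_contDiffOn (s j)))

/-- A smooth parametrised minimal surface in isothermal coordinates. -/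
structure IsMinimalPatch (p : ℕ) (ε : ℝ) (f : Plane → Amb) (U : Set Plane) : Prop where
  smooth : ContDiffOn ℝ ∞ f U
  mem_fst : ∀ x ∈ U, ip p (f x).1 (f x).1 = 1
  mem_snd : ∀ x ∈ U, ip p (f x).2 (f x).2 = 1
  orth : ∀ x ∈ U, met p f 0 1 x = 0
  conf : ∀ x ∈ U, met p f 0 0 x = ε * met p f 1 1 x
  ne_zero : ∀ x ∈ U, met p f 0 0 x ≠ 0
  minimal : ∀ x ∈ U, ∀ N, IsNormalAt p f x N → meanCurv p f x N = 0

namespace IsMinimalPatch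

variable {p : ℕ} {ε : ℝ} {f : Plane → Amb} {U : Set Plane} {x : Plane}

lemma smooth_fst (h : IsMinimalPatch p ε f U) : ContDiffOn ℝ ∞ (fun y => (f y).1) U :=
  contDiff_fst.comp_contDiffOn h.smooth

lemma smooth_snd (h : IsMinimalPatch p ε f U) : ContDiffOn ℝ ∞ (fun y => (f y).2) U :=
  contDiff_snd.comp_contDiffOn h.smooth

lemma pd_eq (hU : IsOpen U) (h : IsMinimalPatch p ε f U) (hx : x ∈ U) (i : Fin 2) :
    pd i f x = (pd i (fun y => (f y).1) x, pd i (fun y => (f y).2) x) := by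
  have d := differentiableAt_of_contDiffOn hU h.smooth hx
  rw [pd_fst d, pd_snd d]

lemma pd_pd_eq (hU : IsOpen U) (h : IsMinimalPatch p ε f U) (hx : x ∈ U) (i j : Fin 2) :
    pd i (pd j f) x = (pd i (pd j fun y => (f y).1) x, pd i (pd j fun y => (f y).2) x) := by
  have s := ContDiffOn.pd hU h.smooth j
  have d := differentiableAt_of_contDiffOn hU s hx
  have e1 : ∀ y ∈ U, (fun z => (pd j f z).1) y = pd j (fun y => (f y).1) y := fun y hy =>
    congrArg Prod.fst (h.pd_eq hU hy j)
  have e2 : ∀ y ∈ U, (fun z => (pd j f z).2) y = pd j (fun y => (f y).2) y := fun y hy =>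
    congrArg Prod.snd (h.pd_eq hU hy j)
  rw [← pd_congr_on hU hx e1 i, ← pd_congr_on hU hx e2 i, pd_fst d, pd_snd d]

lemma met_eq (hU : IsOpen U) (h : IsMinimalPatch p ε f U) (hx : x ∈ U) (i j : Fin 2) :
    met p f i j x = ip p (pd i (fun y => (f y).1) x) (pd j (fun y => (f y).1) x)
      - ip p (pd i (fun y => (f y).2) x) (pd j (fun y => (f y).2) x) := by
  rw [met, h.pd_eq hU hx, h.pd_eq hU hx]; rfl

lemma smooth_met (hU : IsOpen U) (h : IsMinimalPatch p ε f U) (i j : Fin 2) :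
    ContDiffOn ℝ ∞ (met p f i j) U :=
  contDiffOn_met hU h.smooth i j

lemma pd_met (hU : IsOpen U) (h : IsMinimalPatch p ε f U) (hx : x ∈ U) (i j k : Fin 2) :
    pd k (met p f i j) x = G p (pd k (pd i f) x) (pd j f x) + G p (pd i f x) (pd k (pd j f) x) := by
  have s := fun i => ContDiffOn.pd hU h.smooth i
  have d1 := fun i => differentiableAt_of_contDiffOn hU (contDiff_fst.comp_contDiffOn (s i)) hx
  have d2 := fun i => differentiableAt_of_contDiffOn hU (contDiff_snd.comp_contDiffOn (s i)) hx
  have d := fun i => differentiableAt_of_contDiffOn hU (s i) hx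
  have e : met p f i j = fun y => ip p (pd i f y).1 (pd j f y).1 - ip p (pd i f y).2 (pd j f y).2 :=
    rfl
  have i1 := differentiableAt_of_contDiffOn hU (contDiffOn_ip p
    (contDiff_fst.comp_contDiffOn (s i)) (contDiff_fst.comp_contDiffOn (s j))) hx
  have i2 := differentiableAt_of_contDiffOn hU (contDiffOn_ip p
    (contDiff_snd.comp_contDiffOn (s i)) (contDiff_snd.comp_contDiffOn (s j))) hx
  rw [e]
  refine (pd_sub i1 i2 k).trans ?_
  have q1 := pd_ip p (d1 i) (d1 j) k
  have q2 := pd_ip p (d2 i) (d2 j) k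
  simp only [Function.comp_def, pd_fst (d _), pd_snd (d _)] at q1 q2 ⊢
  rw [q1, q2]
  simp only [G]
  ring

/-- Both components of a minimal surface in isothermal coordinates are harmonic. -/
lemma laplacian_eq (hε : ε * ε = 1) (hU : IsOpen U) (h : IsMinimalPatch p ε f U) (hx : x ∈ U) :
    pd 0 (pd 0 f) x + ε • pd 1 (pd 1 f) x + (energy p ε (fun y => (f y).1) x • (f x).1,
      energy p ε (fun y => (f y).2) x • (f x).2) = 0 := by
  have t1 := fun i => ip_pd_eq_zero hU h.smooth_fst h.mem_fst hx i
  have t2 := fun i => ip_pd_eq_zero hU h.smooth_snd h.mem_snd hx i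
  have u1 := fun i j => ip_pd_pd hU h.smooth_fst h.mem_fst hx i j
  have u2 := fun i j => ip_pd_pd hU h.smooth_snd h.mem_snd hx i j
  have hpd := fun i => h.pd_eq hU hx i
  have hpp := fun i j => h.pd_pd_eq hU hx i j
  have t1' : ∀ i, ip p (f x).1 (pd i f x).1 = 0 := fun i => by rw [hpd]; exact t1 i
  have t2' : ∀ i, ip p (f x).2 (pd i f x).2 = 0 := fun i => by rw [hpd]; exact t2 i
  have hYY : met p f 1 1 x = ε * met p f 0 0 x := by
    rw [h.conf x hx, ← mul_assoc, hε, one_mul]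
  have dm := fun i j => differentiableAt_of_contDiffOn hU (h.smooth_met hU i j) hx
  have c0 : ∀ k, pd k (met p f 0 1) x = 0 := fun k => by
    rw [pd_congr_on hU hx (g := fun _ => 0) h.orth, pd_const]
  have c1 : ∀ k, pd k (met p f 0 0) x = ε * pd k (met p f 1 1) x := fun k => by
    rw [pd_congr_on hU hx h.conf, pd_const_mul (dm 1 1)]
  have hc := pd_comm hU hx h.smooth 1 0
  have m00 := c0 0
  have m01 := c0 1
  have m10 := c1 0
  have m11 := c1 1
  rw [h.pd_met hU hx] at m00 m01
  rw [h.pd_met hU hx, h.pd_met hU hx] at m10 m11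
  rw [hc] at m01 m11
  -- The x-derivative of |F_x|² = ε|F_y|² and the y-derivative of ⟨F_x, F_y⟩ = 0 combine so that the
  -- term ⟨F_xy, F_y⟩ cancels. `hLY` uses the other two derivatives.
  have hLX : G p (pd 0 (pd 0 f) x + ε • pd 1 (pd 1 f) x) (pd 0 f x) = 0 := by
    rw [G_add_left, G_smul_left]
    rw [G_comm p (pd 0 f x)] at m10 m01
    rw [G_comm p (pd 1 f x)] at m10
    linear_combination m10 / 2 + ε * m01
  have hLY : G p (pd 0 (pd 0 f) x + ε • pd 1 (pd 1 f) x) (pd 1 f x) = 0 := by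
    rw [G_add_left, G_smul_left]
    rw [G_comm p (pd 0 f x)] at m00 m11
    rw [G_comm p (pd 1 f x)] at m11
    linear_combination m00 - m11 / 2
  refine eq_zero_of_orthogonal p hε (h.ne_zero x hx) (h.mem_fst x hx) (h.mem_snd x hx)
    (t1' 0) (t2' 0) (t1' 1) (t2' 1) rfl (h.orth x hx) hYY ?_ ?_ ?_ ?_ ?_
  · rw [hpp, hpp]
    simp only [Prod.fst_add, Prod.smul_fst, ip_add_right, ip_smul_right, u1, h.mem_fst x hx, energy]
    ring
  · rw [hpp, hpp]
    simp only [Prod.snd_add, Prod.smul_snd, ip_add_right, ip_smul_right, u2, h.mem_snd x hx, energy]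
    ring
  · rw [G_add_left, hLX]
    simp only [G, ip_smul_left, t1', t2']; ring
  · rw [G_add_left, hLY]
    simp only [G, ip_smul_left, t1', t2']; ring
  · intro N hN1 hN2 hX hY
    have hm := h.minimal x hx N ⟨hN1, hN2, fun i => by fin_cases i <;> assumption⟩
    have h11 : met p f 1 1 x ≠ 0 := fun e => h.ne_zero x hx (by rw [h.conf x hx, e, mul_zero])
    have hdet : metDet p f x ≠ 0 := by
      rw [metDet, h.orth x hx, zero_pow two_ne_zero, sub_zero]
      exact mul_ne_zero (h.ne_zero x hx) h11
    rw [meanCurv, div_eq_zero_iff, or_iff_left (mul_ne_zero two_ne_zero hdet), h.orth x hx,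
      h.conf x hx] at hm
    have hs : sff p f 0 0 x N + ε * sff p f 1 1 x N = 0 :=
      mul_left_cancel₀ h11 (by linear_combination hm)
    rw [G_add_left, G_add_left, G_smul_left]
    simp only [sff] at hs
    rw [hs]
    simp only [G, ip_smul_left, hN1, hN2]; ring

lemma harmonic_fst (hε : ε * ε = 1) (hU : IsOpen U) (h : IsMinimalPatch p ε f U) :
    IsHarmonicOn p ε (fun y => (f y).1) U where
  smooth := h.smooth_fst
  mem := h.mem_fst
  harmonic x hx := by
    have := congrArg Prod.fst (h.laplacian_eq hε hU hx)
    rw [h.pd_pd_eq hU hx, h.pd_pd_eq hU hx] at this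
    rw [neg_smul]
    exact eq_neg_of_add_eq_zero_left this

lemma harmonic_snd (hε : ε * ε = 1) (hU : IsOpen U) (h : IsMinimalPatch p ε f U) :
    IsHarmonicOn p ε (fun y => (f y).2) U where
  smooth := h.smooth_snd
  mem := h.mem_snd
  harmonic x hx := by
    have := congrArg Prod.snd (h.laplacian_eq hε hU hx)
    rw [h.pd_pd_eq hU hx, h.pd_pd_eq hU hx] at this
    rw [neg_smul]
    exact eq_neg_of_add_eq_zero_left this

end IsMinimalPatch

/-- The Bochner term κa/4 is -E(c₁ + c₂)/8. The second term is s|E|(c₁ + c₂)/8, because the root in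
M combines with Φ, and s is the sign of E. -/
lemma IsHarmonicOn.gordon {p : ℕ} {ε : ℝ} {φ : Plane → Fin 3 → ℝ} {U : Set Plane} {x : Plane}
    (hε : ε * ε = 1) (hU : IsOpen U) (h : IsHarmonicOn p ε φ U)
    {κ : ℝ} (hκ : κ * κ = 1) {c₁ c₂ E v : Plane → ℝ}
    (hc₁ : ∀ y ∈ U, DifferentiableAt ℝ c₁ y) (hc₂ : ∀ y ∈ U, DifferentiableAt ℝ c₂ y)
    (hE : ∀ y ∈ U, DifferentiableAt ℝ E y) (hE0 : ∀ y ∈ U, E y ≠ 0)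
    (h₁ : ∀ y ∈ U, 1 - ε * disc p * c₁ y ^ 2 ≠ 0) (h₂ : ∀ y ∈ U, 1 - ε * disc p * c₂ y ^ 2 ≠ 0)
    (hT : ∀ y ∈ U, energy p ε φ y = E y * (1 + ε * disc p * (c₁ y * c₂ y)))
    (ha : ∀ y ∈ U, jac φ y = -(κ / 2) * (E y * (c₁ y + c₂ y)))
    (hv : ∀ y ∈ U, ∀ i, pd i v y = (pd i c₁ y / (1 - ε * disc p * c₁ y ^ 2)
      + pd i c₂ y / (1 - ε * disc p * c₂ y ^ 2)) / 2) (hx : x ∈ U)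
    {M s Φ : ℝ} (hs : s * |E x| = E x)
    (hM : M = |E x| * Real.sqrt |(1 - ε * disc p * c₁ x ^ 2) * (1 - ε * disc p * c₂ x ^ 2)| / 2)
    (hΦ : Φ * Real.sqrt |(1 - ε * disc p * c₁ x ^ 2) * (1 - ε * disc p * c₂ x ^ 2)|
      = c₁ x + c₂ x) :
    dzdzbar ε v x + s * (M / 4) * Φ = 0 := by
  rw [h.dzdzbar_potential hε hU hκ hc₁ hc₂ hE hE0 h₁ h₂ hT ha hv hx, ha x hx, hM]
  linear_combination s * |E x| / 8 * hΦ - (E x * (c₁ x + c₂ x)) / 8 * hκ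
    + (c₁ x + c₂ x) / 8 * hs

/-! ### Area form, Jacobians and energies in terms of the Kähler functions -/

namespace IsMinimalPatch

variable {p : ℕ} {ε σ o : ℝ} {f : Plane → Amb} {U : Set Plane} {x : Plane} {c₁ c₂ : Plane → ℝ}

lemma abs_met (hσ : σ = 1 ∨ σ = -1) (hpos : 0 < σ * met p f 0 0 x) :
    σ * |met p f 0 0 x| = met p f 0 0 x := by
  rcases hσ with rfl | rfl
  · rw [abs_of_pos (by linarith)]; ring
  · rw [abs_of_neg (by linarith)]; ring

lemma areaForm_eq (hε : ε * ε = 1) (hσ : σ = 1 ∨ σ = -1) (h : IsMinimalPatch p ε f U)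
    (hpos : 0 < σ * met p f 0 0 x) (hx : x ∈ U) :
    areaForm p f x = ε * σ * met p f 0 0 x := by
  have hYY : met p f 1 1 x = ε * met p f 0 0 x := by
    rw [h.conf x hx, ← mul_assoc, hε, one_mul]
  have hD : metDet p f x = ε * met p f 0 0 x ^ 2 := by
    rw [metDet, h.orth x hx, hYY]; ring
  have ha : |ε| = 1 := by
    rcases mul_self_eq_one_iff.1 hε with rfl | rfl <;> simp
  have hm := abs_met hσ hpos
  have h0 : |met p f 0 0 x| ≠ 0 := abs_ne_zero.2 (h.ne_zero x hx)
  rw [areaForm, hD, abs_mul, ha, one_mul, abs_pow, Real.sqrt_sq (abs_nonneg _), ← sq_abs,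
    div_eq_iff h0]
  nth_rewrite 2 [← hm]
  rcases hσ with rfl | rfl <;> ring

end IsMinimalPatch

/-- A minimal patch with its Kähler functions `c₁`, `c₂`; the sign `o` compares the orientation of
the coordinates with that of the surface. -/
structure IsKahlerPatch (p : ℕ) (ε σ o : ℝ) (f : Plane → Amb) (c₁ c₂ : Plane → ℝ)
    (U : Set Plane) : Prop extends IsMinimalPatch p ε f U where
  isOpen : IsOpen U
  eps_sq : ε * ε = 1
  sigma : σ = 1 ∨ σ = -1
  orient : o * o = 1
  pos : ∀ x ∈ U, 0 < σ * met p f 0 0 x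
  omega₁ : ∀ x ∈ U, Omega1 p (f x) (pd 0 f x) (pd 1 f x) = o * c₁ x * areaForm p f x
  omega₂ : ∀ x ∈ U, Omega2 p (f x) (pd 0 f x) (pd 1 f x) = o * c₂ x * areaForm p f x
  diff₁ : ∀ x ∈ U, DifferentiableAt ℝ c₁ x
  diff₂ : ∀ x ∈ U, DifferentiableAt ℝ c₂ x

namespace IsKahlerPatch

variable {p : ℕ} {ε σ o : ℝ} {f : Plane → Amb} {U : Set Plane} {x : Plane} {c₁ c₂ : Plane → ℝ}

/-- Half the sum and half the difference of Ω₁ and Ω₂ isolate the Kähler form of each factor, which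
is minus its Jacobian. -/
lemma jac_eq (h : IsKahlerPatch p ε σ o f c₁ c₂ U) (hx : x ∈ U) :
    jac (fun y => (f y).1) x = -(o * ε * σ / 2) * (met p f 0 0 x * (c₁ x + c₂ x)) ∧
    jac (fun y => (f y).2) x = (o * ε * σ / 2) * (met p f 0 0 x * (c₁ x - c₂ x)) := by
  have e1 := h.omega₁ x hx
  have e2 := h.omega₂ x hx
  have ha := h.areaForm_eq h.eps_sq h.sigma (h.pos x hx) hx
  rw [Omega1, h.pd_eq h.isOpen hx, h.pd_eq h.isOpen hx, kform_eq, kform_eq, ha] at e1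
  rw [Omega2, h.pd_eq h.isOpen hx, h.pd_eq h.isOpen hx, kform_eq, kform_eq, ha] at e2
  simp only [jac]
  constructor
  · linear_combination -(e1 + e2) / 2
  · linear_combination (e1 - e2) / 2

lemma sign_sq (h : IsKahlerPatch p ε σ o f c₁ c₂ U) : (o * ε * σ) * (o * ε * σ) = 1 := by
  have hs : σ * σ = 1 := by rcases h.sigma with e | e <;> rw [e] <;> norm_num
  linear_combination (ε * ε * σ * σ) * h.orient + σ * σ * h.eps_sq + hs

/-- With a₁, a₂ the Jacobians, the Gram identities give `disc p` · (a₁² - a₂²) as the difference of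
two metric determinants. As the metrics differ by the conformal one, this difference is εE(T - E),
with T the first energy; and a₁² - a₂² = E²c₁c₂. Cancelling E gives T. -/
lemma energy_eq (h : IsKahlerPatch p ε σ o f c₁ c₂ U) (hx : x ∈ U) :
    energy p ε (fun y => (f y).1) x
      = met p f 0 0 x * (1 + ε * disc p * (c₁ x * c₂ x)) ∧
    energy p ε (fun y => (f y).2) x
      = -met p f 0 0 x * (1 - ε * disc p * (c₁ x * c₂ x)) := by
  have hd1 := (h.harmonic_fst h.eps_sq h.isOpen).gram_jac h.isOpen hx
  have hd2 := (h.harmonic_snd h.eps_sq h.isOpen).gram_jac h.isOpen hx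
  have m00 := h.met_eq h.isOpen hx 0 0
  have m01 := h.met_eq h.isOpen hx 0 1
  have m11 := h.met_eq h.isOpen hx 1 1
  have hYY : met p f 1 1 x = ε * met p f 0 0 x := by
    rw [h.conf x hx, ← mul_assoc, h.eps_sq, one_mul]
  rw [h.orth x hx] at m01
  rw [hYY] at m11
  have hE := h.ne_zero x hx
  obtain ⟨ja, jb⟩ := h.jac_eq hx
  rw [ja] at hd1
  rw [jb] at hd2
  have hk := h.sign_sq
  have hε := h.eps_sq
  have key : energy p ε (fun y => (f y).1) x
      = met p f 0 0 x * (1 + ε * disc p * (c₁ x * c₂ x)) := by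
    refine mul_left_cancel₀ hE ?_
    unfold energy
    generalize ip p (pd 0 (fun y => (f y).1) x) (pd 0 (fun y => (f y).1) x) = e1 at *
    generalize ip p (pd 0 (fun y => (f y).1) x) (pd 1 (fun y => (f y).1) x) = f1 at *
    generalize ip p (pd 1 (fun y => (f y).1) x) (pd 1 (fun y => (f y).1) x) = g1 at *
    generalize ip p (pd 0 (fun y => (f y).2) x) (pd 0 (fun y => (f y).2) x) = e2 at *
    generalize ip p (pd 0 (fun y => (f y).2) x) (pd 1 (fun y => (f y).2) x) = f2 at *
    generalize ip p (pd 1 (fun y => (f y).2) x) (pd 1 (fun y => (f y).2) x) = g2 at *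
    obtain rfl : e2 = e1 - met p f 0 0 x := by linarith
    obtain rfl : f2 = f1 := by linarith
    obtain rfl : g2 = g1 - ε * met p f 0 0 x := by linarith
    generalize met p f 0 0 x = E at *
    linear_combination ε * hd2 - ε * hd1 + ε * disc p * E ^ 2 * c₁ x * c₂ x * hk
      - (E * e1 - E ^ 2) * hε
  refine ⟨key, ?_⟩
  have : energy p ε (fun y => (f y).2) x
      = energy p ε (fun y => (f y).1) x - 2 * met p f 0 0 x := by
    unfold energy
    linear_combination m00 + ε * m11 - met p f 0 0 x * hε
  rw [this, key]; ring

lemma absJJ_formula (h : IsKahlerPatch p ε σ o f c₁ c₂ U) (hx : x ∈ U) :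
    absJJ p ε f x = |met p f 0 0 x| * Real.sqrt |(1 - ε * disc p * c₁ x ^ 2)
      * (1 - ε * disc p * c₂ x ^ 2)| / 2 := by
  have m00 := h.met_eq h.isOpen hx 0 0
  have m01 := h.met_eq h.isOpen hx 0 1
  have m11 := h.met_eq h.isOpen hx 1 1
  have hYY : met p f 1 1 x = ε * met p f 0 0 x := by
    rw [h.conf x hx, ← mul_assoc, h.eps_sq, one_mul]
  rw [h.orth x hx] at m01
  rw [hYY] at m11
  have t1 := fun i => ip_pd_eq_zero h.isOpen h.smooth_fst h.mem_fst hx i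
  have t2 := fun i => ip_pd_eq_zero h.isOpen h.smooth_snd h.mem_snd hx i
  rw [absJJ_eq p h.eps_sq (h.pd_eq h.isOpen hx 0) (h.pd_eq h.isOpen hx 1) (h.mem_fst x hx)
    (h.mem_snd x hx) (t1 0) (t1 1) (t2 0) (t2 1) m00.symm m01.symm m11.symm]
  have : (ip p (pd 0 (fun y => (f y).1) x) (pd 0 (fun y => (f y).1) x)
      + ε * ip p (pd 1 (fun y => (f y).1) x) (pd 1 (fun y => (f y).1) x)) ^ 2
      - 4 * (ε * disc p) * triple (f x).1 (pd 0 (fun y => (f y).1) x)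
        (pd 1 (fun y => (f y).1) x) ^ 2
      = met p f 0 0 x ^ 2 * ((1 - ε * disc p * c₁ x ^ 2) * (1 - ε * disc p * c₂ x ^ 2)) := by
    change energy p ε (fun y => (f y).1) x ^ 2
      - 4 * (ε * disc p) * jac (fun y => (f y).1) x ^ 2 = _
    rw [(h.energy_eq hx).1, (h.jac_eq hx).1]
    linear_combination -(ε * disc p) * met p f 0 0 x ^ 2 * (c₁ x + c₂ x) ^ 2 * h.sign_sq
  rw [this, abs_mul, Real.sqrt_mul (abs_nonneg _), abs_pow, Real.sqrt_sq (abs_nonneg _)]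

/-- The Gordon equation for the potential of the first factor. -/
theorem gordon_fst (h : IsKahlerPatch p ε σ o f c₁ c₂ U)
    (h₁ : ∀ y ∈ U, 1 - ε * disc p * c₁ y ^ 2 ≠ 0) (h₂ : ∀ y ∈ U, 1 - ε * disc p * c₂ y ^ 2 ≠ 0)
    {v : Plane → ℝ} (hv : ∀ y ∈ U, ∀ i, pd i v y = (pd i c₁ y / (1 - ε * disc p * c₁ y ^ 2)
      + pd i c₂ y / (1 - ε * disc p * c₂ y ^ 2)) / 2) (hx : x ∈ U) {Φ : ℝ}
    (hΦ : Φ * Real.sqrt |(1 - ε * disc p * c₁ x ^ 2) * (1 - ε * disc p * c₂ x ^ 2)|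
      = c₁ x + c₂ x) :
    dzdzbar ε v x + σ * (absJJ p ε f x / 4) * Φ = 0 :=
  (h.harmonic_fst h.eps_sq h.isOpen).gordon h.eps_sq h.isOpen h.sign_sq h.diff₁ h.diff₂
    (fun _ hy => differentiableAt_of_contDiffOn h.isOpen (h.smooth_met h.isOpen 0 0) hy)
    h.ne_zero h₁ h₂ (fun _ hy => (h.energy_eq hy).1) (fun _ hy => (h.jac_eq hy).1) hv hx
    (IsMinimalPatch.abs_met h.sigma (h.pos x hx)) (h.absJJ_formula hx) hΦ

/-- The Gordon equation for the potential of the second factor. -/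
theorem gordon_snd (h : IsKahlerPatch p ε σ o f c₁ c₂ U) {τ : ℝ} (hτ : τ * τ = 1)
    (h₁ : ∀ y ∈ U, 1 - ε * disc p * c₁ y ^ 2 ≠ 0) (h₂ : ∀ y ∈ U, 1 - ε * disc p * c₂ y ^ 2 ≠ 0)
    {d₁ d₂ : Plane → ℝ} (hd₁ : ∀ y, d₁ y = τ * c₁ y) (hd₂ : ∀ y, d₂ y = -τ * c₂ y)
    {w : Plane → ℝ} (hw : ∀ y ∈ U, ∀ i, pd i w y = (pd i d₁ y / (1 - ε * disc p * d₁ y ^ 2)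
      + pd i d₂ y / (1 - ε * disc p * d₂ y ^ 2)) / 2) (hx : x ∈ U) {Φ : ℝ}
    (hΦ : Φ * Real.sqrt |(1 - ε * disc p * d₁ x ^ 2) * (1 - ε * disc p * d₂ x ^ 2)|
      = d₁ x + d₂ x) :
    dzdzbar ε w x + -σ * (absJJ p ε f x / 4) * Φ = 0 := by
  have s1 : ∀ y, d₁ y ^ 2 = c₁ y ^ 2 := fun y => by
    rw [hd₁]; linear_combination c₁ y ^ 2 * hτ
  have s2 : ∀ y, d₂ y ^ 2 = c₂ y ^ 2 := fun y => by
    rw [hd₂]; linear_combination c₂ y ^ 2 * hτ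
  -- The second factor has the shape of the first after E ↦ -E, with τ moved into κ. The sign of -E
  -- is -σ, hence the sign in the conclusion.
  refine (h.harmonic_snd h.eps_sq h.isOpen).gordon (κ := τ * (o * ε * σ)) (c₁ := d₁) (c₂ := d₂)
    (E := fun y => -met p f 0 0 y) h.eps_sq h.isOpen ?_ ?_ ?_ ?_ ?_ ?_ ?_ ?_ ?_ hw hx ?_ ?_ hΦ
  · linear_combination (o * ε * σ) ^ 2 * hτ + h.sign_sq
  · intro y hy
    rw [funext hd₁]; exact (h.diff₁ y hy).const_mul τ
  · intro y hy
    rw [funext hd₂]; exact (h.diff₂ y hy).const_mul (-τ)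
  · exact fun y hy =>
      (differentiableAt_of_contDiffOn h.isOpen (h.smooth_met h.isOpen 0 0) hy).fun_neg
  · exact fun y hy => neg_ne_zero.2 (h.ne_zero y hy)
  · intro y hy; rw [s1]; exact h₁ y hy
  · intro y hy; rw [s2]; exact h₂ y hy
  · intro y hy
    rw [(h.energy_eq hy).2, hd₁, hd₂]
    linear_combination -met p f 0 0 y * (ε * disc p) * (c₁ y * c₂ y) * hτ
  · intro y hy
    rw [(h.jac_eq hy).2, hd₁, hd₂]
    linear_combination -(o * ε * σ / 2) * (met p f 0 0 y * (c₁ y - c₂ y)) * hτ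
  · have := IsMinimalPatch.abs_met h.sigma (h.pos x hx)
    rw [abs_neg]
    linear_combination -this
  · rw [abs_neg, s1, s2]
    exact h.absJJ_formula hx

end IsKahlerPatch

/-! ### Complex points of surfaces with definite metric -/

lemma disc_zero : disc 0 = 1 := by simp [disc, sgn]
lemma disc_one : disc 1 = -1 := by simp [disc, sgn]
lemma disc_two : disc 2 = 1 := by simp [disc, sgn]

lemma ip_zero_definite (v : Fin 3 → ℝ) : 0 ≤ ip 0 v v ∧ (ip 0 v v = 0 → v = 0) := by
  have e : ip 0 v v = v 0 ^ 2 + v 1 ^ 2 + v 2 ^ 2 := by simp [ip_eq, sgn]; ring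
  rw [e]
  refine ⟨by positivity, fun h => ?_⟩
  funext k
  fin_cases k <;> simp <;> nlinarith [sq_nonneg (v 0), sq_nonneg (v 1), sq_nonneg (v 2)]

/-- The quadric for p = 2 is a two-sheeted hyperboloid with negative definite tangent planes.
Cauchy–Schwarz applied to x₂v₂ = x₀v₀ + x₁v₁, with x₂² = 1 + x₀² + x₁², bounds v₂. -/
lemma ip_two_definite {x v : Fin 3 → ℝ} (hx : ip 2 x x = 1) (hv : ip 2 x v = 0) :
    0 ≤ -ip 2 v v ∧ (-ip 2 v v = 0 → v = 0) := by
  have e : ∀ y z : Fin 3 → ℝ, ip 2 y z = -(y 0 * z 0) - y 1 * z 1 + y 2 * z 2 := by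
    intro y z; simp [ip_eq, sgn]; ring
  rw [e] at hx hv
  rw [e]
  have cs : (x 2 * v 2) ^ 2 ≤ (x 2 ^ 2 - 1) * (v 0 ^ 2 + v 1 ^ 2) := by
    have h1 : x 2 * v 2 = x 0 * v 0 + x 1 * v 1 := by linarith
    have h2 : x 2 ^ 2 - 1 = x 0 ^ 2 + x 1 ^ 2 := by linarith
    rw [h1, h2]
    nlinarith [sq_nonneg (x 0 * v 1 - x 1 * v 0)]
  have x2 : 1 ≤ x 2 ^ 2 := by nlinarith [sq_nonneg (x 0), sq_nonneg (x 1)]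
  have key : v 0 ^ 2 + v 1 ^ 2 ≤ x 2 ^ 2 * (v 0 ^ 2 + v 1 ^ 2 - v 2 ^ 2) := by nlinarith
  have nn : 0 ≤ v 0 ^ 2 + v 1 ^ 2 := by positivity
  have hx2 : 0 < x 2 ^ 2 := by linarith
  refine ⟨?_, fun h => ?_⟩
  · by_contra hc
    have : v 0 ^ 2 + v 1 ^ 2 - v 2 ^ 2 < 0 := by linarith
    have := mul_neg_of_pos_of_neg hx2 this
    linarith
  · have h0 : v 0 ^ 2 + v 1 ^ 2 - v 2 ^ 2 = 0 := by linarith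
    rw [h0, mul_zero] at key
    have k0 : v 0 = 0 := by nlinarith [sq_nonneg (v 0), sq_nonneg (v 1)]
    have k1 : v 1 = 0 := by nlinarith [sq_nonneg (v 0), sq_nonneg (v 1)]
    have k2 : v 2 = 0 := by rw [k0, k1] at h0; nlinarith
    funext k
    fin_cases k <;> simp [k0, k1, k2]

/-- Independent tangent vectors span the tangent plane of a definite quadric. -/
lemma exists_combination (p : ℕ) {c : ℝ} {x X Y : Fin 3 → ℝ} (hx : ip p x x = 1)
    (hX : ip p x X = 0) (hY : ip p x Y = 0)
    (hdef : ∀ v, ip p x v = 0 → c * ip p v v = 0 → v = 0)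
    (hind : ∀ a b : ℝ, a • X + b • Y = 0 → a = 0 ∧ b = 0) {v : Fin 3 → ℝ} (hv : ip p x v = 0) :
    ∃ a b : ℝ, v = a • X + b • Y := by
  have ht : triple x X Y ≠ 0 := by
    intro h0
    have hg := gram_tangent p hx hX hY
    rw [h0] at hg
    have t : ∀ a b : ℝ, ip p x (a • X + b • Y) = 0 := by
      intro a b; rw [ip_add_right, ip_smul_right, ip_smul_right, hX, hY]; ring
    -- If the Gram determinant vanishes, this combination is null, hence zero by definiteness,
    -- contradicting independence.
    have q := hdef (ip p Y Y • X + (-ip p X Y) • Y) (t _ _) (by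
      simp only [ip_add_left, ip_add_right, ip_smul_left, ip_smul_right, ip_comm p Y X]
      linear_combination -c * ip p Y Y * hg)
    obtain ⟨hYY, -⟩ := hind _ _ q
    have := hind 0 1 (by rw [hdef Y hY (by rw [hYY, mul_zero])]; simp)
    exact one_ne_zero this.2
  have h0 : triple v X Y = 0 := by
    rw [triple_of_tangent p hx hv hY, hX, zero_mul]
  refine ⟨triple x v Y / triple x X Y, triple x X v / triple x X Y, ?_⟩
  have key : triple x X Y • v = triple v X Y • x + triple x v Y • X + triple x X v • Y := by
    funext k
    fin_cases k <;> simp [triple] <;> ring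
  rw [h0, zero_smul, zero_add] at key
  rw [div_eq_inv_mul, div_eq_inv_mul, mul_smul, mul_smul, ← smul_add, ← key, smul_smul,
    inv_mul_cancel₀ ht, one_smul]

/-- A null vector which is normal to a positive definite tangent plane vanishes. -/
lemma eq_zero_of_normal_null {p : ℕ} (hp : p = 0 ∨ p = 2) {x X Y N : Amb}
    (h1 : ip p x.1 x.1 = 1) (h2 : ip p x.2 x.2 = 1)
    (hX1 : ip p x.1 X.1 = 0) (hX2 : ip p x.2 X.2 = 0)
    (hY1 : ip p x.1 Y.1 = 0) (hY2 : ip p x.2 Y.2 = 0)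
    (hpos : ∀ a b : ℝ, ¬ (a = 0 ∧ b = 0) → 0 < G p (a • X + b • Y) (a • X + b • Y))
    (hN1 : ip p x.1 N.1 = 0) (hN2 : ip p x.2 N.2 = 0)
    (hNX : G p X N = 0) (hNY : G p Y N = 0) (hNN : G p N N = 0) : N = 0 := by
  -- The plane projects isomorphically to the factor on which G is positive definite, so some W in
  -- the plane shares that component with N. Then W - N lies in the other factor and has length at
  -- most 0, while its length equals that of W. So W = 0.
  have gd : ∀ W : Amb, (∃ a b : ℝ, W = a • X + b • Y) →
      G p (W - N) (W - N) = G p W W := by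
    rintro W ⟨a, b, rfl⟩
    rw [G_sub_left, G_sub_right, G_sub_right, hNN, G_comm p N, G_add_left p _ _ N, G_smul_left,
      G_smul_left, hNX, hNY]
    ring
  have hzero : ∀ a b : ℝ, G p (a • X + b • Y) (a • X + b • Y) ≤ 0 → a = 0 ∧ b = 0 :=
    fun a b h => by
      by_contra hc
      exact absurd (hpos a b hc) (not_lt.2 h)
  rcases hp with rfl | rfl
  · have hind : ∀ a b : ℝ, a • X.1 + b • Y.1 = 0 → a = 0 ∧ b = 0 := by
      intro a b h
      refine hzero a b ?_
      have := (ip_zero_definite (a • X + b • Y).2).1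
      rw [G, show (a • X + b • Y).1 = 0 from h, ip_zero_left]
      linarith
    obtain ⟨a, b, hab⟩ := exists_combination 0 (c := 1) h1 hX1 hY1
      (fun v _ h => (ip_zero_definite v).2 (by linarith)) hind hN1
    have hg := gd _ ⟨a, b, rfl⟩
    have hd : (a • X + b • Y - N).1 = 0 := by
      rw [Prod.fst_sub, hab]; simp
    have q := (ip_zero_definite (a • X + b • Y - N).2).1
    rw [G, hd, ip_zero_left] at hg
    obtain ⟨rfl, rfl⟩ := hzero a b (by linarith)
    have n1 : N.1 = 0 := by rw [hab]; simp
    rw [G, n1, ip_zero_left] at hNN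
    exact Prod.ext n1 ((ip_zero_definite _).2 (by linarith))
  · have t : ∀ a b : ℝ, ip 2 x.1 (a • X + b • Y).1 = 0 ∧ ip 2 x.2 (a • X + b • Y).2 = 0 := by
      intro a b
      simp only [Prod.fst_add, Prod.snd_add, Prod.smul_fst, Prod.smul_snd, ip_add_right,
        ip_smul_right, hX1, hY1, hX2, hY2]
      simp
    have hind : ∀ a b : ℝ, a • X.2 + b • Y.2 = 0 → a = 0 ∧ b = 0 := by
      intro a b h
      refine hzero a b ?_
      have := (ip_two_definite h1 (t a b).1).1
      rw [G, show (a • X + b • Y).2 = 0 from h, ip_zero_left]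
      linarith
    obtain ⟨a, b, hab⟩ := exists_combination 2 (c := -1) h2 hX2 hY2
      (fun v hv h => (ip_two_definite h2 hv).2 (by linarith)) hind hN2
    have hg := gd _ ⟨a, b, rfl⟩
    have hd : (a • X + b • Y - N).2 = 0 := by
      rw [Prod.snd_sub, hab]; simp
    have q := (ip_two_definite (v := (a • X + b • Y - N).1) h1 (by
      rw [Prod.fst_sub, ip_sub_right, (t a b).1, hN1, sub_zero])).1
    rw [G, hd, ip_zero_left] at hg
    obtain ⟨rfl, rfl⟩ := hzero a b (by linarith)
    have n2 : N.2 = 0 := by rw [hab]; simp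
    rw [G, n2, ip_zero_left] at hNN
    exact Prod.ext ((ip_two_definite h1 hN1).2 (by linarith)) n2

/-- Intended for Z = J_kX. The conditions on ⟨Y, Z⟩ and |Z|² say that the projection of Z to the
plane already has the length of Z, so the normal part is null and vanishes. -/
lemma mem_span_of_sq_eq {p : ℕ} (hp : p = 0 ∨ p = 2) {x X Y Z : Amb}
    (h1 : ip p x.1 x.1 = 1) (h2 : ip p x.2 x.2 = 1)
    (hX1 : ip p x.1 X.1 = 0) (hX2 : ip p x.2 X.2 = 0)
    (hY1 : ip p x.1 Y.1 = 0) (hY2 : ip p x.2 Y.2 = 0)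
    (hpos : ∀ a b : ℝ, ¬ (a = 0 ∧ b = 0) → 0 < G p (a • X + b • Y) (a • X + b • Y))
    (hZ1 : ip p x.1 Z.1 = 0) (hZ2 : ip p x.2 Z.2 = 0)
    (hD : 0 < G p X X * G p Y Y - G p X Y ^ 2)
    (hZX : G p X Z = 0) (hZZ : G p Z Z = G p X X)
    (hZY : G p Y Z ^ 2 = G p X X * G p Y Y - G p X Y ^ 2) :
    ∃ a b : ℝ, Z = a • X + b • Y := by
  set D := G p X X * G p Y Y - G p X Y ^ 2 with hDdef
  set W : Amb := (-(G p Y Z * G p X Y / D)) • X + (G p Y Z * G p X X / D) • Y with hW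
  refine ⟨-(G p Y Z * G p X Y / D), G p Y Z * G p X X / D, ?_⟩
  have hD' := hD.ne'
  have eX : G p X (Z - W) = 0 := by
    rw [G_sub_right, hW, G_add_right, G_smul_right, G_smul_right, hZX]; ring
  have eY : G p Y (Z - W) = 0 := by
    rw [G_sub_right, hW, G_add_right, G_smul_right, G_smul_right, G_comm p Y X]
    field_simp
    rw [hDdef]; ring
  have eN : G p (Z - W) (Z - W) = 0 := by
    have : G p W (Z - W) = 0 := by
      rw [hW, G_add_left, G_smul_left, G_smul_left, ← hW, eX, eY]; ring
    rw [G_sub_left, this, G_sub_right, hZZ, hW, G_add_right, G_smul_right, G_smul_right,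
      G_comm p Z X, hZX, G_comm p Z Y]
    field_simp
    linear_combination -G p X X * hZY
  have t : ip p x.1 W.1 = 0 ∧ ip p x.2 W.2 = 0 := by
    simp only [hW, Prod.fst_add, Prod.snd_add, Prod.smul_fst, Prod.smul_snd, ip_add_right,
      ip_smul_right, hX1, hY1, hX2, hY2]
    simp
  exact sub_eq_zero.1 (eq_zero_of_normal_null hp h1 h2 hX1 hX2 hY1 hY2 hpos
    (by rw [Prod.fst_sub, ip_sub_right, hZ1, t.1, sub_zero])
    (by rw [Prod.snd_sub, ip_sub_right, hZ2, t.2, sub_zero]) eX eY eN)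

lemma ip_jmap (p : ℕ) (x v : Fin 3 → ℝ) : ip p x (jmap p x v) = 0 := by
  rw [ip_comm]
  change kform p x v x = 0
  rw [kform_eq]; simp only [triple]; ring

lemma kform_self (p : ℕ) (x v : Fin 3 → ℝ) : kform p x v v = 0 := by
  rw [kform_eq]; simp only [triple]; ring

lemma kform_swap (p : ℕ) (x v w : Fin 3 → ℝ) : kform p x v w = -kform p x w v := by
  rw [kform_eq, kform_eq]; simp only [triple]; ring

lemma jmap_add_smul (p : ℕ) (x X Y : Fin 3 → ℝ) (a b : ℝ) :
    jmap p x (a • X + b • Y) = a • jmap p x X + b • jmap p x Y := by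
  funext k
  fin_cases k <;> simp [jmap, cross, cross_apply] <;> ring

lemma G_J1 (p : ℕ) (x X Y : Amb) : G p (J1 p x X) Y = Omega1 p x X Y := rfl

lemma G_J2 (p : ℕ) (x X Y : Amb) : G p (J2 p x X) Y = Omega2 p x X Y := by
  simp only [G, J2, Omega2, kform, ip_neg_left, sub_neg_eq_add]

lemma J1_add_smul (p : ℕ) (x X Y : Amb) (a b : ℝ) :
    J1 p x (a • X + b • Y) = a • J1 p x X + b • J1 p x Y :=
  Prod.ext (jmap_add_smul p _ _ _ a b) (jmap_add_smul p _ _ _ a b)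

lemma J2_add_smul (p : ℕ) (x X Y : Amb) (a b : ℝ) :
    J2 p x (a • X + b • Y) = a • J2 p x X + b • J2 p x Y := by
  refine Prod.ext (jmap_add_smul p _ _ _ a b) ?_
  change -jmap p x.2 (a • X.2 + b • Y.2) = a • -jmap p x.2 X.2 + b • -jmap p x.2 Y.2
  rw [jmap_add_smul, smul_neg, smul_neg, neg_add]

/-- On a positive definite tangent plane with `|C_k| = 1` the plane is preserved by `J_k`. -/
lemma J_mem_span {p : ℕ} (hp : p = 0 ∨ p = 2) {x X Y : Amb}
    (h1 : ip p x.1 x.1 = 1) (h2 : ip p x.2 x.2 = 1)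
    (hX1 : ip p x.1 X.1 = 0) (hX2 : ip p x.2 X.2 = 0)
    (hY1 : ip p x.1 Y.1 = 0) (hY2 : ip p x.2 Y.2 = 0)
    (hpos : ∀ a b : ℝ, ¬ (a = 0 ∧ b = 0) → 0 < G p (a • X + b • Y) (a • X + b • Y))
    (hD : 0 < G p X X * G p Y Y - G p X Y ^ 2) :
    (Omega1 p x X Y ^ 2 = G p X X * G p Y Y - G p X Y ^ 2 →
      ∃ a b : ℝ, J1 p x X = a • X + b • Y) ∧
    (Omega2 p x X Y ^ 2 = G p X X * G p Y Y - G p X Y ^ 2 →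
      ∃ a b : ℝ, J2 p x X = a • X + b • Y) := by
  -- This makes j an isometry of the tangent planes, so J₁ and J₂ preserve G.
  have hd : disc p = 1 := by
    rcases hp with rfl | rfl
    · exact disc_zero
    · exact disc_two
  constructor
  · intro h
    refine mem_span_of_sq_eq hp h1 h2 hX1 hX2 hY1 hY2 hpos (ip_jmap _ _ _) (ip_jmap _ _ _) hD
      ?_ ?_ ?_
    · rw [G_comm, G_J1, Omega1, kform_self, kform_self, sub_zero]
    · simp only [G, J1, ip_jmap_jmap, h1, h2, hX1, hX2, hd]; ring
    · rw [G_comm, G_J1, h]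
  · intro h
    refine mem_span_of_sq_eq hp h1 h2 hX1 hX2 hY1 hY2 hpos (ip_jmap _ _ _) ?_ hD ?_ ?_ ?_
    · simp only [J2, ip_neg_right, ip_jmap, neg_zero]
    · rw [G_comm, G_J2, Omega2, kform_self, kform_self, add_zero]
    · simp only [G, J2, ip_neg_left, ip_neg_right, ip_jmap_jmap, h1, h2, hX1, hX2, hd]; ring
    · rw [G_comm, G_J2, h]

/-! ### Surfaces in charts -/

section Surface

variable {S : Type*} [TopologicalSpace S] [ChartedSpace Plane S]
  {p : ℕ} {F : S → Amb} {e e' : OpenPartialHomeomorph S Plane} {x : Plane}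

lemma contDiffOn_comp_symm {W : Type*} [NormedAddCommGroup W] [NormedSpace ℝ W] {u : S → W}
    (hu : ContMDiff (𝓡 2) 𝓘(ℝ, W) ∞ u) (he : e ∈ Charts S) :
    ContDiffOn ℝ ∞ (u ∘ e.symm) e.target :=
  contMDiffOn_iff_contDiffOn.1
    (hu.comp_contMDiffOn (contMDiffOn_symm_of_mem_maximalAtlas he))

lemma contMDiffAt_of_comp_symm {W : Type*} [NormedAddCommGroup W] [NormedSpace ℝ W] {u : S → W}
    (he : e ∈ Charts S) (hu : ContDiffOn ℝ ∞ (u ∘ e.symm) e.target) {q : S} (hq : q ∈ e.source) :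
    ContMDiffAt (𝓡 2) 𝓘(ℝ, W) ∞ u q := by
  have h1 := (contMDiffOn_iff_contDiffOn.2 hu).comp (contMDiffOn_of_mem_maximalAtlas he)
    e.mapsTo
  refine (h1.contMDiffAt (e.open_source.mem_nhds hq)).congr_of_eventuallyEq ?_
  filter_upwards [e.open_source.mem_nhds hq] with y hy
  simp [e.left_inv hy]

lemma exists_coordinate_frame (hF : ContMDiff (𝓡 2) 𝓘(ℝ, Amb) ∞ F) (he : e ∈ Charts S)
    (hx : x ∈ e.target) : ∃ t : Plane ≃ₗ[ℝ] TangentSpace (𝓡 2) (e.symm x),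
      ∀ y, fderiv ℝ (F ∘ e.symm) x y = dF F (e.symm x) (t y) := by
  have hd : e.MDifferentiable (𝓡 2) (𝓡 2) :=
    ⟨(contMDiffOn_of_mem_maximalAtlas he).mdifferentiableOn (by simp),
      (contMDiffOn_symm_of_mem_maximalAtlas he).mdifferentiableOn (by simp)⟩
  refine ⟨(hd.symm.mfderiv (x := x) hx).toLinearEquiv, fun y => ?_⟩
  rw [← mfderiv_eq_fderiv, mfderiv_comp (I' := 𝓡 2) x
    (hF.mdifferentiable (by simp) _) (hd.mdifferentiableAt_symm hx)]
  rfl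

lemma plane_eq (y : Plane) : y = y 0 • EuclideanSpace.single 0 (1 : ℝ)
    + y 1 • EuclideanSpace.single 1 (1 : ℝ) := by
  ext k
  fin_cases k <;> simp

lemma fderiv_apply_eq {W : Type*} [NormedAddCommGroup W] [NormedSpace ℝ W] (f : Plane → W)
    (x y : Plane) : fderiv ℝ f x y = y 0 • pd 0 f x + y 1 • pd 1 f x := by
  conv_lhs => rw [plane_eq y, map_add, map_smul, map_smul]
  rfl

/-- The differential of `F` in terms of the partial derivatives in a chart. -/
lemma exists_coordinates (hF : ContMDiff (𝓡 2) 𝓘(ℝ, Amb) ∞ F) (he : e ∈ Charts S)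
    (hx : x ∈ e.target) : ∃ t : Plane ≃ₗ[ℝ] TangentSpace (𝓡 2) (e.symm x),
      ∀ y, dF F (e.symm x) (t y) = y 0 • pd 0 (F ∘ e.symm) x + y 1 • pd 1 (F ∘ e.symm) x := by
  obtain ⟨t, ht⟩ := exists_coordinate_frame hF he hx
  exact ⟨t, fun y => by rw [← ht, fderiv_apply_eq]⟩

lemma G_combination (p : ℕ) (f : Plane → Amb) (x : Plane) (a b : ℝ) :
    G p (a • pd 0 f x + b • pd 1 f x) (a • pd 0 f x + b • pd 1 f x)
      = a ^ 2 * met p f 0 0 x + 2 * a * b * met p f 0 1 x + b ^ 2 * met p f 1 1 x := by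
  simp only [G_add_left, G_add_right, G_smul_left, G_smul_right, met,
    G_comm p (pd 1 f x) (pd 0 f x)]
  ring

lemma IsRiemannian.pos (hF : ContMDiff (𝓡 2) 𝓘(ℝ, Amb) ∞ F) (h : IsRiemannian p F)
    (he : e ∈ Charts S) (hx : x ∈ e.target) {a b : ℝ} (hab : ¬ (a = 0 ∧ b = 0)) :
    0 < G p (a • pd 0 (F ∘ e.symm) x + b • pd 1 (F ∘ e.symm) x)
      (a • pd 0 (F ∘ e.symm) x + b • pd 1 (F ∘ e.symm) x) := by
  obtain ⟨t, ht⟩ := exists_coordinates hF he hx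
  have q := h (e.symm x) (t !₂[a, b]) (by
    rw [Ne, LinearEquiv.map_eq_zero_iff]
    intro h0
    exact hab ⟨by simpa using congrArg (fun y : Plane => y 0) h0,
      by simpa using congrArg (fun y : Plane => y 1) h0⟩)
  rw [ht] at q
  simpa using q

lemma IsRiemannian.metDet_pos (hF : ContMDiff (𝓡 2) 𝓘(ℝ, Amb) ∞ F) (h : IsRiemannian p F)
    (he : e ∈ Charts S) (hx : x ∈ e.target) : 0 < metDet p (F ∘ e.symm) x := by
  have q0 := h.pos hF he hx (a := 1) (b := 0) (by simp)
  have q1 := h.pos hF he hx (a := -met p (F ∘ e.symm) 0 1 x) (b := met p (F ∘ e.symm) 0 0 x) (by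
    rw [G_combination] at q0
    rintro ⟨-, h0⟩
    rw [h0] at q0
    norm_num at q0)
  rw [G_combination] at q0 q1
  have q0' : 0 < met p (F ∘ e.symm) 0 0 x := by linarith
  refine (mul_pos_iff_of_pos_left q0').1 ?_
  rw [metDet]
  linarith

lemma IsLorentzian.metDet_neg (hF : ContMDiff (𝓡 2) 𝓘(ℝ, Amb) ∞ F) (h : IsLorentzian p F)
    (he : e ∈ Charts S) (hx : x ∈ e.target) : metDet p (F ∘ e.symm) x < 0 := by
  obtain ⟨t, ht⟩ := exists_coordinates hF he hx
  obtain ⟨⟨X, hX⟩, ⟨Y, hY⟩⟩ := h (e.symm x)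
  rw [← t.apply_symm_apply X, ht, G_combination] at hX
  rw [← t.apply_symm_apply Y, ht, G_combination] at hY
  generalize t.symm X = X at *
  generalize t.symm Y = Y at *
  rw [metDet]
  generalize met p (F ∘ e.symm) 0 0 x = E at *
  generalize met p (F ∘ e.symm) 0 1 x = M at *
  generalize met p (F ∘ e.symm) 1 1 x = H at *
  by_contra! hD
  -- Completing the square: if the determinant were nonnegative, E times the quadratic form would
  -- never be negative. A form taking both signs then forces E = 0, hence M = 0, leaving H b², which
  -- has only one sign.
  have key : ∀ a b : ℝ, 0 ≤ E * (a ^ 2 * E + 2 * a * b * M + b ^ 2 * H) := by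
    intro a b
    have : E * (a ^ 2 * E + 2 * a * b * M + b ^ 2 * H)
      = (E * a + M * b) ^ 2 + (E * H - M ^ 2) * b ^ 2 := by ring
    rw [this]; positivity
  have k1 := key (X 0) (X 1)
  have k2 := key (Y 0) (Y 1)
  have hE : E = 0 := by
    rcases lt_trichotomy E 0 with hE | hE | hE
    · exact absurd k1 (not_le.2 (mul_neg_of_neg_of_pos hE hX))
    · exact hE
    · exact absurd k2 (not_le.2 (mul_neg_of_pos_of_neg hE hY))
  rw [hE] at hD hX hY
  have hM : M = 0 := by nlinarith
  rw [hM] at hX hY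
  have h1 : 0 < X 1 ^ 2 * H := by linarith
  have h2 : Y 1 ^ 2 * H < 0 := by linarith
  have h3 : 0 < H := by
    by_contra! hc
    nlinarith [sq_nonneg (X 1)]
  nlinarith [sq_nonneg (Y 1)]

section smooth
variable {f : Plane → Amb} {U : Set Plane}

lemma sqrt_abs_ne_zero {D : ℝ} (h : D ≠ 0) : Real.sqrt |D| ≠ 0 :=
  (Real.sqrt_pos.2 (abs_pos.2 h)).ne'

lemma areaForm_ne_zero (h0 : metDet p f x ≠ 0) : areaForm p f x ≠ 0 :=
  div_ne_zero h0 (sqrt_abs_ne_zero h0)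

lemma contDiffOn_areaForm (hU : IsOpen U) (hf : ContDiffOn ℝ ∞ f U)
    (h0 : ∀ x ∈ U, metDet p f x ≠ 0) : ContDiffOn ℝ ∞ (areaForm p f) U := by
  have hD : ContDiffOn ℝ ∞ (metDet p f) U :=
    ((contDiffOn_met hU hf 0 0).mul (contDiffOn_met hU hf 1 1)).sub
      ((contDiffOn_met hU hf 0 1).pow 2)
  have habs : ContDiffOn ℝ ∞ (fun y => |metDet p f y|) U := fun y hy =>
    (contDiffAt_abs (h0 y hy)).comp_contDiffWithinAt y (hD y hy)
  exact hD.div (habs.sqrt fun y hy => abs_ne_zero.2 (h0 y hy))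
    fun y hy => sqrt_abs_ne_zero (h0 y hy)

lemma contDiffOn_kform {φ : Plane → Fin 3 → ℝ} (hφ : ContDiffOn ℝ ∞ φ U)
    {X Y : Plane → Fin 3 → ℝ} (hX : ContDiffOn ℝ ∞ X U) (hY : ContDiffOn ℝ ∞ Y U) :
    ContDiffOn ℝ ∞ (fun y => kform p (φ y) (X y) (Y y)) U := by
  simp only [kform_eq]
  exact (contDiffOn_triple hφ hX hY).neg

lemma contDiffOn_Omega (hU : IsOpen U) (hf : ContDiffOn ℝ ∞ f U) :
    ContDiffOn ℝ ∞ (fun y => Omega1 p (f y) (pd 0 f y) (pd 1 f y)) U ∧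
    ContDiffOn ℝ ∞ (fun y => Omega2 p (f y) (pd 0 f y) (pd 1 f y)) U := by
  have s := fun i => ContDiffOn.pd hU hf i
  have k1 := contDiffOn_kform (p := p) (contDiff_fst.comp_contDiffOn hf)
    (contDiff_fst.comp_contDiffOn (s 0)) (contDiff_fst.comp_contDiffOn (s 1))
  have k2 := contDiffOn_kform (p := p) (contDiff_snd.comp_contDiffOn hf)
    (contDiff_snd.comp_contDiffOn (s 0)) (contDiff_snd.comp_contDiffOn (s 1))
  exact ⟨k1.sub k2, k1.add k2⟩

end smooth

/-- The Kähler functions of a nondegenerate surface are smooth. -/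
lemma IsKahlerPair.contMDiff {A : Set (OpenPartialHomeomorph S Plane)} (hA : IsOrientedAtlas A)
    (hF : ContMDiff (𝓡 2) 𝓘(ℝ, Amb) ∞ F) {C₁ C₂ : S → ℝ} (hC : IsKahlerPair p A F C₁ C₂)
    (h0 : ∀ e ∈ Charts S, ∀ x ∈ e.target, metDet p (F ∘ e.symm) x ≠ 0) :
    ContMDiff (𝓡 2) 𝓘(ℝ, ℝ) ∞ C₁ ∧ ContMDiff (𝓡 2) 𝓘(ℝ, ℝ) ∞ C₂ := by
  have key : ∀ e ∈ A, ContDiffOn ℝ ∞ (C₁ ∘ e.symm) e.target ∧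
      ContDiffOn ℝ ∞ (C₂ ∘ e.symm) e.target := by
    intro e he
    have hf := contDiffOn_comp_symm hF (hA.subset he)
    have ha := contDiffOn_areaForm (p := p) e.open_target hf (h0 e (hA.subset he))
    have han : ∀ x ∈ e.target, areaForm p (F ∘ e.symm) x ≠ 0 := fun x hx =>
      areaForm_ne_zero (h0 e (hA.subset he) x hx)
    obtain ⟨s1, s2⟩ := contDiffOn_Omega (p := p) e.open_target hf
    exact ⟨(s1.div ha han).congr fun x hx => eq_div_of_mul_eq (han x hx) (hC e he x hx).1.symm,
      (s2.div ha han).congr fun x hx => eq_div_of_mul_eq (han x hx) (hC e he x hx).2.symm⟩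
  constructor
  · intro q
    obtain ⟨e, he, hq⟩ := hA.cover q
    exact contMDiffAt_of_comp_symm (hA.subset he) (key e he).1 hq
  · intro q
    obtain ⟨e, he, hq⟩ := hA.cover q
    exact contMDiffAt_of_comp_symm (hA.subset he) (key e he).2 hq

/-- In a chart, `F` takes values in the quadrics with tangent partial derivatives. -/
lemma IsImmersionInto.tangent (hF : IsImmersionInto p F) (he : e ∈ Charts S) (hx : x ∈ e.target)
    (i : Fin 2) : ip p (F (e.symm x)).1 (pd i (F ∘ e.symm) x).1 = 0 ∧
      ip p (F (e.symm x)).2 (pd i (F ∘ e.symm) x).2 = 0 := by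
  have hf := contDiffOn_comp_symm hF.smooth he
  have d := differentiableAt_of_contDiffOn e.open_target hf hx
  rw [← pd_fst d, ← pd_snd d]
  exact ⟨ip_pd_eq_zero e.open_target (contDiff_fst.comp_contDiffOn hf)
    (fun y _ => (hF.mem (e.symm y)).1) hx i, ip_pd_eq_zero e.open_target
    (contDiff_snd.comp_contDiffOn hf) (fun y _ => (hF.mem (e.symm y)).2) hx i⟩

/-- At a point of a Riemannian surface which is not complex, `C_k ≠ ± 1`. -/
lemma one_sub_sq_ne_zero {A : Set (OpenPartialHomeomorph S Plane)} (hA : IsOrientedAtlas A)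
    (hp : p = 0 ∨ p = 2) (hF : IsImmersionInto p F) (hR : IsRiemannian p F)
    (hpts : ∀ q, ¬ IsComplexPoint p F q) {C₁ C₂ : S → ℝ} (hC : IsKahlerPair p A F C₁ C₂) (q : S) :
    1 - C₁ q ^ 2 ≠ 0 ∧ 1 - C₂ q ^ 2 ≠ 0 := by
  obtain ⟨e, he, hq⟩ := hA.cover q
  have heC := hA.subset he
  have hx := e.map_source hq
  obtain ⟨w1, w2⟩ := hC e he _ hx
  have hD := hR.metDet_pos hF.smooth heC hx
  have hpos : ∀ a b : ℝ, ¬ (a = 0 ∧ b = 0) → _ :=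
    fun a b hab => hR.pos hF.smooth heC hx (a := a) (b := b) hab
  obtain ⟨t, ht⟩ := exists_coordinates hF.smooth heC hx
  have m := hF.mem (e.symm (e q))
  have tg := hF.tangent heC hx
  -- The span criterion treats J_k on the first basis vector only; exchanging the two gives J_k on
  -- the second.
  have hpos' : ∀ a b : ℝ, ¬ (a = 0 ∧ b = 0) →
      0 < G p (a • pd 1 (F ∘ e.symm) (e q) + b • pd 0 (F ∘ e.symm) (e q))
        (a • pd 1 (F ∘ e.symm) (e q) + b • pd 0 (F ∘ e.symm) (e q)) := by
    intro a b hab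
    rw [add_comm]
    exact hpos b a fun h => hab h.symm
  have ha : areaForm p (F ∘ e.symm) (e q) ^ 2 = metDet p (F ∘ e.symm) (e q) := by
    rw [areaForm, abs_of_pos hD, div_pow, Real.sq_sqrt hD.le, sq, mul_div_assoc, div_self hD.ne',
      mul_one]
  have hD' : 0 < G p (pd 1 (F ∘ e.symm) (e q)) (pd 1 (F ∘ e.symm) (e q))
      * G p (pd 0 (F ∘ e.symm) (e q)) (pd 0 (F ∘ e.symm) (e q))
      - G p (pd 1 (F ∘ e.symm) (e q)) (pd 0 (F ∘ e.symm) (e q)) ^ 2 := by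
    rw [G_comm p (pd 1 _ _) (pd 0 _ _), mul_comm]; exact hD
  obtain ⟨r1, r2⟩ := J_mem_span hp m.1 m.2 (tg 0).1 (tg 0).2 (tg 1).1 (tg 1).2 hpos hD
  obtain ⟨r1', r2'⟩ := J_mem_span hp m.1 m.2 (tg 1).1 (tg 1).2 (tg 0).1 (tg 0).2 hpos' hD'
  have hdet : metDet p (F ∘ e.symm) (e q) = G p (pd 0 (F ∘ e.symm) (e q)) (pd 0 (F ∘ e.symm) (e q))
      * G p (pd 1 (F ∘ e.symm) (e q)) (pd 1 (F ∘ e.symm) (e q))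
      - G p (pd 0 (F ∘ e.symm) (e q)) (pd 1 (F ∘ e.symm) (e q)) ^ 2 := rfl
  have o1 : ∀ x X Y : Amb, Omega1 p x Y X = -Omega1 p x X Y := fun x X Y => by
    rw [Omega1, Omega1, kform_swap, kform_swap p x.2]; ring
  have o2 : ∀ x X Y : Amb, Omega2 p x Y X = -Omega2 p x X Y := fun x X Y => by
    rw [Omega2, Omega2, kform_swap, kform_swap p x.2]; ring
  have hcq : e.symm (e q) = q := e.left_inv hq
  have surj : ∀ a b : ℝ, ∃ Y, a • pd 0 (F ∘ e.symm) (e q) + b • pd 1 (F ∘ e.symm) (e q)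
      = dF F (e.symm (e q)) Y := fun a b => ⟨t !₂[a, b], by rw [ht]; simp⟩
  constructor
  · intro h
    refine hpts (e.symm (e q)) (Or.inl fun X => ?_)
    have hsq : C₁ (e.symm (e q)) ^ 2 = 1 := by rw [hcq]; linarith
    have e1 : Omega1 p (F (e.symm (e q))) (pd 0 (F ∘ e.symm) (e q)) (pd 1 (F ∘ e.symm) (e q)) ^ 2
      = metDet p (F ∘ e.symm) (e q) := by rw [w1, mul_pow, hsq, one_mul, ha]
    obtain ⟨a, b, hab⟩ := r1 (e1.trans hdet)
    obtain ⟨a', b', hab'⟩ := r1' (by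
      rw [o1, neg_sq, e1, hdet, G_comm p (pd 1 _ _) (pd 0 _ _), mul_comm])
    rw [← t.apply_symm_apply X, ht, J1_add_smul, hab, hab']
    generalize t.symm X = z
    obtain ⟨Y, hY⟩ := surj (z 0 * a + z 1 * b') (z 0 * b + z 1 * a')
    refine ⟨Y, hY ▸ ?_⟩
    module
  · intro h
    refine hpts (e.symm (e q)) (Or.inr fun X => ?_)
    have hsq : C₂ (e.symm (e q)) ^ 2 = 1 := by rw [hcq]; linarith
    have e1 : Omega2 p (F (e.symm (e q))) (pd 0 (F ∘ e.symm) (e q)) (pd 1 (F ∘ e.symm) (e q)) ^ 2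
      = metDet p (F ∘ e.symm) (e q) := by rw [w2, mul_pow, hsq, one_mul, ha]
    obtain ⟨a, b, hab⟩ := r2 (e1.trans hdet)
    obtain ⟨a', b', hab'⟩ := r2' (by
      rw [o2, neg_sq, e1, hdet, G_comm p (pd 1 _ _) (pd 0 _ _), mul_comm])
    rw [← t.apply_symm_apply X, ht, J2_add_smul, hab, hab']
    generalize t.symm X = z
    obtain ⟨Y, hY⟩ := surj (z 0 * a + z 1 * b') (z 0 * b + z 1 * a')
    refine ⟨Y, hY ▸ ?_⟩
    module

end Surface

/-! ### Comparison of orientations and passage to local patches -/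

section Surface

variable {S : Type*} [TopologicalSpace S] [ChartedSpace Plane S]
  {p : ℕ} {F : S → Amb} {e : OpenPartialHomeomorph S Plane} {x : Plane}

lemma kform_combination (p : ℕ) (x X Y : Fin 3 → ℝ) (a b c d : ℝ) :
    kform p x (a • X + b • Y) (c • X + d • Y) = (a * d - b * c) * kform p x X Y := by
  simp only [kform_eq, triple, Pi.add_apply, Pi.smul_apply, smul_eq_mul]; ring

/-- Near each point of a chart, the Kähler functions satisfy their defining equation up to a
constant sign, which compares the orientations. -/
lemma IsKahlerPair.exists_sign {A : Set (OpenPartialHomeomorph S Plane)} (hA : IsOrientedAtlas A)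
    (hF : ContMDiff (𝓡 2) 𝓘(ℝ, Amb) ∞ F) {C₁ C₂ : S → ℝ} (hC : IsKahlerPair p A F C₁ C₂)
    (h0 : ∀ e ∈ Charts S, ∀ x ∈ e.target, metDet p (F ∘ e.symm) x ≠ 0) (he : e ∈ Charts S)
    (hx : x ∈ e.target) : ∃ U : Set Plane, IsOpen U ∧ x ∈ U ∧ U ⊆ e.target ∧ ∃ o : ℝ, o * o = 1 ∧
      ∀ y ∈ U, Omega1 p (F (e.symm y)) (pd 0 (F ∘ e.symm) y) (pd 1 (F ∘ e.symm) y)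
          = o * C₁ (e.symm y) * areaForm p (F ∘ e.symm) y ∧
        Omega2 p (F (e.symm y)) (pd 0 (F ∘ e.symm) y) (pd 1 (F ∘ e.symm) y)
          = o * C₂ (e.symm y) * areaForm p (F ∘ e.symm) y := by
  obtain ⟨e', he', hq⟩ := hA.cover (e.symm x)
  have heC' := hA.subset he'
  set V : Set Plane := e.target ∩ e.symm ⁻¹' e'.source with hV
  have hVo : IsOpen V := e.isOpen_inter_preimage_symm e'.open_source
  set τ : Plane → Plane := e' ∘ e.symm with hτ
  have sτ : ContDiffOn ℝ ∞ τ V := contMDiffOn_iff_contDiffOn.1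
    ((contMDiffOn_of_mem_maximalAtlas heC').comp
      ((contMDiffOn_symm_of_mem_maximalAtlas he).mono Set.inter_subset_left) fun y hy => hy.2)
  have sf' := contDiffOn_comp_symm hF heC'
  have hpd : ∀ y ∈ V, ∀ i, pd i (F ∘ e.symm) y = pd i τ y 0 • pd 0 (F ∘ e'.symm) (τ y)
      + pd i τ y 1 • pd 1 (F ∘ e'.symm) (τ y) := by
    intro y hy i
    have hτy : τ y ∈ e'.target := e'.map_source hy.2
    rw [pd_congr_on hVo hy (g := (F ∘ e'.symm) ∘ τ) (fun z hz => by
      simp [hτ, e'.left_inv hz.2]) i]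
    have d1 := differentiableAt_of_contDiffOn hVo sτ hy
    have d2 := differentiableAt_of_contDiffOn e'.open_target sf' hτy
    rw [← fderiv_apply_eq]
    unfold pd
    rw [fderiv_comp y d2 d1]; rfl
  set J : Plane → ℝ := fun y => pd 0 τ y 0 * pd 1 τ y 1 - pd 0 τ y 1 * pd 1 τ y 0 with hJ
  have hcoord : ∀ i j, ContinuousOn (fun y => pd i τ y j) V := fun i j =>
    (PiLp.continuous_apply 2 (fun _ : Fin 2 => ℝ) j).comp_continuousOn
      (ContDiffOn.pd hVo sτ i).continuousOn
  have cJ : ContinuousOn J V :=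
    ((hcoord 0 0).mul (hcoord 1 1)).sub ((hcoord 0 1).mul (hcoord 1 0))
  have hdet : ∀ y ∈ V, metDet p (F ∘ e.symm) y = J y ^ 2 * metDet p (F ∘ e'.symm) (τ y) := by
    intro y hy
    simp only [metDet, met, hpd y hy, G_add_left, G_add_right, G_smul_left, G_smul_right,
      G_comm p (pd 1 (F ∘ e'.symm) (τ y)) (pd 0 (F ∘ e'.symm) (τ y)), hJ]
    ring
  -- A zero of J would make the induced metric degenerate in the chart `e`.
  have hJ0 : ∀ y ∈ V, J y ≠ 0 := by
    intro y hy hz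
    have := hdet y hy
    rw [hz] at this
    exact h0 e he y hy.1 (by rw [this]; ring)
  have harea : ∀ y ∈ V, areaForm p (F ∘ e.symm) y = |J y| * areaForm p (F ∘ e'.symm) (τ y) := by
    intro y hy
    have hs := sqrt_abs_ne_zero (h0 e' heC' (τ y) (e'.map_source hy.2))
    have hJa : |J y| ≠ 0 := abs_ne_zero.2 (hJ0 y hy)
    rw [areaForm, areaForm, hdet y hy, abs_mul, abs_pow, Real.sqrt_mul (sq_nonneg _),
      Real.sqrt_sq (abs_nonneg _), ← sq_abs]
    field_simp
  have hxV : x ∈ V := ⟨hx, hq⟩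
  obtain ⟨o, ho, hoJ⟩ : ∃ o : ℝ, o * o = 1 ∧ 0 < o * J x := by
    rcases lt_or_gt_of_ne (hJ0 x hxV) with h | h
    · exact ⟨-1, by norm_num, by linarith⟩
    · exact ⟨1, by norm_num, by linarith⟩
  -- The forms Ω_k scale by J but the area form by |J|; on this neighbourhood of x the ratio is the
  -- constant o.
  refine ⟨V ∩ (fun y => o * J y) ⁻¹' Set.Ioi 0,
    (continuousOn_const.mul cJ).isOpen_inter_preimage hVo isOpen_Ioi, ⟨hxV, hoJ⟩,
    fun y hy => hy.1.1, o, ho, fun y hy => ?_⟩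
  have hyV := hy.1
  have hpos : 0 < o * J y := hy.2
  have hJs : J y = o * |J y| := by
    rcases mul_self_eq_one_iff.1 ho with rfl | rfl
    · rw [abs_of_pos (by linarith)]; ring
    · rw [abs_of_neg (by linarith)]; ring
  have hτs : e'.symm (τ y) = e.symm y := e'.left_inv hyV.2
  obtain ⟨w1, w2⟩ := hC e' he' (τ y) (e'.map_source hyV.2)
  rw [hτs] at w1 w2
  have k1 : ∀ z : Amb, kform p z.1 (pd 0 (F ∘ e.symm) y).1 (pd 1 (F ∘ e.symm) y).1
      = J y * kform p z.1 (pd 0 (F ∘ e'.symm) (τ y)).1 (pd 1 (F ∘ e'.symm) (τ y)).1 := by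
    intro z
    rw [hpd y hyV, hpd y hyV]
    exact kform_combination p _ _ _ _ _ _ _
  have k2 : ∀ z : Amb, kform p z.2 (pd 0 (F ∘ e.symm) y).2 (pd 1 (F ∘ e.symm) y).2
      = J y * kform p z.2 (pd 0 (F ∘ e'.symm) (τ y)).2 (pd 1 (F ∘ e'.symm) (τ y)).2 := by
    intro z
    rw [hpd y hyV, hpd y hyV]
    exact kform_combination p _ _ _ _ _ _ _
  constructor
  · rw [Omega1, k1, k2, ← mul_sub, ← Omega1, w1, harea y hyV]
    nth_rewrite 1 [hJs]
    ring
  · rw [Omega2, k1, k2, ← mul_add, ← Omega2, w2, harea y hyV]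
    nth_rewrite 1 [hJs]
    ring

/-- Near each parameter of an isothermal chart where `δ C_k² ≠ 1`, the surface is a Kähler patch. -/
lemma exists_isKahlerPatch {A : Set (OpenPartialHomeomorph S Plane)} (hA : IsOrientedAtlas A)
    (hF : IsImmersionInto p F) (hmin : IsMinimal p F) {C₁ C₂ : S → ℝ}
    (hC : IsKahlerPair p A F C₁ C₂)
    (h0 : ∀ e ∈ Charts S, ∀ x ∈ e.target, metDet p (F ∘ e.symm) x ≠ 0) {ε σ : ℝ}
    (hε : ε * ε = 1) (hσ : σ = 1 ∨ σ = -1) (he : IsIsothermal p ε σ F e) (hx : x ∈ e.target)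
    {δ : ℝ} (h₁ : 1 - δ * C₁ (e.symm x) ^ 2 ≠ 0) (h₂ : 1 - δ * C₂ (e.symm x) ^ 2 ≠ 0) :
    ∃ U o, x ∈ U ∧ IsKahlerPatch p ε σ o (F ∘ e.symm) (C₁ ∘ e.symm) (C₂ ∘ e.symm) U ∧
      (∀ y ∈ U, 1 - δ * (C₁ ∘ e.symm) y ^ 2 ≠ 0) ∧ ∀ y ∈ U, 1 - δ * (C₂ ∘ e.symm) y ^ 2 ≠ 0 := by
  obtain ⟨U, hU, hxU, hUt, o, ho, hΩ⟩ := hC.exists_sign hA hF.smooth h0 he.1 hx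
  obtain ⟨s1, s2⟩ := hC.contMDiff hA hF.smooth h0
  have c1 := contDiffOn_comp_symm s1 he.1
  have c2 := contDiffOn_comp_symm s2 he.1
  set V : Set Plane := (U ∩ (fun y => 1 - δ * (C₁ ∘ e.symm) y ^ 2) ⁻¹' {0}ᶜ)
    ∩ (fun y => 1 - δ * (C₂ ∘ e.symm) y ^ 2) ⁻¹' {0}ᶜ with hV
  have q1 : ContinuousOn (fun y => 1 - δ * (C₁ ∘ e.symm) y ^ 2) U :=
    continuousOn_const.sub (continuousOn_const.mul ((c1.continuousOn.mono hUt).pow 2))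
  have q2 : ContinuousOn (fun y => 1 - δ * (C₂ ∘ e.symm) y ^ 2) U :=
    continuousOn_const.sub (continuousOn_const.mul ((c2.continuousOn.mono hUt).pow 2))
  have hV1 := q1.isOpen_inter_preimage hU (isOpen_compl_singleton (x := (0 : ℝ)))
  have hVo : IsOpen V :=
    (q2.mono Set.inter_subset_left).isOpen_inter_preimage hV1 isOpen_compl_singleton
  have hVt : V ⊆ e.target := fun y hy => hUt hy.1.1
  have hf := contDiffOn_comp_symm hF.smooth he.1
  refine ⟨V, o, ⟨⟨hxU, h₁⟩, h₂⟩, ?_, fun y hy => hy.1.2, fun y hy => hy.2⟩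
  exact
    { smooth := hf.mono hVt
      mem_fst := fun y _ => (hF.mem (e.symm y)).1
      mem_snd := fun y _ => (hF.mem (e.symm y)).2
      orth := fun y hy => (he.2 y (hVt hy)).1
      conf := fun y hy => (he.2 y (hVt hy)).2.1
      ne_zero := fun y hy hz => by
        have := (he.2 y (hVt hy)).2.2
        rw [hz, mul_zero] at this
        exact lt_irrefl _ this
      minimal := fun y hy => hmin e he.1 y (hVt hy)
      isOpen := hVo
      eps_sq := hε
      sigma := hσ
      orient := ho
      pos := fun y hy => (he.2 y (hVt hy)).2.2
      omega₁ := fun y hy => (hΩ y hy.1.1).1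
      omega₂ := fun y hy => (hΩ y hy.1.1).2
      diff₁ := fun y hy => differentiableAt_of_contDiffOn e.open_target c1 (hVt hy)
      diff₂ := fun y hy => differentiableAt_of_contDiffOn e.open_target c2 (hVt hy) }

end Surface

/-! ### The Gordon equations on a patch -/

namespace IsKahlerPatch

variable {p : ℕ} {ε σ o : ℝ} {f : Plane → Amb} {U : Set Plane} {x : Plane} {c₁ c₂ : Plane → ℝ}

/-- The sinh-Gordon equations, where `k` and `l` are signs that make the addition formulas for
`vLog` hold. -/
lemma sinh_gordon (h : IsKahlerPatch p ε σ o f c₁ c₂ U) (hδ : ε * disc p = 1)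
    (h₁ : ∀ y ∈ U, 1 - 1 * c₁ y ^ 2 ≠ 0) (h₂ : ∀ y ∈ U, 1 - 1 * c₂ y ^ 2 ≠ 0) (hx : x ∈ U)
    {k l : ℝ}
    (hk : k * Real.sinh (2 * vLog (c₁ x) (c₂ x)) * Real.sqrt |(1 - c₁ x ^ 2) * (1 - c₂ x ^ 2)|
      = c₁ x + c₂ x)
    (hl : l * Real.sinh (2 * vLog (-c₁ x) (c₂ x)) * Real.sqrt |(1 - c₁ x ^ 2) * (1 - c₂ x ^ 2)|
      = -c₁ x + c₂ x) :
    dzdzbar ε (fun y => vLog (c₁ y) (c₂ y)) x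
        + σ * k * (absJJ p ε f x / 4) * Real.sinh (2 * vLog (c₁ x) (c₂ x)) = 0 ∧
      dzdzbar ε (fun y => wLog (c₁ y) (c₂ y)) x
        + -σ * l * (absJJ p ε f x / 4) * Real.sinh (2 * wLog (c₁ x) (c₂ x)) = 0 := by
  have h₁' : ∀ y ∈ U, 1 - c₁ y ^ 2 ≠ 0 := by simpa using h₁
  have h₂' : ∀ y ∈ U, 1 - c₂ y ^ 2 ≠ 0 := by simpa using h₂
  replace h₁ : ∀ y ∈ U, 1 - ε * disc p * c₁ y ^ 2 ≠ 0 := by rwa [hδ]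
  replace h₂ : ∀ y ∈ U, 1 - ε * disc p * c₂ y ^ 2 ≠ 0 := by rwa [hδ]
  constructor
  · have q := h.gordon_fst h₁ h₂ (v := fun y => vLog (c₁ y) (c₂ y))
      (fun y hy i => by
        rw [hδ, one_mul, one_mul]
        exact pd_vLog h.isOpen h.diff₁ h.diff₂ h₁' h₂' hy i) hx
      (Φ := k * Real.sinh (2 * vLog (c₁ x) (c₂ x))) (by rw [hδ, one_mul, one_mul]; exact hk)
    linear_combination q
  · simp only [wLog_eq_vLog]
    have q := h.gordon_snd (τ := -1) (by norm_num) h₁ h₂ (d₁ := fun y => -c₁ y) (d₂ := c₂)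
      (fun y => by ring) (fun y => by ring) (w := fun y => vLog (-c₁ y) (c₂ y))
      (fun y hy i => by
        rw [hδ, one_mul, one_mul]
        exact pd_vLog h.isOpen (fun z hz => (h.diff₁ z hz).fun_neg) h.diff₂
          (fun z hz => by rw [neg_sq]; exact h₁' z hz) h₂' hy i) hx
      (Φ := l * Real.sinh (2 * vLog (-c₁ x) (c₂ x)))
      (by rw [hδ, one_mul, one_mul, neg_sq]; exact hl)
    linear_combination q

/-- The factor on which G is negative definite has an energy of known sign, which gives c₁c₂ ≥ 1 for
p = 0 and c₁c₂ ≤ -1 for p = 2. The squared Hopf differential is nonnegative, so 1 - c₁² and 1 - c₂²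
cannot have opposite signs; both negative is the only possibility left. -/
lemma one_lt_abs (h : IsKahlerPatch p 1 1 o f c₁ c₂ U) (hp : p = 0 ∨ p = 2) (hx : x ∈ U)
    (n₁ : 1 - c₁ x ^ 2 ≠ 0) (n₂ : 1 - c₂ x ^ 2 ≠ 0) : 1 < |c₁ x| ∧ 1 < |c₂ x| := by
  have hd : disc p = 1 := by
    rcases hp with rfl | rfl
    · exact disc_zero
    · exact disc_two
  have hE : 0 < met p f 0 0 x := by simpa using h.pos x hx
  obtain ⟨T1, T2⟩ := h.energy_eq hx
  have hprod : 1 ≤ (c₁ x * c₂ x) ^ 2 := by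
    rw [hd] at T1 T2
    rcases hp with rfl | rfl
    · have q : 0 ≤ energy 0 1 (fun y => (f y).2) x := by
        unfold energy
        rw [one_mul]
        exact add_nonneg (ip_zero_definite _).1 (ip_zero_definite _).1
      rw [T2] at q
      have : 1 ≤ c₁ x * c₂ x := by
        by_contra! hc
        nlinarith [mul_pos hE (sub_pos.2 hc)]
      nlinarith
    · have t := fun i => ip_pd_eq_zero h.isOpen h.smooth_fst h.mem_fst hx i
      have q : 0 ≤ -energy 2 1 (fun y => (f y).1) x := by
        unfold energy
        have a0 := (ip_two_definite (h.mem_fst x hx) (t 0)).1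
        have a1 := (ip_two_definite (h.mem_fst x hx) (t 1)).1
        linarith
      rw [T1] at q
      have : c₁ x * c₂ x ≤ -1 := by
        by_contra! hc
        nlinarith [mul_pos hE (sub_pos.2 hc)]
      nlinarith
  have hR : 0 ≤ (1 - c₁ x ^ 2) * (1 - c₂ x ^ 2) := by
    have hg := (h.harmonic_fst h.eps_sq h.isOpen).gram_jac h.isOpen hx
    have e : met p f 0 0 x ^ 2 * ((1 - c₁ x ^ 2) * (1 - c₂ x ^ 2))
        = energy p 1 (fun y => (f y).1) x ^ 2 - 4 * jac (fun y => (f y).1) x ^ 2 := by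
      rw [T1, (h.jac_eq hx).1, hd]
      linear_combination met p f 0 0 x ^ 2 * (c₁ x + c₂ x) ^ 2 * h.sign_sq
    rw [hd, one_mul] at hg
    rw [hg] at e
    -- After the Gram identity this is (|φ_x|² - |φ_y|²)² + 4⟨φ_x, φ_y⟩².
    have q : 0 ≤ met p f 0 0 x ^ 2 * ((1 - c₁ x ^ 2) * (1 - c₂ x ^ 2)) := by
      rw [e, energy]
      nlinarith [sq_nonneg (ip p (pd 0 (fun y => (f y).1) x) (pd 0 (fun y => (f y).1) x)
        - ip p (pd 1 (fun y => (f y).1) x) (pd 1 (fun y => (f y).1) x)),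
        sq_nonneg (ip p (pd 0 (fun y => (f y).1) x) (pd 1 (fun y => (f y).1) x))]
    exact nonneg_of_mul_nonneg_right q (by positivity)
  rw [mul_pow] at hprod
  have key : ∀ a b : ℝ, 1 - a ^ 2 ≠ 0 → 0 ≤ (1 - a ^ 2) * (1 - b ^ 2) → 1 ≤ a ^ 2 * b ^ 2 →
      1 < |a| := by
    intro a b ha hab h1
    rw [← one_lt_sq_iff_one_lt_abs]
    by_contra! hc
    have ha' : 0 < 1 - a ^ 2 := lt_of_le_of_ne (by linarith) ha.symm
    have hb := nonneg_of_mul_nonneg_right hab ha'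
    nlinarith [sq_nonneg a, sq_nonneg b]
  exact ⟨key _ _ n₁ hR hprod, key _ _ n₂ (by rwa [mul_comm]) (by rwa [mul_comm])⟩

lemma sin_gordon (h : IsKahlerPatch p ε σ o f c₁ c₂ U) (hδ : ε * disc p = -1) (hx : x ∈ U) :
    dzdzbar ε (fun y => vArctan (c₁ y) (c₂ y)) x
        + σ * (absJJ p ε f x / 4) * Real.sin (2 * vArctan (c₁ x) (c₂ x)) = 0 ∧
      dzdzbar ε (fun y => wArctan (c₁ y) (c₂ y)) x
        + -σ * (absJJ p ε f x / 4) * Real.sin (2 * wArctan (c₁ x) (c₂ x)) = 0 := by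
  have hne : ∀ c : ℝ, 1 - ε * disc p * c ^ 2 ≠ 0 := fun c => by
    rw [hδ]
    have : 0 < 1 - (-1) * c ^ 2 := by nlinarith [sq_nonneg c]
    exact this.ne'
  have hs : ∀ c : ℝ, 1 - ε * disc p * c ^ 2 = 1 + c ^ 2 := fun c => by rw [hδ]; ring
  constructor
  · refine h.gordon_fst (fun y _ => hne _) (fun y _ => hne _) (fun y hy i => ?_) hx ?_
    · rw [hs, hs]
      exact pd_vArctan (h.diff₁ y hy) (h.diff₂ y hy) i
    · rw [hs, hs]
      exact sin_vArctan _ _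
  · simp only [wArctan_eq_vArctan]
    refine h.gordon_snd (τ := 1) (by norm_num) (fun y _ => hne _) (fun y _ => hne _)
      (d₁ := c₁) (d₂ := fun y => -c₂ y) (fun y => by ring) (fun y => by ring)
      (fun y hy i => ?_) hx ?_
    · rw [hs, hs]
      exact pd_vArctan (h.diff₁ y hy) (h.diff₂ y hy).fun_neg i
    · rw [hs, hs]
      exact sin_vArctan _ _

end IsKahlerPatch

lemma ContMDiffAt.comp_pair {S : Type*} [TopologicalSpace S] [ChartedSpace Plane S]
    {C₁ C₂ : S → ℝ} (h₁ : ContMDiff (𝓡 2) 𝓘(ℝ, ℝ) ∞ C₁) (h₂ : ContMDiff (𝓡 2) 𝓘(ℝ, ℝ) ∞ C₂)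
    {V : ℝ × ℝ → ℝ} {q : S} (hV : ContDiffAt ℝ ∞ V (C₁ q, C₂ q)) :
    ContMDiffAt (𝓡 2) 𝓘(ℝ, ℝ) ∞ (fun q => V (C₁ q, C₂ q)) q :=
  hV.contMDiffAt.comp q ((h₁ q).prodMk_space (h₂ q))

end NeutralSurface

end

/-! ### Assembly of the four cases -/

open NeutralSurface in
theorem proposition11 {S : Type*} [TopologicalSpace S] [ChartedSpace (EuclideanSpace ℝ (Fin 2)) S]
    [IsManifold (𝓡 2) ∞ S] (p : ℕ)
    (A : Set (OpenPartialHomeomorph S (EuclideanSpace ℝ (Fin 2)))) (hA : IsOrientedAtlas A)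
    (F : S → (Fin 3 → ℝ) × (Fin 3 → ℝ)) (hF : IsImmersionInto p F) (hmin : IsMinimal p F)
    (hpts : ∀ q, ¬ IsComplexPoint p F q)
    (C₁ C₂ : S → ℝ) (hC : IsKahlerPair p A F C₁ C₂) :
    ((p = 0 ∨ p = 2) → IsRiemannian p F →
      ∃ v w : S → ℝ,
        (∀ q, v q = vLog (C₁ q) (C₂ q)) ∧ (∀ q, w q = wLog (C₁ q) (C₂ q)) ∧
        ContMDiff (𝓡 2) 𝓘(ℝ, ℝ) ∞ v ∧ ContMDiff (𝓡 2) 𝓘(ℝ, ℝ) ∞ w ∧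
        ∀ e, IsIsothermal p 1 1 F e → ∀ x ∈ e.target,
          ∀ l : ℝ, (l = 1 ∨ l = -1) → 0 < l * (C₁ (e.symm x) * C₂ (e.symm x)) →
            gordon p 1 F e l Real.sinh v x = 0 ∧ gordon p 1 F e l Real.sinh w x = 0) ∧
    (p = 1 → IsLorentzian p F →
      ∃ v w : S → ℝ,
        (∀ q, v q = vLog (C₁ q) (C₂ q)) ∧ (∀ q, w q = wLog (C₁ q) (C₂ q)) ∧
        ContMDiffOn (𝓡 2) 𝓘(ℝ, ℝ) ∞ v {q | |C₁ q| ≠ 1 ∧ |C₂ q| ≠ 1} ∧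
        ContMDiffOn (𝓡 2) 𝓘(ℝ, ℝ) ∞ w {q | |C₁ q| ≠ 1 ∧ |C₂ q| ≠ 1} ∧
        ∀ s : ℝ, (s = 1 ∨ s = -1) → ∀ e, IsIsothermal p (-1) s F e → ∀ x ∈ e.target,
          (|C₁ (e.symm x)| < 1 → |C₂ (e.symm x)| < 1 →
            gordon p (-1) F e s Real.sinh v x = 0 ∧
              gordon p (-1) F e (-s) Real.sinh w x = 0) ∧
          (1 < |C₁ (e.symm x)| → 1 < |C₂ (e.symm x)| →
            ∀ l : ℝ, (l = 1 ∨ l = -1) → 0 < l * (C₁ (e.symm x) * C₂ (e.symm x)) →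
              gordon p (-1) F e (s * l) Real.sinh v x = 0 ∧
                gordon p (-1) F e (s * l) Real.sinh w x = 0)) ∧
    (p = 1 → IsRiemannian p F →
      ∃ v w : S → ℝ,
        (∀ q, v q = vArctan (C₁ q) (C₂ q)) ∧ (∀ q, w q = wArctan (C₁ q) (C₂ q)) ∧
        ContMDiff (𝓡 2) 𝓘(ℝ, ℝ) ∞ v ∧ ContMDiff (𝓡 2) 𝓘(ℝ, ℝ) ∞ w ∧
        ∀ e, IsIsothermal p 1 1 F e → ∀ x ∈ e.target,
          gordon p 1 F e 1 Real.sin v x = 0 ∧ gordon p 1 F e (-1) Real.sin w x = 0) ∧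
    ((p = 0 ∨ p = 2) → IsLorentzian p F →
      ∃ v w : S → ℝ,
        (∀ q, v q = vArctan (C₁ q) (C₂ q)) ∧ (∀ q, w q = wArctan (C₁ q) (C₂ q)) ∧
        ContMDiff (𝓡 2) 𝓘(ℝ, ℝ) ∞ v ∧ ContMDiff (𝓡 2) 𝓘(ℝ, ℝ) ∞ w ∧
        ∀ s : ℝ, (s = 1 ∨ s = -1) → ∀ e, IsIsothermal p (-1) s F e → ∀ x ∈ e.target,
          gordon p (-1) F e s Real.sin v x = 0 ∧
            gordon p (-1) F e (-s) Real.sin w x = 0) := by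
  have hR0 : IsRiemannian p F → ∀ e ∈ Charts S, ∀ x ∈ e.target, metDet p (F ∘ e.symm) x ≠ 0 :=
    fun h e he x hx => (h.metDet_pos hF.smooth he hx).ne'
  have hL0 : IsLorentzian p F → ∀ e ∈ Charts S, ∀ x ∈ e.target, metDet p (F ∘ e.symm) x ≠ 0 :=
    fun h e he x hx => (h.metDet_neg hF.smooth he hx).ne
  have disc_even : p = 0 ∨ p = 2 → disc p = 1 := by
    rintro (rfl | rfl)
    · exact disc_zero
    · exact disc_two
  have vlog_smooth : ∀ {q : S}, ContMDiff (𝓡 2) 𝓘(ℝ, ℝ) ∞ C₁ → ContMDiff (𝓡 2) 𝓘(ℝ, ℝ) ∞ C₂ →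
      1 - C₁ q ^ 2 ≠ 0 → 1 - C₂ q ^ 2 ≠ 0 →
      ContMDiffAt (𝓡 2) 𝓘(ℝ, ℝ) ∞ (fun q => vLog (C₁ q) (C₂ q)) q ∧
        ContMDiffAt (𝓡 2) 𝓘(ℝ, ℝ) ∞ (fun q => wLog (C₁ q) (C₂ q)) q := by
    intro q s1 s2 h1 h2
    refine ⟨ContMDiffAt.comp_pair s1 s2 (contDiffAt_vLog h1 h2), ?_⟩
    simp only [wLog_eq_vLog]
    exact ContMDiffAt.comp_pair (V := fun c => vLog c.1 c.2) s1.neg s2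
      (contDiffAt_vLog (by simpa using h1) h2)
  have arctan_smooth : ContMDiff (𝓡 2) 𝓘(ℝ, ℝ) ∞ C₁ → ContMDiff (𝓡 2) 𝓘(ℝ, ℝ) ∞ C₂ →
      ContMDiff (𝓡 2) 𝓘(ℝ, ℝ) ∞ (fun q => vArctan (C₁ q) (C₂ q)) ∧
        ContMDiff (𝓡 2) 𝓘(ℝ, ℝ) ∞ (fun q => wArctan (C₁ q) (C₂ q)) := by
    intro s1 s2
    refine ⟨fun q => ContMDiffAt.comp_pair s1 s2 contDiff_vArctan.contDiffAt, fun q => ?_⟩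
    simp only [wArctan_eq_vArctan]
    exact ContMDiffAt.comp_pair (V := fun c => vArctan c.1 c.2) s1 s2.neg
      contDiff_vArctan.contDiffAt
  have sq_ne : ∀ c : ℝ, |c| ≠ 1 → 1 - c ^ 2 ≠ 0 := by
    intro c hc h
    exact hc (((sq_eq_sq_iff_abs_eq_abs c 1).1 (by linarith)).trans abs_one)
  have log_gt : ∀ {c₁ c₂ l : ℝ}, 1 < |c₁| → 1 < |c₂| → (l = 1 ∨ l = -1) → 0 < l * (c₁ * c₂) →
      -l * Real.sinh (2 * vLog (-c₁) c₂) * Real.sqrt |(1 - c₁ ^ 2) * (1 - c₂ ^ 2)|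
        = -c₁ + c₂ := by
    intro c₁ c₂ l h1 h2 hl h
    have := sinh_vLog_of_gt (c₁ := -c₁) (l := -l) (by rwa [abs_neg]) h2
      (by rcases hl with rfl | rfl <;> simp) (by linarith)
    rwa [neg_sq] at this
  refine ⟨fun hp hR => ?_, fun hp hL => ?_, fun hp hR => ?_, fun hp hL => ?_⟩
  · obtain ⟨s1, s2⟩ := hC.contMDiff hA hF.smooth (hR0 hR)
    have hne := one_sub_sq_ne_zero hA hp hF hR hpts hC
    refine ⟨fun q => vLog (C₁ q) (C₂ q), fun q => wLog (C₁ q) (C₂ q), fun _ => rfl, fun _ => rfl,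
      fun q => (vlog_smooth s1 s2 (hne q).1 (hne q).2).1,
      fun q => (vlog_smooth s1 s2 (hne q).1 (hne q).2).2, fun e he x hx l hl hlC => ?_⟩
    obtain ⟨U, o, hxU, hK, n1, n2⟩ := exists_isKahlerPatch hA hF hmin hC (hR0 hR)
      (by norm_num) (Or.inl rfl) he hx (δ := 1) (by rw [one_mul]; exact (hne _).1)
      (by rw [one_mul]; exact (hne _).2)
    obtain ⟨h1, h2⟩ := hK.one_lt_abs hp hxU (hne _).1 (hne _).2
    -- The pair for w is (-C₁, C₂), whose product has the opposite sign, hence -l. It cancels the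
    -- minus sign of the second factor, so v and w satisfy the same equation.
    have q := hK.sinh_gordon (by rw [disc_even hp, one_mul]) n1 n2 hxU (k := l) (l := -l)
      (sinh_vLog_of_gt h1 h2 hl hlC) (log_gt h1 h2 hl hlC)
    rw [neg_mul_neg, one_mul] at q
    exact q
  · obtain ⟨s1, s2⟩ := hC.contMDiff hA hF.smooth (hL0 hL)
    refine ⟨fun q => vLog (C₁ q) (C₂ q), fun q => wLog (C₁ q) (C₂ q), fun _ => rfl, fun _ => rfl,
      fun q hq => (vlog_smooth s1 s2 (sq_ne _ hq.1) (sq_ne _ hq.2)).1.contMDiffWithinAt,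
      fun q hq => (vlog_smooth s1 s2 (sq_ne _ hq.1) (sq_ne _ hq.2)).2.contMDiffWithinAt,
      fun s hs e he x hx => ⟨fun h1 h2 => ?_, fun h1 h2 l hl hlC => ?_⟩⟩
    · obtain ⟨U, o, hxU, hK, n1, n2⟩ := exists_isKahlerPatch hA hF hmin hC (hL0 hL)
        (by norm_num) hs he hx (δ := 1) (by rw [one_mul]; exact sq_ne _ h1.ne)
        (by rw [one_mul]; exact sq_ne _ h2.ne)
      -- For |C_k| < 1 no sign comes from sinh, so the minus sign of the second factor survives in
      -- the equation for w.
      have q := hK.sinh_gordon (by rw [hp, disc_one]; norm_num) n1 n2 hxU (k := 1) (l := 1)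
        (by rw [one_mul]; exact sinh_vLog_of_lt h1 h2)
        (by
          rw [one_mul, ← neg_sq ((C₁ ∘ e.symm) x)]
          exact sinh_vLog_of_lt (by rwa [abs_neg]) h2)
      rw [mul_one, mul_one] at q
      exact q
    · obtain ⟨U, o, hxU, hK, n1, n2⟩ := exists_isKahlerPatch hA hF hmin hC (hL0 hL)
        (by norm_num) hs he hx (δ := 1) (by rw [one_mul]; exact sq_ne _ h1.ne')
        (by rw [one_mul]; exact sq_ne _ h2.ne')
      have q := hK.sinh_gordon (by rw [hp, disc_one]; norm_num) n1 n2 hxU (k := l) (l := -l)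
        (sinh_vLog_of_gt h1 h2 hl hlC) (log_gt h1 h2 hl hlC)
      rw [neg_mul_neg] at q
      exact q
  · obtain ⟨s1, s2⟩ := hC.contMDiff hA hF.smooth (hR0 hR)
    refine ⟨fun q => vArctan (C₁ q) (C₂ q), fun q => wArctan (C₁ q) (C₂ q), fun _ => rfl,
      fun _ => rfl, (arctan_smooth s1 s2).1, (arctan_smooth s1 s2).2, fun e he x hx => ?_⟩
    -- Taking δ = 0 makes the nonvanishing conditions vacuous; the denominators needed here are 1 +
    -- C_k².
    obtain ⟨U, o, hxU, hK, -, -⟩ := exists_isKahlerPatch hA hF hmin hC (hR0 hR)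
      (by norm_num) (Or.inl rfl) he hx (δ := 0) (by simp) (by simp)
    exact hK.sin_gordon (by rw [hp, disc_one]; norm_num) hxU
  · obtain ⟨s1, s2⟩ := hC.contMDiff hA hF.smooth (hL0 hL)
    refine ⟨fun q => vArctan (C₁ q) (C₂ q), fun q => wArctan (C₁ q) (C₂ q), fun _ => rfl,
      fun _ => rfl, (arctan_smooth s1 s2).1, (arctan_smooth s1 s2).2, fun s hs e he x hx => ?_⟩
    obtain ⟨U, o, hxU, hK, -, -⟩ := exists_isKahlerPatch hA hF hmin hC (hL0 hL)
      (by norm_num) hs he hx (δ := 0) (by simp) (by simp)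
    exact hK.sin_gordon (by rw [disc_even hp]; norm_num) hxU
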